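/- Let $q\in(0,1)$. Let $\mathcal A=\mathcal O(SU_q(2))$ be the $*$-algebra generated by $a,b,c,d$ with relations $ab=qba$, $ac=qca$, $bd=qdb$, $cd=qdc$, $bc=cb$, $ad-qbc=1=da-q^{-1}bc$ and involution $a^*=d$, $b^*=-qc$. Let $h$ be its Haar state and let $\mathcal H_h$ be the GNS space, i.e. the Hilbert space completion of $\mathcal A$ for $\langle x,y\rangle=h(x^*y)$. Let $K,E,F$ be the unbounded operators on $\mathcal H_h$ with domain $\mathcal A$ given by the left action of the generators $k,e,f$ of $\mathcal U_q(su_2)$ on $\mathcal A$: $K$ is the algebra automorphism with $a\mapsto q^{1/2}a$, $b\mapsto q^{-1/2}b$, $c\mapsto q^{1/2}c$, $d\mapsto q^{-1/2}d$; $E$ and $F$ are determined by $E(xy)=E(x)K^{-1}(y)+K(x)E(y)$, $F(xy)=F(x)K^{-1}(y)+K(x)F(y)$ and $E:\ a,c\mapsto 0,\ b\mapsto a,\ d\mapsto c$, $F:\ b,d\mapsto 0,\ a\mapsto b,\ c\mapsto d$. On $\mathcal H=\mathcal H_h\oplus\mathcal H_h$ let $D_q$ be the closure of $$\begin{pmatrix}\dfrac{q^{-1}K^2-1}{q-q^{-1}}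 & EKq^{1/2}\\[2mm] FKq^{-1/2} & \dfrac{1-qK^2}{q-q^{-1}}\end{pmatrix}:\mathcal A\oplus\mathcal A\to\mathcal H ,$$ let $\mathcal H_n$, $n\in\frac12\mathbb Z$, be the eigenspace for the eigenvalue $q^n$ of the closure of $\operatorname{diag}(Kq^{-1/2},Kq^{1/2}):\mathcal A\oplus\mathcal A\to\mathcal H$, let $\mathcal M$ be the von Neumann algebra of all bounded operators $T$ on $\mathcal H$ with $T\mathcal H_n\subseteq\mathcal H_n$ for all $n$, and let $\Psi(T)=\sum_{n\in\frac12\mathbb Z}q^n\operatorname{Tr}(T|_{\mathcal H_n})$ for $T\in\mathcal M_+$, extended linearly to $\mathcal L^1(\mathcal M,\Psi)=\{T\in\mathcal M:\Psi(|T|)<\infty\}$. Then $D_q$ is selfadjoint with a bounded inverse, and $|D_q|^{-z}\in\mathcal L^1(\mathcal M,\Psi)$ whenever $\operatorname{Re}z>1/2$. The $q$-zeta function $\zeta_q(z)=\Psi(|D_q|^{-z})$ is holomorphic for $\operatorname{Re}z>1/2$. It has a meromorphic extension to $\mathbb C$ whose poles are exactly the points of $$P=\tfrac12-(\mathbb N\cup\{0\})+i\cdot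 2\pi\log(q)^{-1}\cdot\mathbb Z ,$$ each of them of order two, and the extension is given for all $z\in\mathbb C\setminus P$ by the convergent series $$\zeta_q(z)=(q^{-1}-q)^z\sum_{j=0}^\infty\binom{z+j-1}{j}\,\frac{\left(q^{z-1/2+j}+q^{j+1/2}\right)\left(1-q^{2j+z}\right)}{\left(1-q^{z-1/2+j}\right)^2\left(1-q^{j+1/2}\right)^2}.$$ -/

import Mathlib

open scoped ComplexConjugate InnerProductSpace

noncomputable section

namespace SUq2

/-! ## The coordinate algebra of quantum `SU(2)` -/

/-- The four generators of the coordinate algebra. -/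
inductive Gen
  | a | b | c | d

/-- The defining relations of the coordinate algebra, for four elements of a `ℂ`-algebra. -/
structure IsQuad (q : Set.Ioo (0 : ℝ) 1) {B : Type*} [Ring B] [Algebra ℂ B]
    (a b c d : B) : Prop where
  ab : a * b = ((q : ℝ) : ℂ) • (b * a)
  ac : a * c = ((q : ℝ) : ℂ) • (c * a)
  bd : b * d = ((q : ℝ) : ℂ) • (d * b)
  cd : c * d = ((q : ℝ) : ℂ) • (d * c)
  bc : b * c = c * b
  ad : a * d - ((q : ℝ) : ℂ) • (b * c) = 1
  da : d * a - ((q : ℝ) : ℂ)⁻¹ • (b * c) = 1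

open FreeAlgebra in
/-- The same relations, imposed on the generators of the free algebra. -/
inductive Rel (q : Set.Ioo (0 : ℝ) 1) : FreeAlgebra ℂ Gen → FreeAlgebra ℂ Gen → Prop
  | ab : Rel q (ι ℂ Gen.a * ι ℂ Gen.b) (algebraMap ℂ _ (q : ℝ) * (ι ℂ Gen.b * ι ℂ Gen.a))
  | ac : Rel q (ι ℂ Gen.a * ι ℂ Gen.c) (algebraMap ℂ _ (q : ℝ) * (ι ℂ Gen.c * ι ℂ Gen.a))
  | bd : Rel q (ι ℂ Gen.b * ι ℂ Gen.d) (algebraMap ℂ _ (q : ℝ) * (ι ℂ Gen.d * ι ℂ Gen.b))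
  | cd : Rel q (ι ℂ Gen.c * ι ℂ Gen.d) (algebraMap ℂ _ (q : ℝ) * (ι ℂ Gen.d * ι ℂ Gen.c))
  | bc : Rel q (ι ℂ Gen.b * ι ℂ Gen.c) (ι ℂ Gen.c * ι ℂ Gen.b)
  | ad : Rel q (ι ℂ Gen.a * ι ℂ Gen.d - algebraMap ℂ _ (q : ℝ) * (ι ℂ Gen.b * ι ℂ Gen.c)) 1
  | da : Rel q (ι ℂ Gen.d * ι ℂ Gen.a -
      algebraMap ℂ _ ((q : ℝ) : ℂ)⁻¹ * (ι ℂ Gen.b * ι ℂ Gen.c)) 1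

/-- The coordinate algebra `𝒜 = 𝒪(SU_q(2))`: the unital `ℂ`-algebra generated by `a, b, c, d`
subject to the relations above. -/
def CoordAlg (q : Set.Ioo (0 : ℝ) 1) : Type := RingQuot (Rel q)

instance (q : Set.Ioo (0 : ℝ) 1) : Ring (CoordAlg q) := inferInstanceAs (Ring (RingQuot (Rel q)))

instance (q : Set.Ioo (0 : ℝ) 1) : Algebra ℂ (CoordAlg q) :=
  inferInstanceAs (Algebra ℂ (RingQuot (Rel q)))

/-- The quotient map from the free algebra. -/
def mk (q : Set.Ioo (0 : ℝ) 1) : FreeAlgebra ℂ Gen →ₐ[ℂ] CoordAlg q :=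
  RingQuot.mkAlgHom ℂ (Rel q)

theorem mk_rel {q : Set.Ioo (0 : ℝ) 1} {x y : FreeAlgebra ℂ Gen} (h : Rel q x y) :
    mk q x = mk q y :=
  RingQuot.mkAlgHom_rel ℂ h

/-- The class of a generator in the coordinate algebra. -/
def gen (q : Set.Ioo (0 : ℝ) 1) (g : Gen) : CoordAlg q :=
  mk q (FreeAlgebra.ι ℂ g)

theorem isQuad_gen (q : Set.Ioo (0 : ℝ) 1) :
    IsQuad q (gen q Gen.a) (gen q Gen.b) (gen q Gen.c) (gen q Gen.d) := by
  constructor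
  · simpa [gen, Algebra.smul_def] using mk_rel (Rel.ab (q := q))
  · simpa [gen, Algebra.smul_def] using mk_rel (Rel.ac (q := q))
  · simpa [gen, Algebra.smul_def] using mk_rel (Rel.bd (q := q))
  · simpa [gen, Algebra.smul_def] using mk_rel (Rel.cd (q := q))
  · simpa [gen, Algebra.smul_def] using mk_rel (Rel.bc (q := q))
  · simpa [gen, Algebra.smul_def] using mk_rel (Rel.ad (q := q))
  · simpa [gen, Algebra.smul_def] using mk_rel (Rel.da (q := q))

/-- The image of a generator under a prescribed assignment. -/
def Gen.elim {B : Type*} (a b c d : B) : Gen → B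
  | .a => a
  | .b => b
  | .c => c
  | .d => d

/-- The universal property of the coordinate algebra. -/
def lift {q : Set.Ioo (0 : ℝ) 1} {B : Type*} [Ring B] [Algebra ℂ B] {a b c d : B}
    (h : IsQuad q a b c d) : CoordAlg q →ₐ[ℂ] B :=
  RingQuot.liftAlgHom ℂ ⟨FreeAlgebra.lift ℂ (Gen.elim a b c d), by
    intro x y hxy
    cases hxy
    · simpa [Gen.elim, Algebra.smul_def] using h.ab
    · simpa [Gen.elim, Algebra.smul_def] using h.ac
    · simpa [Gen.elim, Algebra.smul_def] using h.bd
    · simpa [Gen.elim, Algebra.smul_def] using h.cd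
    · simpa [Gen.elim, Algebra.smul_def] using h.bc
    · simpa [Gen.elim, Algebra.smul_def] using h.ad
    · simpa [Gen.elim, Algebra.smul_def] using h.da⟩

theorem lift_gen {q : Set.Ioo (0 : ℝ) 1} {B : Type*} [Ring B] [Algebra ℂ B] {a b c d : B}
    (h : IsQuad q a b c d) (g : Gen) : lift h (gen q g) = Gen.elim a b c d g := by
  unfold lift gen
  exact (RingQuot.liftAlgHom_mkAlgHom_apply _ _ _ _).trans (FreeAlgebra.lift_ι_apply _ _)

theorem coordAlg_induction {q : Set.Ioo (0 : ℝ) 1} {P : CoordAlg q → Prop}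
    (hs : ∀ z : ℂ, P (algebraMap ℂ _ z)) (hg : ∀ g, P (gen q g))
    (hm : ∀ x y, P x → P y → P (x * y)) (ha : ∀ x y, P x → P y → P (x + y))
    (x : CoordAlg q) : P x := by
  obtain ⟨y, rfl⟩ : ∃ y, mk q y = x := RingQuot.mkAlgHom_surjective ℂ (Rel q) x
  induction y using FreeAlgebra.induction with
  | grade0 r => simpa using hs r
  | grade1 g => exact hg g
  | mul x y hx hy => simpa using hm _ _ hx hy
  | add x y hx hy => simpa using ha _ _ hx hy

/-! ## The involution -/

/-- The conjugate-opposite of a complex algebra: the opposite ring, with `z` acting as the complex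
conjugate of `z`.  Algebra homomorphisms `B →ₐ[ℂ] ConjOp B'` are the conjugate-linear
anti-multiplicative maps from `B` to `B'`. -/
def ConjOp (B : Type*) : Type _ := Bᵐᵒᵖ

instance (B : Type*) [Ring B] : Ring (ConjOp B) := inferInstanceAs (Ring Bᵐᵒᵖ)

instance (B : Type*) [Ring B] [Algebra ℂ B] : Algebra ℂ (ConjOp B) :=
  RingHom.toAlgebra' (((algebraMap ℂ Bᵐᵒᵖ).comp (starRingEnd ℂ) : ℂ →+* Bᵐᵒᵖ)) (by
    intro z x
    exact Algebra.commutes (R := ℂ) (A := Bᵐᵒᵖ) (conj z) x)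

/-- The identity map from `B` to its conjugate-opposite. -/
def toConjOp {B : Type*} (x : B) : ConjOp B := MulOpposite.op x

/-- The identity map from the conjugate-opposite of `B` to `B`. -/
def ofConjOp {B : Type*} (x : ConjOp B) : B := MulOpposite.unop x

theorem toConjOp_mul {B : Type*} [Ring B] (x y : B) :
    toConjOp x * toConjOp y = toConjOp (y * x) := rfl

theorem toConjOp_sub {B : Type*} [Ring B] (x y : B) :
    toConjOp x - toConjOp y = toConjOp (x - y) := rfl

theorem toConjOp_smul {B : Type*} [Ring B] [Algebra ℂ B] (z : ℂ) (x : B) :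
    z • toConjOp x = toConjOp (conj z • x) := by
  rw [Algebra.smul_def (R := ℂ) (A := ConjOp B), Algebra.smul_def (R := ℂ) (A := B),
    Algebra.commutes (R := ℂ) (A := B)]
  rfl

theorem q_ne_zero (q : Set.Ioo (0 : ℝ) 1) : ((q : ℝ) : ℂ) ≠ 0 := by
  exact_mod_cast q.2.1.ne'

/-- The elements `a^* = d`, `b^* = -q c`, `c^* = -q⁻¹ b`, `d^* = a` satisfy the relations in the
conjugate-opposite algebra. -/
theorem isQuad_star (q : Set.Ioo (0 : ℝ) 1) :
    IsQuad q (toConjOp (gen q Gen.d)) (toConjOp (-((q : ℝ) : ℂ) • gen q Gen.c))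
      (toConjOp (-((q : ℝ) : ℂ)⁻¹ • gen q Gen.b)) (toConjOp (gen q Gen.a)) := by
  have hq := q_ne_zero q
  have h := isQuad_gen q
  have h1 : (1 : ConjOp (CoordAlg q)) = toConjOp 1 := rfl
  constructor <;>
    simp only [toConjOp_mul, toConjOp_smul, toConjOp_sub, map_inv₀, Complex.conj_ofReal, h1] <;>
    refine congrArg toConjOp ?_
  · simp [h.cd, smul_smul, -Complex.coe_smul]
  · simp [h.bd, smul_smul, mul_comm, -Complex.coe_smul]
  · simp [h.ac, smul_smul, -Complex.coe_smul]
  · simp [h.ab, smul_smul, mul_comm, -Complex.coe_smul]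
  · simp [h.bc, smul_smul, mul_comm, -Complex.coe_smul]
  · rw [← h.ad]; simp [h.bc, smul_smul, hq, -Complex.coe_smul]
  · rw [← h.da]; simp [h.bc, smul_smul, hq, -Complex.coe_smul]

/-- The involution, as a homomorphism to the conjugate-opposite algebra. -/
def starHom (q : Set.Ioo (0 : ℝ) 1) : CoordAlg q →ₐ[ℂ] ConjOp (CoordAlg q) :=
  lift (isQuad_star q)

instance (q : Set.Ioo (0 : ℝ) 1) : Star (CoordAlg q) := ⟨fun x => ofConjOp (starHom q x)⟩

theorem star_def (q : Set.Ioo (0 : ℝ) 1) (x : CoordAlg q) : star x = ofConjOp (starHom q x) := rfl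

theorem coord_star_mul (q : Set.Ioo (0 : ℝ) 1) (x y : CoordAlg q) :
    star (x * y) = star y * star x := by
  simp only [star_def, map_mul]; rfl

theorem coord_star_add (q : Set.Ioo (0 : ℝ) 1) (x y : CoordAlg q) :
    star (x + y) = star x + star y := by
  simp only [star_def, map_add]; rfl

theorem coord_star_algebraMap (q : Set.Ioo (0 : ℝ) 1) (z : ℂ) :
    star (algebraMap ℂ (CoordAlg q) z) = algebraMap ℂ (CoordAlg q) (conj z) := by
  simp only [star_def, AlgHom.commutes]; rfl

theorem star_gen (q : Set.Ioo (0 : ℝ) 1) (g : Gen) : star (gen q g) =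
    Gen.elim (gen q Gen.d) (-((q : ℝ) : ℂ) • gen q Gen.c) (-((q : ℝ) : ℂ)⁻¹ • gen q Gen.b)
      (gen q Gen.a) g := by
  rw [star_def, starHom, lift_gen]
  cases g <;> rfl

theorem coord_star_smul (q : Set.Ioo (0 : ℝ) 1) (z : ℂ) (x : CoordAlg q) :
    star (z • x) = conj z • star x := by
  rw [Algebra.smul_def, coord_star_mul, coord_star_algebraMap, Algebra.smul_def, Algebra.commutes]

/-- The `*`-algebra structure of the coordinate algebra. -/
instance (q : Set.Ioo (0 : ℝ) 1) : StarRing (CoordAlg q) where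
  star_involutive := by
    intro x
    induction x using coordAlg_induction with
    | hs z => simp [coord_star_algebraMap]
    | hg g =>
      have hq := q_ne_zero q
      cases g <;> simp [star_gen, Gen.elim, coord_star_smul, -neg_smul, smul_smul, hq]
    | hm x y hx hy => rw [coord_star_mul, coord_star_mul, hx, hy]
    | ha x y hx hy => rw [coord_star_add, coord_star_add, hx, hy]
  star_mul := coord_star_mul q
  star_add := coord_star_add q

instance (q : Set.Ioo (0 : ℝ) 1) : StarModule ℂ (CoordAlg q) := ⟨coord_star_smul q⟩

/-! ## The left action of the quantized enveloping algebra

The action of the generators `k`, `e`, `f` of `𝒰_q(su_2)` on `𝒜`.  It is determined by its values on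
the generators, by `∂_k` being an algebra automorphism, and by the twisted Leibniz rules
`∂_e (x y) = ∂_e x ∂_{k⁻¹} y + ∂_k x ∂_e y` and `∂_f (x y) = ∂_f x ∂_{k⁻¹} y + ∂_k x ∂_f y`.
A map `δ` satisfies such a rule exactly when `x ↦ !![∂_k x, δ x; 0, ∂_{k⁻¹} x]` is multiplicative. -/

/-- The complex number `q^{1/2}`. -/
def sqrtQ (q : Set.Ioo (0 : ℝ) 1) : ℂ := ((Real.sqrt (q : ℝ) : ℝ) : ℂ)

theorem sqrtQ_mul_self (q : Set.Ioo (0 : ℝ) 1) : ((q : ℝ) : ℂ) = sqrtQ q * sqrtQ q := by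
  rw [sqrtQ, ← Complex.ofReal_mul, Real.mul_self_sqrt q.2.1.le]

theorem sqrtQ_ne_zero (q : Set.Ioo (0 : ℝ) 1) : sqrtQ q ≠ 0 := by
  intro h
  apply q_ne_zero q
  rw [sqrtQ_mul_self, h, mul_zero]

theorem isQuad_actK (q : Set.Ioo (0 : ℝ) 1) :
    IsQuad q (sqrtQ q • gen q Gen.a) ((sqrtQ q)⁻¹ • gen q Gen.b)
      (sqrtQ q • gen q Gen.c) ((sqrtQ q)⁻¹ • gen q Gen.d) := by
  have hq := sqrtQ_ne_zero q
  have h := isQuad_gen q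
  constructor
  · simp [h.ab, smul_smul, mul_comm, hq, -Complex.coe_smul]
  · simp only [h.ac, smul_mul_smul_comm, smul_smul]; match_scalars; ring
  · simp only [h.bd, smul_mul_smul_comm, smul_smul]; match_scalars; ring
  · simp [h.cd, smul_smul, mul_comm, hq, -Complex.coe_smul]
  · simp [h.bc, smul_smul, hq, -Complex.coe_smul]
  · rw [← h.ad]; simp [smul_smul, hq, -Complex.coe_smul]
  · rw [← h.da]; simp [smul_smul, hq, -Complex.coe_smul]

/-- The automorphism `∂_k`, with `a ↦ q^{1/2} a`, `b ↦ q^{-1/2} b`, `c ↦ q^{1/2} c`,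
`d ↦ q^{-1/2} d`. -/
def actK (q : Set.Ioo (0 : ℝ) 1) : CoordAlg q →ₐ[ℂ] CoordAlg q := lift (isQuad_actK q)

theorem isQuad_actE (q : Set.Ioo (0 : ℝ) 1) :
    IsQuad q (B := Matrix (Fin 2) (Fin 2) (CoordAlg q))
      !![sqrtQ q • gen q Gen.a, 0; 0, (sqrtQ q)⁻¹ • gen q Gen.a]
      !![(sqrtQ q)⁻¹ • gen q Gen.b, gen q Gen.a; 0, sqrtQ q • gen q Gen.b]
      !![sqrtQ q • gen q Gen.c, 0; 0, (sqrtQ q)⁻¹ • gen q Gen.c]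
      !![(sqrtQ q)⁻¹ • gen q Gen.d, gen q Gen.c; 0, sqrtQ q • gen q Gen.d] := by
  have hq := sqrtQ_ne_zero q
  have h := isQuad_gen q
  have had := sub_eq_iff_eq_add.mp h.ad
  have hda := sub_eq_iff_eq_add.mp h.da
  have hab := h.ab
  have hac := h.ac
  have hbd := h.bd
  have hcd := h.cd
  have hbc := h.bc
  simp only [sqrtQ_mul_self, hbc] at had hda hab hac hbd hcd
  constructor <;> try simp only [sqrtQ_mul_self]
  all_goals
    ext i j
    fin_cases i <;> fin_cases j <;>
    simp [Matrix.mul_apply, Fin.sum_univ_two, smul_smul, had, hda, hab, hac, hbd, hcd, hbc, hq,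
      -Complex.coe_smul]
  all_goals (match_scalars <;> field_simp <;> ring)

theorem isQuad_actF (q : Set.Ioo (0 : ℝ) 1) :
    IsQuad q (B := Matrix (Fin 2) (Fin 2) (CoordAlg q))
      !![sqrtQ q • gen q Gen.a, gen q Gen.b; 0, (sqrtQ q)⁻¹ • gen q Gen.a]
      !![(sqrtQ q)⁻¹ • gen q Gen.b, 0; 0, sqrtQ q • gen q Gen.b]
      !![sqrtQ q • gen q Gen.c, gen q Gen.d; 0, (sqrtQ q)⁻¹ • gen q Gen.c]
      !![(sqrtQ q)⁻¹ • gen q Gen.d, 0; 0, sqrtQ q • gen q Gen.d] := by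
  have hq := sqrtQ_ne_zero q
  have h := isQuad_gen q
  have had := sub_eq_iff_eq_add.mp h.ad
  have hda := sub_eq_iff_eq_add.mp h.da
  have hab := h.ab
  have hac := h.ac
  have hbd := h.bd
  have hcd := h.cd
  have hbc := h.bc
  simp only [sqrtQ_mul_self, hbc] at had hda hab hac hbd hcd
  constructor <;> try simp only [sqrtQ_mul_self]
  all_goals
    ext i j
    fin_cases i <;> fin_cases j <;>
    simp [Matrix.mul_apply, Fin.sum_univ_two, smul_smul, had, hda, hab, hac, hbd, hcd, hbc, hq,
      -Complex.coe_smul]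
  all_goals (match_scalars <;> field_simp <;> ring)

/-- The map `∂_e`, with `a ↦ 0`, `b ↦ a`, `c ↦ 0`, `d ↦ c`. -/
def actE (q : Set.Ioo (0 : ℝ) 1) : CoordAlg q →ₗ[ℂ] CoordAlg q :=
  Matrix.entryLinearMap ℂ (CoordAlg q) 0 1 ∘ₗ (lift (isQuad_actE q)).toLinearMap

/-- The map `∂_f`, with `a ↦ b`, `b ↦ 0`, `c ↦ d`, `d ↦ 0`. -/
def actF (q : Set.Ioo (0 : ℝ) 1) : CoordAlg q →ₗ[ℂ] CoordAlg q :=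
  Matrix.entryLinearMap ℂ (CoordAlg q) 0 1 ∘ₗ (lift (isQuad_actF q)).toLinearMap

/-! ## The Haar state

Let `𝒜` act on the space with basis `e_{n,k}`, `n ∈ ℕ`, `k ∈ ℤ`, by
`a e_{n,k} = (1 - q^{2n})^{1/2} e_{n-1,k}`, `d e_{n,k} = (1 - q^{2n+2})^{1/2} e_{n+1,k}`,
`c e_{n,k} = q^n e_{n,k+1}`, `b e_{n,k} = -q^{n+1} e_{n,k-1}`.
The Haar state is `h(x) = (1 - q²) ∑ₙ q^{2n} ⟨e_{n,0}, x e_{n,0}⟩`. -/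

/-- Finitely supported vectors in `ℓ²(ℕ × ℤ)`. -/
abbrev Fock : Type := ℕ × ℤ →₀ ℂ

/-- The linear map with `e_p ↦ w p • e_{f p}`. -/
def weighted (w : ℕ × ℤ → ℝ) (f : ℕ × ℤ → ℕ × ℤ) : Module.End ℂ Fock :=
  Finsupp.linearCombination ℂ (fun p => Finsupp.single (f p) ((w p : ℝ) : ℂ))

theorem weighted_single (w : ℕ × ℤ → ℝ) (f : ℕ × ℤ → ℕ × ℤ) (p : ℕ × ℤ) (z : ℂ) :
    weighted w f (Finsupp.single p z) = Finsupp.single (f p) (z * (w p : ℝ)) := by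
  simp [weighted, Finsupp.linearCombination_single]

/-- The operator by which `a` acts. -/
def repA (q : Set.Ioo (0 : ℝ) 1) : Module.End ℂ Fock :=
  weighted (fun p => Real.sqrt (1 - (q : ℝ) ^ (2 * p.1))) (fun p => (p.1 - 1, p.2))

/-- The operator by which `b` acts. -/
def repB (q : Set.Ioo (0 : ℝ) 1) : Module.End ℂ Fock :=
  weighted (fun p => -(q : ℝ) ^ (p.1 + 1)) (fun p => (p.1, p.2 - 1))

/-- The operator by which `c` acts. -/
def repC (q : Set.Ioo (0 : ℝ) 1) : Module.End ℂ Fock :=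
  weighted (fun p => (q : ℝ) ^ p.1) (fun p => (p.1, p.2 + 1))

/-- The operator by which `d` acts. -/
def repD (q : Set.Ioo (0 : ℝ) 1) : Module.End ℂ Fock :=
  weighted (fun p => Real.sqrt (1 - (q : ℝ) ^ (2 * (p.1 + 1)))) (fun p => (p.1 + 1, p.2))

theorem one_sub_pow_nonneg (q : Set.Ioo (0 : ℝ) 1) (n : ℕ) : 0 ≤ 1 - (q : ℝ) ^ n :=
  sub_nonneg.mpr (pow_le_one₀ q.2.1.le q.2.2.le)

theorem isQuad_rep (q : Set.Ioo (0 : ℝ) 1) :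
    IsQuad q (repA q) (repB q) (repC q) (repD q) := by
  have hq := q_ne_zero q
  have hs : ∀ n : ℕ, ((Real.sqrt (1 - (q : ℝ) ^ n) : ℝ) : ℂ) *
      ((Real.sqrt (1 - (q : ℝ) ^ n) : ℝ) : ℂ) = 1 - ((q : ℝ) : ℂ) ^ n := by
    intro n
    rw [← Complex.ofReal_mul, Real.mul_self_sqrt (one_sub_pow_nonneg q n)]
    push_cast; rfl
  constructor <;> refine Finsupp.lhom_ext fun p z => ?_ <;> obtain ⟨n, k⟩ := p <;>
    simp only [Module.End.mul_apply, LinearMap.smul_apply, LinearMap.sub_apply,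
      Module.End.one_apply, repA, repB, repC, repD, weighted_single, Finsupp.smul_single,
      smul_eq_mul, sub_add_cancel, add_sub_cancel_right, Nat.add_sub_cancel]
  · rcases n with _ | n
    · simp
    · congr 1
      push_cast; ring
  · rcases n with _ | n
    · simp
    · congr 1
      push_cast; ring
  · congr 1
    push_cast; ring
  · congr 1
    push_cast; ring
  · congr 1
    push_cast; ring
  · rw [← Finsupp.single_sub]
    congr 1
    have := hs (2 * (n + 1))
    push_cast
    linear_combination z * this
  · rcases n with _ | n
    · have h0 : Real.sqrt (1 - (q : ℝ) ^ (2 * 0)) = 0 := by simp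
      rw [h0]
      simp only [Complex.ofReal_zero, mul_zero, zero_mul, Finsupp.single_zero, zero_sub]
      rw [← Finsupp.single_neg]
      congr 1
      push_cast
      field_simp
    · simp only [Nat.add_sub_cancel]
      rw [← Finsupp.single_sub]
      congr 1
      have := hs (2 * (n + 1))
      have hqq := inv_mul_cancel₀ hq
      push_cast
      linear_combination z * this + z * ((q : ℝ) : ℂ) ^ (2 * (n + 1)) * hqq

/-- The representation of the coordinate algebra on finitely supported vectors. -/
def rep (q : Set.Ioo (0 : ℝ) 1) : CoordAlg q →ₐ[ℂ] Module.End ℂ Fock := lift (isQuad_rep q)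

theorem rep_gen (q : Set.Ioo (0 : ℝ) 1) (g : Gen) :
    rep q (gen q g) = Gen.elim (repA q) (repB q) (repC q) (repD q) g := lift_gen _ _

/-- The `ℓ¹` norm of a finitely supported vector. -/
def norm1 (u : Fock) : ℝ := u.sum fun _ z => ‖z‖

theorem norm1_single (p : ℕ × ℤ) (z : ℂ) : norm1 (Finsupp.single p z) = ‖z‖ := by
  simp [norm1]

theorem norm1_add_le (u v : Fock) : norm1 (u + v) ≤ norm1 u + norm1 v := by
  classical
  unfold norm1
  rw [Finsupp.sum_of_support_subset (u + v) Finsupp.support_add _ (by simp),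
    Finsupp.sum_of_support_subset u Finset.subset_union_left _ (by simp),
    Finsupp.sum_of_support_subset v Finset.subset_union_right _ (by simp),
    ← Finset.sum_add_distrib]
  exact Finset.sum_le_sum fun i _ => norm_add_le _ _

theorem norm1_smul (z : ℂ) (u : Fock) : norm1 (z • u) = ‖z‖ * norm1 u := by
  unfold norm1
  rw [Finsupp.sum_smul_index' (by simp), Finsupp.mul_sum]
  simp

theorem norm_apply_le_norm1 (u : Fock) (p : ℕ × ℤ) : ‖u p‖ ≤ norm1 u := by
  classical
  by_cases hp : p ∈ u.support
  · exact Finset.single_le_sum (f := fun i => ‖u i‖) (fun _ _ => norm_nonneg _) hp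
  · rw [Finsupp.notMem_support_iff.mp hp, norm_zero]
    exact Finset.sum_nonneg fun _ _ => norm_nonneg _

theorem norm1_weighted_le {w : ℕ × ℤ → ℝ} (f : ℕ × ℤ → ℕ × ℤ) (hw : ∀ p, |w p| ≤ 1) (u : Fock) :
    norm1 (weighted w f u) ≤ norm1 u := by
  induction u using Finsupp.induction with
  | zero => simp [norm1]
  | single_add p z u hp hz ih =>
    have h1 : norm1 (Finsupp.single p z + u) = ‖z‖ + norm1 u := by
      unfold norm1
      rw [Finsupp.sum_add_index_of_disjoint]
      · simp
      · classical
        refine Finset.disjoint_of_subset_left Finsupp.support_single_subset ?_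
        exact Finset.disjoint_singleton_left.mpr hp
    rw [map_add, h1, weighted_single]
    refine (norm1_add_le _ _).trans (add_le_add ?_ ih)
    rw [norm1_single, norm_mul, Complex.norm_real, Real.norm_eq_abs]
    exact mul_le_of_le_one_right (norm_nonneg _) (hw p)

theorem exists_norm1_rep_le (q : Set.Ioo (0 : ℝ) 1) (x : CoordAlg q) :
    ∃ C : ℝ, 0 ≤ C ∧ ∀ u, norm1 (rep q x u) ≤ C * norm1 u := by
  have hpow : ∀ n : ℕ, |(q : ℝ) ^ n| ≤ 1 := fun n => by
    rw [abs_of_nonneg (pow_nonneg q.2.1.le n)]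
    exact pow_le_one₀ q.2.1.le q.2.2.le
  have hsq : ∀ n : ℕ, |Real.sqrt (1 - (q : ℝ) ^ n)| ≤ 1 := fun n => by
    rw [abs_of_nonneg (Real.sqrt_nonneg _)]
    exact Real.sqrt_le_one.mpr (by linarith [pow_nonneg q.2.1.le n])
  induction x using coordAlg_induction with
  | hs z =>
    refine ⟨‖z‖, norm_nonneg _, fun u => ?_⟩
    rw [AlgHom.commutes, Module.algebraMap_end_apply, norm1_smul]
  | hg g =>
    refine ⟨1, zero_le_one, fun u => ?_⟩
    rw [rep_gen, one_mul]
    cases g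
    · exact norm1_weighted_le _ (fun p => hsq _) u
    · exact norm1_weighted_le _ (fun p => by rw [abs_neg]; exact hpow _) u
    · exact norm1_weighted_le _ (fun p => hpow _) u
    · exact norm1_weighted_le _ (fun p => hsq _) u
  | hm x y hx hy =>
    obtain ⟨C, hC, hx⟩ := hx
    obtain ⟨C', hC', hy⟩ := hy
    refine ⟨C * C', mul_nonneg hC hC', fun u => ?_⟩
    rw [map_mul, Module.End.mul_apply, mul_assoc]
    exact (hx _).trans (mul_le_mul_of_nonneg_left (hy u) hC)
  | ha x y hx hy =>
    obtain ⟨C, hC, hx⟩ := hx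
    obtain ⟨C', hC', hy⟩ := hy
    refine ⟨C + C', add_nonneg hC hC', fun u => ?_⟩
    rw [map_add, LinearMap.add_apply, add_mul]
    exact (norm1_add_le _ _).trans (add_le_add (hx u) (hy u))

/-- The `n`-th term of the series defining the Haar state. -/
def haarTerm (q : Set.Ioo (0 : ℝ) 1) (x : CoordAlg q) (n : ℕ) : ℂ :=
  (((q : ℝ) ^ (2 * n) : ℝ) : ℂ) * rep q x (Finsupp.single ((n : ℕ), (0 : ℤ)) 1) (n, 0)

theorem summable_haarTerm (q : Set.Ioo (0 : ℝ) 1) (x : CoordAlg q) :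
    Summable (haarTerm q x) := by
  obtain ⟨C, hC, hx⟩ := exists_norm1_rep_le q x
  have hg : Summable fun n : ℕ => ((q : ℝ) ^ 2) ^ n * C :=
    (summable_geometric_of_lt_one (by positivity) (pow_lt_one₀ q.2.1.le q.2.2 two_ne_zero)).mul_right
      C
  refine Summable.of_norm_bounded hg fun n => ?_
  rw [haarTerm, norm_mul, Complex.norm_real, Real.norm_eq_abs,
    abs_of_nonneg (pow_nonneg q.2.1.le _), pow_mul]
  refine mul_le_mul_of_nonneg_left ?_ (by positivity)
  refine (norm_apply_le_norm1 _ _).trans ((hx _).trans ?_)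
  rw [norm1_single, norm_one, mul_one]

/-- The Haar state `h` on the coordinate algebra. -/
def haar (q : Set.Ioo (0 : ℝ) 1) : CoordAlg q →ₗ[ℂ] ℂ where
  toFun x := (((1 - (q : ℝ) ^ 2 : ℝ)) : ℂ) * ∑' n, haarTerm q x n
  map_add' x y := by
    have h : haarTerm q (x + y) = fun n => haarTerm q x n + haarTerm q y n := by
      funext n
      simp [haarTerm, mul_add]
    rw [h, (summable_haarTerm q x).tsum_add (summable_haarTerm q y), mul_add]
  map_smul' z x := by
    have h : haarTerm q (z • x) = fun n => z * haarTerm q x n := by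
      funext n
      simp [haarTerm, mul_left_comm]
    rw [h, tsum_mul_left, RingHom.id_apply, smul_eq_mul, mul_left_comm]

/-- The standard sesquilinear pairing of finitely supported vectors. -/
def pairing (u v : Fock) : ℂ := u.sum fun p z => conj z * v p

theorem pairing_add_left (u u' v : Fock) : pairing (u + u') v = pairing u v + pairing u' v := by
  classical
  exact Finsupp.sum_add_index' (by simp) (by intros; simp [add_mul])

theorem pairing_smul_left (z : ℂ) (u v : Fock) : pairing (z • u) v = conj z * pairing u v := by
  unfold pairing
  rw [Finsupp.sum_smul_index' (by simp), Finsupp.mul_sum]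
  simp [mul_assoc]

theorem pairing_add_right (u v v' : Fock) : pairing u (v + v') = pairing u v + pairing u v' := by
  simp [pairing, mul_add, Finsupp.sum_add]

theorem pairing_smul_right (z : ℂ) (u v : Fock) : pairing u (z • v) = z * pairing u v := by
  unfold pairing
  rw [Finsupp.mul_sum]
  simp [mul_left_comm]

theorem pairing_single_left (p : ℕ × ℤ) (v : Fock) : pairing (Finsupp.single p 1) v = v p := by
  simp [pairing]

theorem pairing_conj (u v : Fock) : conj (pairing u v) = pairing v u := by
  classical
  unfold pairing
  rw [Finsupp.sum_of_support_subset u (Finset.subset_union_left (s₂ := v.support)) _ (by simp),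
    Finsupp.sum_of_support_subset v (Finset.subset_union_right (s₁ := u.support)) _ (by simp),
    map_sum]
  simp [mul_comm]

theorem pairing_self_nonneg (u : Fock) : 0 ≤ (pairing u u).re := by
  unfold pairing
  rw [Finsupp.sum, Complex.re_sum]
  refine Finset.sum_nonneg fun p _ => ?_
  rw [← Complex.normSq_eq_conj_mul_self, Complex.ofReal_re]
  exact Complex.normSq_nonneg _

theorem pairing_weighted {w w' : ℕ × ℤ → ℝ} {f f' : ℕ × ℤ → ℕ × ℤ} (t : ℝ)
    (h : ∀ p r, (if f p = r then t * w p else 0) = if f' r = p then w' r else 0) (u v : Fock) :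
    (t : ℂ) * pairing (weighted w f u) v = pairing u (weighted w' f' v) := by
  classical
  induction u using Finsupp.induction_linear with
  | zero => simp [pairing]
  | add u u' hu hu' => rw [map_add, pairing_add_left, pairing_add_left, mul_add, hu, hu']
  | single p z =>
    induction v using Finsupp.induction_linear with
    | zero => simp [pairing]
    | add v v' hv hv' => rw [map_add, pairing_add_right, pairing_add_right, mul_add, hv, hv']
    | single r y =>
      have h' := congrArg (fun t : ℝ => (t : ℂ)) (h p r)
      simp only [weighted_single, pairing, Finsupp.single_apply, eq_comm (a := r)] at h' ⊢
      rw [Finsupp.sum_single_index (by simp), Finsupp.sum_single_index (by simp), map_mul,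
        Complex.conj_ofReal]
      by_cases h1 : f p = r <;> by_cases h2 : f' r = p <;>
        simp only [h1, h2, if_true, if_false, Complex.ofReal_zero, Complex.ofReal_mul] at h' ⊢
      · linear_combination conj z * y * h'
      · linear_combination conj z * y * h'
      · linear_combination conj z * y * h'
      · simp

theorem pairing_repD (q : Set.Ioo (0 : ℝ) 1) (u v : Fock) :
    pairing (repD q u) v = pairing u (repA q v) := by
  have := pairing_weighted (w := fun p => Real.sqrt (1 - (q : ℝ) ^ (2 * (p.1 + 1))))
    (w' := fun p => Real.sqrt (1 - (q : ℝ) ^ (2 * p.1))) (f := fun p => (p.1 + 1, p.2))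
    (f' := fun p => (p.1 - 1, p.2)) 1 (by
      rintro ⟨n, k⟩ ⟨m, l⟩
      rcases m with _ | m
      · simp
      · by_cases hnm : n = m
        · subst hnm
          simp [eq_comm]
        · simp [hnm, Ne.symm hnm]) u v
  rw [Complex.ofReal_one, one_mul] at this
  exact this

theorem pairing_repC (q : Set.Ioo (0 : ℝ) 1) (u v : Fock) :
    -((q : ℝ) : ℂ) * pairing (repC q u) v = pairing u (repB q v) := by
  have := pairing_weighted (w := fun p => (q : ℝ) ^ p.1)
    (w' := fun p => -(q : ℝ) ^ (p.1 + 1)) (f := fun p => (p.1, p.2 + 1))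
    (f' := fun p => (p.1, p.2 - 1)) (-(q : ℝ)) (by
      rintro ⟨n, k⟩ ⟨m, l⟩
      by_cases hnm : n = m
      · subst hnm
        have hkl : k + 1 = l ↔ l - 1 = k := by omega
        simp [hkl, pow_succ']
      · simp [hnm, Ne.symm hnm]) u v
  rw [Complex.ofReal_neg] at this
  exact this

theorem pairing_rep_star (q : Set.Ioo (0 : ℝ) 1) (x : CoordAlg q) :
    ∀ u v, pairing (rep q (star x) u) v = pairing u (rep q x v) := by
  induction x using coordAlg_induction with
  | hs z =>
    intro u v
    rw [coord_star_algebraMap, AlgHom.commutes, AlgHom.commutes, Module.algebraMap_end_apply,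
      Module.algebraMap_end_apply, pairing_smul_left, pairing_smul_right, Complex.conj_conj]
  | hg g =>
    intro u v
    rw [star_gen, rep_gen]
    cases g <;> simp only [Gen.elim, map_smul, rep_gen, LinearMap.smul_apply, pairing_smul_left]
    · exact pairing_repD q u v
    · rw [map_neg, Complex.conj_ofReal]
      exact pairing_repC q u v
    · have h := congrArg conj (pairing_repC q v u)
      rw [map_mul, pairing_conj, pairing_conj, map_neg, Complex.conj_ofReal] at h
      rw [← h, map_neg, map_inv₀, Complex.conj_ofReal, neg_mul, neg_mul, mul_neg, neg_neg,
        inv_mul_cancel_left₀ (q_ne_zero q)]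
    · have h := congrArg conj (pairing_repD q v u)
      rw [pairing_conj, pairing_conj] at h
      exact h.symm
  | hm x y hx hy =>
    intro u v
    rw [coord_star_mul, map_mul, map_mul, Module.End.mul_apply, Module.End.mul_apply, hy, hx]
  | ha x y hx hy =>
    intro u v
    rw [coord_star_add, map_add, map_add, LinearMap.add_apply, LinearMap.add_apply,
      pairing_add_left, pairing_add_right, hx, hy]

theorem haar_star_mul (q : Set.Ioo (0 : ℝ) 1) (x y : CoordAlg q) :
    haar q (star x * y) = (((1 - (q : ℝ) ^ 2 : ℝ)) : ℂ) * ∑' n : ℕ, (((q : ℝ) ^ (2 * n) : ℝ) : ℂ) *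
      pairing (rep q x (Finsupp.single (n, 0) 1)) (rep q y (Finsupp.single (n, 0) 1)) := by
  refine congrArg (fun t : ℕ → ℂ => (((1 - (q : ℝ) ^ 2 : ℝ)) : ℂ) * ∑' n, t n) (funext fun n => ?_)
  rw [haarTerm, map_mul, Module.End.mul_apply, ← pairing_single_left, ← pairing_rep_star, star_star]

/-! ## The GNS space of the Haar state -/

/-- The coordinate algebra, regarded as a pre-Hilbert space for the Haar state. -/
def PreGNS (q : Set.Ioo (0 : ℝ) 1) : Type := CoordAlg q

instance (q : Set.Ioo (0 : ℝ) 1) : AddCommGroup (PreGNS q) :=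
  inferInstanceAs (AddCommGroup (CoordAlg q))

instance (q : Set.Ioo (0 : ℝ) 1) : Module ℂ (PreGNS q) := inferInstanceAs (Module ℂ (CoordAlg q))

/-- The identity map from the coordinate algebra to the pre-Hilbert space. -/
def toPreGNS (q : Set.Ioo (0 : ℝ) 1) : CoordAlg q ≃ₗ[ℂ] PreGNS q := LinearEquiv.refl ℂ _

/-- The inner product `⟨x, y⟩ = h(x^* y)`. -/
abbrev gnsCore (q : Set.Ioo (0 : ℝ) 1) : PreInnerProductSpace.Core ℂ (PreGNS q) where
  inner x y := haar q (star ((toPreGNS q).symm x) * (toPreGNS q).symm y)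
  conj_inner_symm x y := by
    rw [haar_star_mul, haar_star_mul, map_mul, Complex.conj_ofReal, Complex.conj_tsum]
    simp [pairing_conj]
  re_inner_nonneg x := by
    rw [haar_star_mul]
    have h1 : (0 : ℝ) ≤ 1 - (q : ℝ) ^ 2 := one_sub_pow_nonneg q 2
    have h2 : ∀ u : Fock, pairing u u = (((pairing u u).re : ℝ) : ℂ) := fun u =>
      (Complex.conj_eq_iff_re.mp (pairing_conj u u)).symm
    have h3 : ∀ n : ℕ, (((q : ℝ) ^ (2 * n) : ℝ) : ℂ) *
        pairing (rep q ((toPreGNS q).symm x) (Finsupp.single (n, 0) 1))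
          (rep q ((toPreGNS q).symm x) (Finsupp.single (n, 0) 1)) =
        (((q : ℝ) ^ (2 * n) * (pairing (rep q ((toPreGNS q).symm x) (Finsupp.single (n, 0) 1))
          (rep q ((toPreGNS q).symm x) (Finsupp.single (n, 0) 1))).re : ℝ) : ℂ) := fun n => by
      rw [Complex.ofReal_mul, ← h2]
    rw [tsum_congr h3, ← Complex.ofReal_tsum, ← Complex.ofReal_mul]
    exact mul_nonneg h1 (tsum_nonneg fun n =>
      mul_nonneg (pow_nonneg q.2.1.le _) (pairing_self_nonneg _))
  add_left x y z := by rw [map_add, star_add, add_mul, map_add]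
  smul_left x y z := by rw [map_smul, star_smul, smul_mul_assoc, map_smul]; rfl

instance (q : Set.Ioo (0 : ℝ) 1) : SeminormedAddCommGroup (PreGNS q) :=
  InnerProductSpace.Core.toSeminormedAddCommGroup (c := gnsCore q)

instance (q : Set.Ioo (0 : ℝ) 1) : InnerProductSpace ℂ (PreGNS q) :=
  InnerProductSpace.ofCore (gnsCore q)

/-- The GNS space `ℋ_h` of the Haar state. -/
abbrev HaarSpace (q : Set.Ioo (0 : ℝ) 1) : Type := UniformSpace.Completion (PreGNS q)

/-- The canonical map `𝒜 → ℋ_h`. -/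
def incl (q : Set.Ioo (0 : ℝ) 1) : CoordAlg q →ₗ[ℂ] HaarSpace q :=
  (UniformSpace.Completion.toComplₗᵢ (𝕜 := ℂ) (E := PreGNS q)).toLinearMap ∘ₗ
    (toPreGNS q).toLinearMap

theorem inner_incl (q : Set.Ioo (0 : ℝ) 1) (x y : CoordAlg q) :
    ⟪incl q x, incl q y⟫_ℂ = haar q (star x * y) :=
  UniformSpace.Completion.inner_coe (𝕜 := ℂ) (toPreGNS q x) (toPreGNS q y)

/-- The Hilbert space `ℋ = ℋ_h ⊕ ℋ_h`. -/
abbrev HilbertH (q : Set.Ioo (0 : ℝ) 1) : Type := WithLp 2 (HaarSpace q × HaarSpace q)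

/-- The canonical map `𝒜 ⊕ 𝒜 → ℋ`. -/
def inclH (q : Set.Ioo (0 : ℝ) 1) : CoordAlg q × CoordAlg q →ₗ[ℂ] HilbertH q :=
  (WithLp.linearEquiv 2 ℂ (HaarSpace q × HaarSpace q)).symm.toLinearMap ∘ₗ
    (incl q).prodMap (incl q)

/-! ## Unbounded operators, the modular operator and the Dirac operator -/

/-- The unbounded operator `𝒜 ⊕ 𝒜 → ℋ` with domain `𝒜 ⊕ 𝒜` defined by a linear endomorphism of
`𝒜 ⊕ 𝒜`, given by its graph. -/
def unbounded (q : Set.Ioo (0 : ℝ) 1) (T : Module.End ℂ (CoordAlg q × CoordAlg q)) :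
    HilbertH q →ₗ.[ℂ] HilbertH q :=
  (LinearMap.range ((inclH q).prod (inclH q ∘ₗ T))).toLinearPMap

/-- The endomorphism `∂_k` of the vector space `𝒜`. -/
def opK (q : Set.Ioo (0 : ℝ) 1) : Module.End ℂ (CoordAlg q) := (actK q).toLinearMap

/-- The endomorphism `∂_e` of the vector space `𝒜`. -/
def opE (q : Set.Ioo (0 : ℝ) 1) : Module.End ℂ (CoordAlg q) := actE q

/-- The endomorphism `∂_f` of the vector space `𝒜`. -/
def opF (q : Set.Ioo (0 : ℝ) 1) : Module.End ℂ (CoordAlg q) := actF q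

/-- The endomorphism of `𝒜 ⊕ 𝒜` with the given matrix of endomorphisms of `𝒜`. -/
def blockOp {q : Set.Ioo (0 : ℝ) 1} (T₁₁ T₁₂ T₂₁ T₂₂ : Module.End ℂ (CoordAlg q)) :
    Module.End ℂ (CoordAlg q × CoordAlg q) :=
  (T₁₁.coprod T₁₂).prod (T₂₁.coprod T₂₂)

/-- The closure of the unbounded operator `Δ = diag(K q^{-1/2}, K q^{1/2})`. -/
def modular (q : Set.Ioo (0 : ℝ) 1) : HilbertH q →ₗ.[ℂ] HilbertH q :=
  (unbounded q (blockOp ((sqrtQ q)⁻¹ • opK q) 0 0 (sqrtQ q • opK q))).closure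

/-- The `q`-Dirac operator `D_q`, the closure of the unbounded operator
`D = ((q⁻¹ K² - 1) / (q - q⁻¹), E K q^{1/2}; F K q^{-1/2}, (1 - q K²) / (q - q⁻¹))`. -/
def dirac (q : Set.Ioo (0 : ℝ) 1) : HilbertH q →ₗ.[ℂ] HilbertH q :=
  (unbounded q (blockOp
    ((((q : ℝ) : ℂ) - ((q : ℝ) : ℂ)⁻¹)⁻¹ • (((q : ℝ) : ℂ)⁻¹ • (opK q * opK q) - 1))
    (sqrtQ q • (opE q * opK q))
    ((sqrtQ q)⁻¹ • (opF q * opK q))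
    ((((q : ℝ) : ℂ) - ((q : ℝ) : ℂ)⁻¹)⁻¹ • (1 - ((q : ℝ) : ℂ) • (opK q * opK q))))).closure

/-! ## The von Neumann algebra and its trace -/

/-- The eigenspace of an unbounded operator. -/
def eigenspace {H : Type*} [NormedAddCommGroup H] [Module ℂ H] (T : H →ₗ.[ℂ] H) (c : ℂ) :
    Submodule ℂ H :=
  T.graph.comap (LinearMap.id.prod (c • LinearMap.id))

theorem mem_eigenspace {H : Type*} [NormedAddCommGroup H] [Module ℂ H] {T : H →ₗ.[ℂ] H} {c : ℂ}
    {v : H} : v ∈ eigenspace T c ↔ ∃ w : T.domain, (w : H) = v ∧ T w = c • v := by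
  rw [eigenspace, Submodule.mem_comap, LinearPMap.mem_graph_iff]
  rfl

/-- The eigenspace `ℋ_n` of the closure of `Δ` for the eigenvalue `q^n`, where `n = k / 2` runs
through the half-integers. -/
def eigenH (q : Set.Ioo (0 : ℝ) 1) (k : ℤ) : Submodule ℂ (HilbertH q) :=
  eigenspace (modular q) (((q : ℝ) ^ ((k : ℝ) / 2) : ℝ) : ℂ)

/-- The von Neumann algebra `ℳ` of all bounded operators which preserve every `ℋ_n`. -/
def vonNeumann (q : Set.Ioo (0 : ℝ) 1) : Set (HilbertH q →L[ℂ] HilbertH q) :=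
  {T | ∀ k : ℤ, ∀ v ∈ eigenH q k, T v ∈ eigenH q k}

/-- An orthonormal basis of a closed subspace `V` of a Hilbert space, as a set of vectors.  (The
closure is only there to make sense of the definition for all subspaces.) -/
def onb {H : Type*} [NormedAddCommGroup H] [InnerProductSpace ℂ H] [CompleteSpace H]
    (V : Submodule ℂ H) : Set V.topologicalClosure :=
  (exists_hilbertBasis ℂ V.topologicalClosure).choose

theorem onb_spec {H : Type*} [NormedAddCommGroup H] [InnerProductSpace ℂ H] [CompleteSpace H]
    (V : Submodule ℂ H) :
    ∃ b : HilbertBasis (onb V) ℂ V.topologicalClosure, ⇑b = ((↑) : onb V → V.topologicalClosure) :=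
  (exists_hilbertBasis ℂ V.topologicalClosure).choose_spec

/-- The trace `Ψ(T) = ∑ₙ qⁿ Tr(T|_{ℋ_n}) ∈ [0, ∞]` of a positive operator `T ∈ ℳ`. -/
def psiPos (q : Set.Ioo (0 : ℝ) 1) (T : HilbertH q →L[ℂ] HilbertH q) : ENNReal :=
  ∑' k : ℤ, ENNReal.ofReal ((q : ℝ) ^ ((k : ℝ) / 2)) *
    ∑' v : onb (eigenH q k), ENNReal.ofReal (⟪(v.1 : HilbertH q), T (v.1 : HilbertH q)⟫_ℂ).re

/-- The trace ideal `ℒ¹(ℳ, Ψ)` of all `T ∈ ℳ` with `Ψ(|T|) < ∞`. -/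
def traceIdeal (q : Set.Ioo (0 : ℝ) 1) : Set (HilbertH q →L[ℂ] HilbertH q) :=
  {T | T ∈ vonNeumann q ∧ psiPos q (CFC.abs T) < ⊤}

/-- The linear extension `Ψ(T) = ∑ₙ qⁿ Tr(T|_{ℋ_n})` of the trace to `T ∈ ℒ¹(ℳ, Ψ)`; both sums
converge absolutely there. -/
def psi (q : Set.Ioo (0 : ℝ) 1) (T : HilbertH q →L[ℂ] HilbertH q) : ℂ :=
  ∑' k : ℤ, (((q : ℝ) ^ ((k : ℝ) / 2) : ℝ) : ℂ) *
    ∑' v : onb (eigenH q k), ⟪(v.1 : HilbertH q), T (v.1 : HilbertH q)⟫_ℂ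

/-! ## Complex powers and the zeta function -/

/-- `R` is the bounded, everywhere defined inverse of the unbounded operator `T`. -/
def IsBoundedInverse {H : Type*} [NormedAddCommGroup H] [InnerProductSpace ℂ H]
    (T : H →ₗ.[ℂ] H) (R : H →L[ℂ] H) : Prop :=
  ∀ v w : H, (v, w) ∈ T.graph ↔ R w = v

open Classical in
/-- The bounded inverse of an unbounded operator, if there is one. -/
def boundedInverse {H : Type*} [NormedAddCommGroup H] [InnerProductSpace ℂ H]
    (T : H →ₗ.[ℂ] H) : H →L[ℂ] H :=
  if h : ∃ R, IsBoundedInverse T R then h.choose else 0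

/-- The operator `|T|^{-z}`, for `Re z > 0` and a selfadjoint operator `T` with a bounded inverse:
since `|t|^{-z} = |t⁻¹|^z`, the functional calculus of `T` for the function `t ↦ |t|^{-z}` is the
continuous functional calculus of the bounded selfadjoint operator `T⁻¹` for the function
`s ↦ |s|^z`. -/
def absPowNeg {H : Type*} [NormedAddCommGroup H] [InnerProductSpace ℂ H] [CompleteSpace H]
    (T : H →ₗ.[ℂ] H) (z : ℂ) : H →L[ℂ] H :=
  cfc (fun s : ℂ => ((‖s‖ : ℝ) : ℂ) ^ z) (boundedInverse T)

/-- The `q`-zeta function `ζ_q(z) = Ψ(|D_q|^{-z})`. -/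
def zetaQ (q : Set.Ioo (0 : ℝ) 1) (z : ℂ) : ℂ := psi q (absPowNeg (dirac q) z)

/-- The set `1/2 - (ℕ ∪ {0}) + i 2π log(q)⁻¹ ℤ`. -/
def poleSet (q : Set.Ioo (0 : ℝ) 1) : Set ℂ :=
  {z | ∃ (n : ℕ) (m : ℤ),
    z = 1 / 2 - n + Complex.I * (2 * Real.pi * ((Real.log q : ℝ) : ℂ)⁻¹ * m)}

/-- The `j`-th term
`binom(z+j-1, j) (q^{z-1/2+j} + q^{j+1/2}) (1 - q^{2j+z}) / ((1 - q^{z-1/2+j})² (1 - q^{j+1/2})²)`. -/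
def seriesTerm (q : Set.Ioo (0 : ℝ) 1) (z : ℂ) (j : ℕ) : ℂ :=
  Ring.choose (z + j - 1) j *
    (((((q : ℝ) : ℂ) ^ (z - 1 / 2 + j) + ((q : ℝ) : ℂ) ^ ((j : ℂ) + 1 / 2)) *
        (1 - ((q : ℝ) : ℂ) ^ (2 * j + z))) /
      ((1 - ((q : ℝ) : ℂ) ^ (z - 1 / 2 + j)) ^ 2 *
        (1 - ((q : ℝ) : ℂ) ^ ((j : ℂ) + 1 / 2)) ^ 2))

end SUq2

end

noncomputable section

namespace SUq2

variable {q : Set.Ioo (0 : ℝ) 1}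

/-! ## The action of the quantized enveloping algebra on products -/

/-! The Dirac operator is diagonalized explicitly, and the resulting sum over its eigenvalues is
rearranged into a series that makes sense for all `z`.

Under `𝒰_q(su_2)` the algebra `𝒜` decomposes into ladders: `a^i c^j` is a highest weight vector and
`F^p (a^i c^j)`, `0 ≤ p ≤ i + j`, are its descendants. Since the Haar state is invariant
(`haar_actK`, `haar_actF`), `E` and `F` are adjoint to each other (`haar_star_mul_actF`), so the
ladder vectors are orthogonal, with norms given by quantum integers (`inner_ladder_eq_zero`,
`inner_ladder_self_pos`). They exhaust `𝒜` by a count: reordering monomials bounds the dimension of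
the degree `≤ M` part by `∑_{m ≤ M} (m+1)²`, which is the number of independent ladder vectors in it
(`mem_span_wvec`). Faithfulness of `h` on `𝒜` is a by-product (`incl_injective`).

Let `e_p` be the normalized ladder vectors for fixed `i, j`, and put `N = i + j + 1`, `k = N - 2p`.
On the span of `(e_{p-1}, 0)` and `(0, e_p)` the modular operator is `q^{k/2}`, and `D_q` is
`q^{k/2}` times the matrix with rows `([k/2], λ)`, `(λ, -[k/2])`, where `λ² = [p][N-p] = [N/2]² -
[k/2]²`. Its eigenvalues are therefore `± q^{k/2} [N/2]`; for `p = 0` and `p = N` the block is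
one-dimensional, with the same absolute value. This gives a common orthonormal eigenbasis
`eigBasis`, and the closures are the full diagonal operators in it (`dirac_graph`, `modular_graph`).
Selfadjointness, the inverse, the powers and `Ψ` are read off from the diagonal.

With `P = p` and `n = N - P` one has `q^{k/2} [N/2] = q^{-P} (1 - q^N) / (q⁻¹ - q)`, so an
eigenvector contributes `(q⁻¹ - q)^z u^P v^n (1 - q^N)^{-z}`, where `u = q^{z-1/2}` and `v =
q^{1/2}` (`zpow_mul_cpow`). Expanding the last power by the binomial series, interchanging the sums
and using `∑ (P+n+1) u^P v^n = (1 - uv) / ((1-u)² (1-v)²)` yields the stated series when `|u| < 1`,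
that is, `Re z > 1/2` (`exists_hasSum_zetaTerm`).

Near any point, all but finitely many terms of the series are holomorphic and dominated by a
binomial coefficient times `q^j` (`exists_analytic_tail`), which gives the continuation. The poles
of the `j`-th term lie on `Re z = 1/2 - j`, so different terms never share a pole. At such a pole a
simple zero is squared in the denominator and the numerator does not vanish, so the order is exactly
two (`meromorphicOrderAt_seriesTerm`). -/

theorem isQuad_actKinv (q : Set.Ioo (0 : ℝ) 1) :
    IsQuad q ((sqrtQ q)⁻¹ • gen q Gen.a) (sqrtQ q • gen q Gen.b)
      ((sqrtQ q)⁻¹ • gen q Gen.c) (sqrtQ q • gen q Gen.d) := by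
  have hq := sqrtQ_ne_zero q
  have h := isQuad_gen q
  constructor
  · simp only [h.ab, smul_mul_smul_comm, smul_smul]; match_scalars; ring
  · simp only [h.ac, smul_mul_smul_comm, smul_smul]; match_scalars; ring
  · simp only [h.bd, smul_mul_smul_comm, smul_smul]; match_scalars; ring
  · simp only [h.cd, smul_mul_smul_comm, smul_smul]; match_scalars; ring
  · simp only [h.bc, smul_mul_smul_comm]; match_scalars; ring
  · rw [← h.ad]; simp [smul_smul, hq, -Complex.coe_smul]
  · rw [← h.da]; simp [smul_smul, hq, -Complex.coe_smul]

/-- The automorphism `∂_{k⁻¹}`. -/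
def actKinv (q : Set.Ioo (0 : ℝ) 1) : CoordAlg q →ₐ[ℂ] CoordAlg q := lift (isQuad_actKinv q)

theorem actK_a : actK q (gen q Gen.a) = sqrtQ q • gen q Gen.a := lift_gen _ _
theorem actK_b : actK q (gen q Gen.b) = (sqrtQ q)⁻¹ • gen q Gen.b := lift_gen _ _
theorem actK_c : actK q (gen q Gen.c) = sqrtQ q • gen q Gen.c := lift_gen _ _
theorem actK_d : actK q (gen q Gen.d) = (sqrtQ q)⁻¹ • gen q Gen.d := lift_gen _ _

theorem actKinv_a : actKinv q (gen q Gen.a) = (sqrtQ q)⁻¹ • gen q Gen.a := lift_gen _ _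
theorem actKinv_b : actKinv q (gen q Gen.b) = sqrtQ q • gen q Gen.b := lift_gen _ _
theorem actKinv_c : actKinv q (gen q Gen.c) = (sqrtQ q)⁻¹ • gen q Gen.c := lift_gen _ _
theorem actKinv_d : actKinv q (gen q Gen.d) = sqrtQ q • gen q Gen.d := lift_gen _ _

/-- Upper triangular matrices are closed under products and their diagonal entries are
multiplicative, so only generators need checking. Multiplicativity of the lift then becomes the
twisted Leibniz rule. -/
theorem lift_actE (x : CoordAlg q) :
    lift (isQuad_actE q) x = !![actK q x, actE q x; 0, actKinv q x] := by
  have key : lift (isQuad_actE q) x 0 0 = actK q x ∧ lift (isQuad_actE q) x 1 0 = 0 ∧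
      lift (isQuad_actE q) x 1 1 = actKinv q x := by
    induction x using coordAlg_induction with
    | hs z => simp [AlgHom.commutes, Matrix.algebraMap_matrix_apply]
    | hg g =>
      rw [lift_gen, actK, actKinv, lift_gen, lift_gen]
      cases g <;> simp [Gen.elim]
    | hm x y hx hy => simp [Matrix.mul_apply, hx, hy]
    | ha x y hx hy => simp [hx, hy]
  ext i j
  fin_cases i <;> fin_cases j <;> simp [key, actE]

theorem lift_actF (x : CoordAlg q) :
    lift (isQuad_actF q) x = !![actK q x, actF q x; 0, actKinv q x] := by
  have key : lift (isQuad_actF q) x 0 0 = actK q x ∧ lift (isQuad_actF q) x 1 0 = 0 ∧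
      lift (isQuad_actF q) x 1 1 = actKinv q x := by
    induction x using coordAlg_induction with
    | hs z => simp [AlgHom.commutes, Matrix.algebraMap_matrix_apply]
    | hg g =>
      rw [lift_gen, actK, actKinv, lift_gen, lift_gen]
      cases g <;> simp [Gen.elim]
    | hm x y hx hy => simp [Matrix.mul_apply, hx, hy]
    | ha x y hx hy => simp [hx, hy]
  ext i j
  fin_cases i <;> fin_cases j <;> simp [key, actF]

theorem actE_mul (x y : CoordAlg q) :
    actE q (x * y) = actK q x * actE q y + actE q x * actKinv q y := by
  have h := congrArg (fun M : Matrix (Fin 2) (Fin 2) (CoordAlg q) => M 0 1)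
    (map_mul (lift (isQuad_actE q)) x y)
  simpa [lift_actE, Matrix.mul_apply] using h

theorem actF_mul (x y : CoordAlg q) :
    actF q (x * y) = actK q x * actF q y + actF q x * actKinv q y := by
  have h := congrArg (fun M : Matrix (Fin 2) (Fin 2) (CoordAlg q) => M 0 1)
    (map_mul (lift (isQuad_actF q)) x y)
  simpa [lift_actF, Matrix.mul_apply] using h

theorem actE_algebraMap (z : ℂ) : actE q (algebraMap ℂ _ z) = 0 := by
  simp [actE, AlgHom.commutes, Matrix.algebraMap_matrix_apply]

theorem actF_algebraMap (z : ℂ) : actF q (algebraMap ℂ _ z) = 0 := by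
  simp [actF, AlgHom.commutes, Matrix.algebraMap_matrix_apply]

theorem actE_gen (g : Gen) :
    actE q (gen q g) = Gen.elim 0 (gen q Gen.a) 0 (gen q Gen.c) g := by
  simp only [actE, LinearMap.comp_apply, AlgHom.toLinearMap_apply, lift_gen]
  cases g <;> simp [Gen.elim]

theorem actF_gen (g : Gen) :
    actF q (gen q g) = Gen.elim (gen q Gen.b) 0 (gen q Gen.d) 0 g := by
  simp only [actF, LinearMap.comp_apply, AlgHom.toLinearMap_apply, lift_gen]
  cases g <;> simp [Gen.elim]

theorem actE_a : actE q (gen q Gen.a) = 0 := actE_gen _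
theorem actE_b : actE q (gen q Gen.b) = gen q Gen.a := actE_gen _
theorem actE_c : actE q (gen q Gen.c) = 0 := actE_gen _
theorem actE_d : actE q (gen q Gen.d) = gen q Gen.c := actE_gen _
theorem actF_a : actF q (gen q Gen.a) = gen q Gen.b := actF_gen _
theorem actF_b : actF q (gen q Gen.b) = 0 := actF_gen _
theorem actF_c : actF q (gen q Gen.c) = gen q Gen.d := actF_gen _
theorem actF_d : actF q (gen q Gen.d) = 0 := actF_gen _

theorem actK_actKinv (x : CoordAlg q) : actK q (actKinv q x) = x := by
  have hq := sqrtQ_ne_zero q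
  induction x using coordAlg_induction with
  | hs z => simp
  | hg g =>
    cases g <;> simp [actK_a, actK_b, actK_c, actK_d, actKinv_a, actKinv_b, actKinv_c, actKinv_d,
      smul_smul, hq]
  | hm x y hx hy => simp [hx, hy]
  | ha x y hx hy => simp [hx, hy]

theorem actKinv_actK (x : CoordAlg q) : actKinv q (actK q x) = x := by
  have hq := sqrtQ_ne_zero q
  induction x using coordAlg_induction with
  | hs z => simp
  | hg g =>
    cases g <;> simp [actK_a, actK_b, actK_c, actK_d, actKinv_a, actKinv_b, actKinv_c, actKinv_d,
      smul_smul, hq]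
  | hm x y hx hy => simp [hx, hy]
  | ha x y hx hy => simp [hx, hy]

/-- Both sides satisfy the same twisted Leibniz rule, so the relation propagates from the generators
to products. -/
theorem actK_actE (x : CoordAlg q) : actK q (actE q x) = ((q : ℝ) : ℂ) • actE q (actK q x) := by
  have hq := sqrtQ_ne_zero q
  induction x using coordAlg_induction with
  | hs z => simp [actE_algebraMap]
  | hg g =>
    cases g <;> simp [actK_a, actK_b, actK_c, actK_d, actE_a, actE_b, actE_c, actE_d,
      smul_smul, hq, sqrtQ_mul_self, -Complex.coe_smul]
  | hm x y hx hy =>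
    simp only [actE_mul, map_add, map_mul, hx, hy, actK_actKinv, actKinv_actK, smul_add,
      mul_smul_comm, smul_mul_assoc]
  | ha x y hx hy => simp [hx, hy]

theorem actF_actK (x : CoordAlg q) : actF q (actK q x) = ((q : ℝ) : ℂ) • actK q (actF q x) := by
  have hq := sqrtQ_ne_zero q
  induction x using coordAlg_induction with
  | hs z => simp [actF_algebraMap]
  | hg g =>
    cases g <;> simp [actK_a, actK_b, actK_c, actK_d, actF_a, actF_b, actF_c, actF_d,
      smul_smul, hq, sqrtQ_mul_self, -Complex.coe_smul]
  | hm x y hx hy =>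
    simp only [actF_mul, map_add, map_mul, hx, hy, actK_actKinv, actKinv_actK, smul_add,
      mul_smul_comm, smul_mul_assoc]
  | ha x y hx hy => simp [hx, hy]

theorem actKinv_actE (x : CoordAlg q) :
    actE q (actKinv q x) = ((q : ℝ) : ℂ) • actKinv q (actE q x) := by
  have h := actK_actE (actKinv q x)
  rw [actK_actKinv] at h
  have h2 := congrArg (actKinv q) h
  rw [actKinv_actK] at h2
  rw [h2, map_smul]

theorem actKinv_actF (x : CoordAlg q) :
    actKinv q (actF q x) = ((q : ℝ) : ℂ) • actF q (actKinv q x) := by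
  have h := actF_actK (actKinv q x)
  rw [actK_actKinv] at h
  rw [h, map_smul, actKinv_actK]

/-- The commutation relation of `∂_e` and `∂_f`. -/
theorem actE_actF_sub (x : CoordAlg q) :
    (((q : ℝ) : ℂ) - ((q : ℝ) : ℂ)⁻¹) • (actE q (actF q x) - actF q (actE q x)) =
      actK q (actK q x) - actKinv q (actKinv q x) := by
  have hq := sqrtQ_ne_zero q
  have hq' := q_ne_zero q
  induction x using coordAlg_induction with
  | hs z => simp [actF_algebraMap, actE_algebraMap]
  | hg g =>
    cases g <;> simp only [actK_a, actK_b, actK_c, actK_d, actF_a, actF_b, actF_c, actF_d,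
      actE_a, actE_b, actE_c, actE_d, actKinv_a, actKinv_b, actKinv_c, actKinv_d, map_smul,
      map_zero, smul_smul, sqrtQ_mul_self, smul_sub, sub_smul] <;>
    match_scalars <;> field_simp <;> ring
  | hm x y hx hy =>
    -- The terms with one of `E`, `F` on each factor cancel: moving `K` past one and `K⁻¹` past the
    -- other produces the same power of `q` in both orders.
    have h1 : actE q (actF q (x * y)) - actF q (actE q (x * y)) =
        (actE q (actF q x) - actF q (actE q x)) * actKinv q (actKinv q y) +
        actK q (actK q x) * (actE q (actF q y) - actF q (actE q y)) := by
      simp only [actF_mul, actE_mul, map_add, actK_actE, actF_actK, actKinv_actE, actKinv_actF,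
        mul_smul_comm, smul_mul_assoc]
      noncomm_ring
    rw [h1, smul_add, ← smul_mul_assoc, ← mul_smul_comm, hx, hy]
    simp only [map_mul]
    noncomm_ring
  | ha x y hx hy =>
    have h1 : actE q (actF q (x + y)) - actF q (actE q (x + y)) =
        (actE q (actF q x) - actF q (actE q x)) + (actE q (actF q y) - actF q (actE q y)) := by
      simp only [map_add]; abel
    rw [h1, smul_add, hx, hy]
    simp only [map_add]
    abel

theorem conj_sqrtQ : conj (sqrtQ q) = sqrtQ q := Complex.conj_ofReal _

theorem star_actK (x : CoordAlg q) : star (actK q x) = actKinv q (star x) := by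
  induction x using coordAlg_induction with
  | hs z => simp only [AlgHom.commutes, coord_star_algebraMap]
  | hg g =>
    cases g <;> simp only [actK_a, actK_b, actK_c, actK_d, star_gen, coord_star_smul, Gen.elim,
      map_smul, actKinv_a, actKinv_b, actKinv_c, actKinv_d, conj_sqrtQ, map_inv₀, smul_smul,
      mul_comm]
  | hm x y hx hy => simp [hx, hy]
  | ha x y hx hy => simp [hx, hy]

theorem star_actKinv (x : CoordAlg q) : star (actKinv q x) = actK q (star x) := by
  have h := star_actK (actKinv q x)
  rw [actK_actKinv] at h
  rw [h, actK_actKinv]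

/-- The involution reverses products and exchanges `K` with `K⁻¹`, so both sides obey the same
Leibniz rule; the factor `-q` comes from the generators. -/
theorem actF_star (x : CoordAlg q) : actF q (star x) = -((q : ℝ) : ℂ) • star (actE q x) := by
  have hq' := q_ne_zero q
  induction x using coordAlg_induction with
  | hs z => simp [actF_algebraMap, actE_algebraMap, coord_star_algebraMap]
  | hg g =>
    cases g <;> simp [actF_a, actF_b, actF_c, actF_d, star_gen, Gen.elim, actE_a, actE_b, actE_c,
      actE_d, smul_smul, hq', -Complex.coe_smul, -neg_smul]
  | hm x y hx hy =>
    simp only [actF_mul, actE_mul, star_mul, star_add, hx, hy, star_actK, star_actKinv, smul_add,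
      smul_mul_assoc, mul_smul_comm]
    abel
  | ha x y hx hy => simp only [map_add, star_add, hx, hy, smul_add]

/-! ## Ordered monomials -/

theorem gen_bc : gen q Gen.b * gen q Gen.c = gen q Gen.c * gen q Gen.b := (isQuad_gen q).bc

theorem gen_a_mul_d : gen q Gen.a * gen q Gen.d =
    1 + ((q : ℝ) : ℂ) • (gen q Gen.b * gen q Gen.c) :=
  sub_eq_iff_eq_add.mp (isQuad_gen q).ad

theorem gen_d_mul_a : gen q Gen.d * gen q Gen.a =
    1 + ((q : ℝ) : ℂ)⁻¹ • (gen q Gen.b * gen q Gen.c) :=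
  sub_eq_iff_eq_add.mp (isQuad_gen q).da

/-- Elements with `x * y = t • (y * x)` satisfy the corresponding relation for powers of `y`. -/
theorem mul_pow_of_qcomm {B : Type*} [Ring B] [Algebra ℂ B] {x y : B} {t : ℂ}
    (h : x * y = t • (y * x)) (n : ℕ) : x * y ^ n = t ^ n • (y ^ n * x) := by
  induction n with
  | zero => simp
  | succ n ih =>
    rw [pow_succ, ← mul_assoc, ih, smul_mul_assoc, mul_assoc, h, mul_smul_comm, smul_smul,
      pow_succ, mul_assoc]

theorem gen_b_mul_a_pow (i : ℕ) : gen q Gen.b * gen q Gen.a ^ i =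
    (((q : ℝ) : ℂ)⁻¹) ^ i • (gen q Gen.a ^ i * gen q Gen.b) :=
  mul_pow_of_qcomm (by
    rw [(isQuad_gen q).ab, smul_smul, inv_mul_cancel₀ (q_ne_zero q), one_smul]) i

theorem gen_c_mul_a_pow (i : ℕ) : gen q Gen.c * gen q Gen.a ^ i =
    (((q : ℝ) : ℂ)⁻¹) ^ i • (gen q Gen.a ^ i * gen q Gen.c) :=
  mul_pow_of_qcomm (by
    rw [(isQuad_gen q).ac, smul_smul, inv_mul_cancel₀ (q_ne_zero q), one_smul]) i

theorem gen_b_mul_d_pow (i : ℕ) : gen q Gen.b * gen q Gen.d ^ i =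
    ((q : ℝ) : ℂ) ^ i • (gen q Gen.d ^ i * gen q Gen.b) :=
  mul_pow_of_qcomm (isQuad_gen q).bd i

theorem gen_c_mul_d_pow (i : ℕ) : gen q Gen.c * gen q Gen.d ^ i =
    ((q : ℝ) : ℂ) ^ i • (gen q Gen.d ^ i * gen q Gen.c) :=
  mul_pow_of_qcomm (isQuad_gen q).cd i

theorem gen_c_mul_b_pow (i : ℕ) : gen q Gen.c * gen q Gen.b ^ i = gen q Gen.b ^ i * gen q Gen.c :=
  (Commute.pow_right (show Commute (gen q Gen.c) (gen q Gen.b) from gen_bc.symm) i).eq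

/-- The monomial `a^i b^j c^k`. -/
def monA (q : Set.Ioo (0 : ℝ) 1) (i j k : ℕ) : CoordAlg q :=
  gen q Gen.a ^ i * (gen q Gen.b ^ j * gen q Gen.c ^ k)

/-- The monomial `d^i b^j c^k`. -/
def monD (q : Set.Ioo (0 : ℝ) 1) (i j k : ℕ) : CoordAlg q :=
  gen q Gen.d ^ i * (gen q Gen.b ^ j * gen q Gen.c ^ k)

theorem a_mul_monA (i j k : ℕ) : gen q Gen.a * monA q i j k = monA q (i + 1) j k := by
  simp only [monA, pow_succ', mul_assoc]

theorem d_mul_monD (i j k : ℕ) : gen q Gen.d * monD q i j k = monD q (i + 1) j k := by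
  simp only [monD, pow_succ', mul_assoc]

theorem b_mul_monA (i j k : ℕ) :
    gen q Gen.b * monA q i j k = (((q : ℝ) : ℂ)⁻¹) ^ i • monA q i (j + 1) k := by
  simp only [monA]
  rw [← mul_assoc, gen_b_mul_a_pow, smul_mul_assoc, mul_assoc, pow_succ' (gen q Gen.b), mul_assoc]

theorem c_mul_monA (i j k : ℕ) :
    gen q Gen.c * monA q i j k = (((q : ℝ) : ℂ)⁻¹) ^ i • monA q i j (k + 1) := by
  simp only [monA]
  rw [← mul_assoc, gen_c_mul_a_pow, smul_mul_assoc, mul_assoc, ← mul_assoc (gen q Gen.c),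
    gen_c_mul_b_pow, mul_assoc, ← pow_succ']

theorem b_mul_monD (i j k : ℕ) :
    gen q Gen.b * monD q i j k = ((q : ℝ) : ℂ) ^ i • monD q i (j + 1) k := by
  simp only [monD]
  rw [← mul_assoc, gen_b_mul_d_pow, smul_mul_assoc, mul_assoc, pow_succ' (gen q Gen.b), mul_assoc]

theorem c_mul_monD (i j k : ℕ) :
    gen q Gen.c * monD q i j k = ((q : ℝ) : ℂ) ^ i • monD q i j (k + 1) := by
  simp only [monD]
  rw [← mul_assoc, gen_c_mul_d_pow, smul_mul_assoc, mul_assoc, ← mul_assoc (gen q Gen.c),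
    gen_c_mul_b_pow, mul_assoc, ← pow_succ']

/-- A `d` meeting an `a` is traded for `1 + q⁻¹ bc`, so no ordered monomial has to contain both. -/
theorem d_mul_monA_succ (i j k : ℕ) : gen q Gen.d * monA q (i + 1) j k =
    monA q i j k + ((q : ℝ) : ℂ)⁻¹ • (gen q Gen.b * (gen q Gen.c * monA q i j k)) := by
  rw [← a_mul_monA, ← mul_assoc, gen_d_mul_a, add_mul, one_mul, smul_mul_assoc, mul_assoc]

theorem a_mul_monD_succ (i j k : ℕ) : gen q Gen.a * monD q (i + 1) j k =
    monD q i j k + ((q : ℝ) : ℂ) • (gen q Gen.b * (gen q Gen.c * monD q i j k)) := by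
  rw [← d_mul_monD, ← mul_assoc, gen_a_mul_d, add_mul, one_mul, smul_mul_assoc, mul_assoc]

theorem monD_zero (j k : ℕ) : monD q 0 j k = monA q 0 j k := by simp [monA, monD]

/-- The span of the ordered monomials of degree at most `M`. -/
def monSpan (q : Set.Ioo (0 : ℝ) 1) (M : ℕ) : Submodule ℂ (CoordAlg q) :=
  Submodule.span ℂ {x | ∃ i j k, i + j + k ≤ M ∧ (x = monA q i j k ∨ x = monD q i j k)}

theorem monA_mem {M i j k : ℕ} (h : i + j + k ≤ M) : monA q i j k ∈ monSpan q M :=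
  Submodule.subset_span ⟨i, j, k, h, Or.inl rfl⟩

theorem monD_mem {M i j k : ℕ} (h : i + j + k ≤ M) : monD q i j k ∈ monSpan q M :=
  Submodule.subset_span ⟨i, j, k, h, Or.inr rfl⟩

theorem monSpan_mono {M M' : ℕ} (h : M ≤ M') : monSpan q M ≤ monSpan q M' :=
  Submodule.span_mono fun _ ⟨i, j, k, hs, hx⟩ => ⟨i, j, k, hs.trans h, hx⟩

/-- The spanning half of a basis theorem. Generators commute up to scalars except `a` and `d`, and
replacing `ad` or `da` by `1` and `bc` does not raise the degree. -/
theorem gen_mul_mem_monSpan (g : Gen) {M : ℕ} {x : CoordAlg q} (hx : x ∈ monSpan q M) :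
    gen q g * x ∈ monSpan q (M + 1) := by
  induction hx using Submodule.span_induction with
  | mem x hx =>
    obtain ⟨i, j, k, h, rfl | rfl⟩ := hx
    · cases g
      · rw [a_mul_monA]; exact monA_mem (by omega)
      · rw [b_mul_monA]; exact Submodule.smul_mem _ _ (monA_mem (by omega))
      · rw [c_mul_monA]; exact Submodule.smul_mem _ _ (monA_mem (by omega))
      · rcases i with _ | i
        · rw [← monD_zero, d_mul_monD]; exact monD_mem (by omega)
        · rw [d_mul_monA_succ, c_mul_monA, mul_smul_comm, b_mul_monA]
          exact Submodule.add_mem _ (monA_mem (by omega)) (Submodule.smul_mem _ _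
            (Submodule.smul_mem _ _ (Submodule.smul_mem _ _ (monA_mem (by omega)))))
    · cases g
      · rcases i with _ | i
        · rw [monD_zero, a_mul_monA]; exact monA_mem (by omega)
        · rw [a_mul_monD_succ, c_mul_monD, mul_smul_comm, b_mul_monD]
          exact Submodule.add_mem _ (monD_mem (by omega)) (Submodule.smul_mem _ _
            (Submodule.smul_mem _ _ (Submodule.smul_mem _ _ (monD_mem (by omega)))))
      · rw [b_mul_monD]; exact Submodule.smul_mem _ _ (monD_mem (by omega))
      · rw [c_mul_monD]; exact Submodule.smul_mem _ _ (monD_mem (by omega))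
      · rw [d_mul_monD]; exact monD_mem (by omega)
  | zero => simp
  | add x y _ _ hx hy => rw [mul_add]; exact Submodule.add_mem _ hx hy
  | smul z x _ hx => rw [mul_smul_comm]; exact Submodule.smul_mem _ _ hx

/-! ### The filtration of the coordinate algebra by degree -/

/-- The span of `1` and the generators. -/
def genSpan (q : Set.Ioo (0 : ℝ) 1) : Submodule ℂ (CoordAlg q) :=
  Submodule.span ℂ (insert 1 (Set.range (gen q)))

theorem one_mem_genSpan : (1 : CoordAlg q) ∈ genSpan q :=
  Submodule.subset_span (Set.mem_insert _ _)

theorem gen_mem_genSpan (g : Gen) : gen q g ∈ genSpan q :=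
  Submodule.subset_span (Set.mem_insert_of_mem _ ⟨g, rfl⟩)

theorem genSpan_pow_le (M : ℕ) : genSpan q ^ M ≤ monSpan q M := by
  induction M with
  | zero =>
    rw [pow_zero, Submodule.one_le]
    have : (1 : CoordAlg q) = monA q 0 0 0 := by simp [monA]
    rw [this]; exact monA_mem le_rfl
  | succ M ih =>
    rw [pow_succ', Submodule.mul_le]
    intro x hx y hy
    have hy := ih hy
    clear ih
    induction hx using Submodule.span_induction with
    | mem x hx =>
      rcases hx with rfl | ⟨g, rfl⟩
      · rw [one_mul]; exact monSpan_mono (Nat.le_succ _) hy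
      · exact gen_mul_mem_monSpan g hy
    | zero => simp
    | add x x' _ _ hx hx' => rw [add_mul]; exact Submodule.add_mem _ hx hx'
    | smul z x _ hx => rw [smul_mul_assoc]; exact Submodule.smul_mem _ _ hx

theorem genSpan_pow_mono {M M' : ℕ} (h : M ≤ M') : genSpan q ^ M ≤ genSpan q ^ M' :=
  pow_le_pow_right₀ (Submodule.one_le.mpr one_mem_genSpan) h

theorem exists_mem_genSpan_pow (x : CoordAlg q) : ∃ M, x ∈ genSpan q ^ M := by
  induction x using coordAlg_induction with
  | hs z => exact ⟨0, by rw [pow_zero]; exact Submodule.algebraMap_mem z⟩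
  | hg g => exact ⟨1, by rw [pow_one]; exact gen_mem_genSpan g⟩
  | hm x y hx hy =>
    obtain ⟨M, hx⟩ := hx
    obtain ⟨M', hy⟩ := hy
    exact ⟨M + M', by rw [pow_add]; exact Submodule.mul_mem_mul hx hy⟩
  | ha x y hx hy =>
    obtain ⟨M, hx⟩ := hx
    obtain ⟨M', hy⟩ := hy
    exact ⟨max M M', Submodule.add_mem _ (genSpan_pow_mono (le_max_left _ _) hx)
      (genSpan_pow_mono (le_max_right _ _) hy)⟩

theorem linearMap_mem_genSpan (T : CoordAlg q →ₗ[ℂ] CoordAlg q) (h1 : T 1 ∈ genSpan q)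
    (hg : ∀ g, T (gen q g) ∈ genSpan q) {x : CoordAlg q} (hx : x ∈ genSpan q) :
    T x ∈ genSpan q := by
  have : genSpan q ≤ (genSpan q).comap T := by
    refine Submodule.span_le.mpr ?_
    rintro _ (rfl | ⟨g, rfl⟩)
    · exact h1
    · exact hg g
  exact this hx

theorem algHom_mem_genSpan_pow (T : CoordAlg q →ₐ[ℂ] CoordAlg q)
    (hg : ∀ g, T (gen q g) ∈ genSpan q) {M : ℕ} {x : CoordAlg q} (hx : x ∈ genSpan q ^ M) :
    T x ∈ genSpan q ^ M := by
  have h1 : (genSpan q).map T.toLinearMap ≤ genSpan q := by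
    rw [Submodule.map_le_iff_le_comap]
    intro x hx
    exact linearMap_mem_genSpan T.toLinearMap (by simpa using one_mem_genSpan) hg hx
  have h2 : (genSpan q ^ M).map T.toLinearMap ≤ genSpan q ^ M := by
    rw [Submodule.map_pow]
    exact pow_le_pow_left' h1 M
  exact h2 ⟨x, hx, rfl⟩

theorem actK_mem {M : ℕ} {x : CoordAlg q} (hx : x ∈ genSpan q ^ M) :
    actK q x ∈ genSpan q ^ M := by
  refine algHom_mem_genSpan_pow _ (fun g => ?_) hx
  cases g <;> simp only [actK_a, actK_b, actK_c, actK_d] <;>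
    exact Submodule.smul_mem _ _ (gen_mem_genSpan _)

theorem actKinv_mem {M : ℕ} {x : CoordAlg q} (hx : x ∈ genSpan q ^ M) :
    actKinv q x ∈ genSpan q ^ M := by
  refine algHom_mem_genSpan_pow _ (fun g => ?_) hx
  cases g <;> simp only [actKinv_a, actKinv_b, actKinv_c, actKinv_d] <;>
    exact Submodule.smul_mem _ _ (gen_mem_genSpan _)

theorem actF_one : actF q 1 = 0 := by
  have := actF_algebraMap (q := q) 1
  rwa [map_one] at this

theorem actE_one : actE q 1 = 0 := by
  have := actE_algebraMap (q := q) 1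
  rwa [map_one] at this

/-- The span of `1` and the generators is stable under `F` and `K^{±1}`, and the Leibniz rule
spreads `F` over the factors. Hence a whole ladder stays in the degree of its highest weight vector.
-/
theorem actF_mem {M : ℕ} {x : CoordAlg q} (hx : x ∈ genSpan q ^ M) :
    actF q x ∈ genSpan q ^ M := by
  induction M generalizing x with
  | zero =>
    rw [pow_zero] at hx
    obtain ⟨z, rfl⟩ := Submodule.mem_one.mp hx
    rw [actF_algebraMap]; exact Submodule.zero_mem _
  | succ M ih =>
    rw [pow_succ'] at hx ⊢
    refine Submodule.mul_induction_on hx (fun x hx y hy => ?_) fun x y hx hy => by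
      rw [map_add]; exact Submodule.add_mem _ hx hy
    rw [actF_mul]
    have hK := actK_mem (M := 1) (x := x) (by rwa [pow_one])
    rw [pow_one] at hK
    refine Submodule.add_mem _ (Submodule.mul_mem_mul hK (ih hy))
      (Submodule.mul_mem_mul ?_ (actKinv_mem hy))
    refine linearMap_mem_genSpan _ (by rw [actF_one]; exact Submodule.zero_mem _)
      (fun g => ?_) hx
    rw [actF_gen]
    cases g <;> simp only [Gen.elim]
    · exact gen_mem_genSpan _
    · exact Submodule.zero_mem _
    · exact gen_mem_genSpan _
    · exact Submodule.zero_mem _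

/-- The index set for the ordered monomials of degree at most `M`. -/
abbrev DegIndex (M : ℕ) : Type := Σ m : Fin (M + 1), Fin (m + 1) × Fin (m + 1)

/-- An enumeration of the ordered monomials of degree at most `M`. -/
def monEnum (q : Set.Ioo (0 : ℝ) 1) (M : ℕ) (r : DegIndex M) : CoordAlg q :=
  if (r.2.1 : ℕ) + r.2.2 ≤ r.1 then monA q (r.1 - (r.2.1 + r.2.2)) r.2.1 r.2.2
  else monD q (r.2.1 + r.2.2 - r.1) (r.1 - r.2.1) (r.1 - r.2.2)

/-- Monomials of exact degree `m` are coded by pairs `(s, t)` in `[0, m]²`: `s + t ≤ m` stands for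
`a^{m-s-t} b^s c^t`, and `s + t > m` for `d^{s+t-m} b^{m-s} c^{m-t}`. So there are `(m+1)²` codes.
-/
theorem monSpan_le (M : ℕ) : monSpan q M ≤ Submodule.span ℂ (Set.range (monEnum q M)) := by
  refine Submodule.span_le.mpr ?_
  have hA : ∀ i j k, i + j + k ≤ M →
      monA q i j k ∈ Submodule.span ℂ (Set.range (monEnum q M)) := by
    intro i j k h
    refine Submodule.subset_span ⟨⟨⟨i + j + k, by omega⟩, ⟨j, by simp only; omega⟩,
      ⟨k, by simp only; omega⟩⟩, ?_⟩
    rw [monEnum, if_pos (by simp only; omega)]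
    congr 1
    simp only; omega
  rintro x ⟨i, j, k, h, rfl | rfl⟩
  · exact hA i j k h
  · rcases i with _ | i
    · rw [monD_zero]; exact hA 0 j k h
    · refine Submodule.subset_span ⟨⟨⟨i + 1 + j + k, by omega⟩, ⟨i + 1 + k, by simp only; omega⟩,
        ⟨i + 1 + j, by simp only; omega⟩⟩, ?_⟩
      rw [monEnum, if_neg (by simp only; omega)]
      congr 1 <;> simp only <;> omega

/-- A linearly independent family of elements of filtration degree at most `M` which has as many
members as there are ordered monomials spans. -/
theorem genSpan_pow_le_span {M : ℕ} {v : DegIndex M → CoordAlg q} (hv : LinearIndependent ℂ v)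
    (hm : ∀ r, v r ∈ genSpan q ^ M) : genSpan q ^ M ≤ Submodule.span ℂ (Set.range v) := by
  have hle := (genSpan_pow_le M).trans (monSpan_le (q := q) M)
  have hvle : Submodule.span ℂ (Set.range v) ≤ genSpan q ^ M :=
    Submodule.span_le.mpr (by rintro _ ⟨r, rfl⟩; exact hm r)
  have hfin : FiniteDimensional ℂ (Submodule.span ℂ (Set.range (monEnum q M))) :=
    FiniteDimensional.span_of_finite ℂ (Set.finite_range _)
  have h1 := finrank_range_le_card (R := ℂ) (b := monEnum q M)
  have h2 := finrank_span_eq_card hv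
  -- Squeeze: the smaller span has dimension equal to the number of indices, the larger one at most
  -- that.
  rw [Submodule.eq_of_le_of_finrank_le (hvle.trans hle) (by rw [h2]; exact h1)]
  exact hle

/-! ## Invariance of the Haar state -/

/-- The element `x` acts on the basis vectors `e_{n,k}` by a weighted shift by `(r, t)`. -/
def Shifts (x : CoordAlg q) (r t : ℤ) : Prop :=
  ∀ p p' : ℕ × ℤ, rep q x (Finsupp.single p 1) p' ≠ 0 →
    (p'.1 : ℤ) = p.1 + r ∧ p'.2 = p.2 + t

theorem rep_apply_eq_sum (x : CoordAlg q) (u : Fock) (p' : ℕ × ℤ) :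
    rep q x u p' = u.sum fun p z => z * rep q x (Finsupp.single p 1) p' := by
  conv_lhs => rw [← Finsupp.sum_single u, map_finsuppSum, Finsupp.sum_apply]
  refine Finsupp.sum_congr fun p _ => ?_
  rw [← Finsupp.smul_single_one, map_smul, Finsupp.smul_apply, smul_eq_mul]

theorem Shifts.mul {x y : CoordAlg q} {r t r' t' : ℤ} (hx : Shifts x r t) (hy : Shifts y r' t') :
    Shifts (x * y) (r + r') (t + t') := by
  intro p p' h
  rw [map_mul, Module.End.mul_apply, rep_apply_eq_sum] at h
  obtain ⟨p'', _, hp⟩ := Finset.exists_ne_zero_of_sum_ne_zero h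
  have h1 := hx p'' p' (right_ne_zero_of_mul hp)
  have h2 := hy p p'' (left_ne_zero_of_mul hp)
  omega

theorem Shifts.smul {x : CoordAlg q} {r t : ℤ} (hx : Shifts x r t) (z : ℂ) :
    Shifts (z • x) r t := by
  intro p p' h
  rw [map_smul, LinearMap.smul_apply, Finsupp.smul_apply] at h
  exact hx p p' (right_ne_zero_of_smul h)

theorem shifts_one : Shifts (1 : CoordAlg q) 0 0 := by
  intro p p' h
  rw [map_one, Module.End.one_apply, Finsupp.single_apply] at h
  have : p = p' := by by_contra hne; exact h (if_neg hne)
  subst this; simp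

theorem Shifts.pow {x : CoordAlg q} {r t : ℤ} (hx : Shifts x r t) (n : ℕ) :
    Shifts (x ^ n) (n * r) (n * t) := by
  induction n with
  | zero => simpa using shifts_one
  | succ n ih =>
    rw [pow_succ]
    convert ih.mul hx using 1 <;> push_cast <;> ring

theorem weighted_apply_ne_zero {w : ℕ × ℤ → ℝ} {f : ℕ × ℤ → ℕ × ℤ} {p p' : ℕ × ℤ}
    (h : weighted w f (Finsupp.single p 1) p' ≠ 0) : f p = p' ∧ w p ≠ 0 := by
  rw [weighted_single, Finsupp.single_apply] at h
  split_ifs at h with h1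
  · exact ⟨h1, fun h2 => h (by simp [h2])⟩
  · exact absurd rfl h

theorem shifts_a : Shifts (gen q Gen.a) (-1) 0 := by
  intro p p' h
  rw [rep_gen] at h
  obtain ⟨rfl, h2⟩ := weighted_apply_ne_zero h
  -- At `n = 0` the truncated `n - 1` would not be a shift, but there the weight `(1 - q^0)^{1/2}`
  -- vanishes.
  have : p.1 ≠ 0 := by rintro h0; simp [h0] at h2
  change ((p.1 - 1 : ℕ) : ℤ) = p.1 + -1 ∧ p.2 = p.2 + 0
  omega

theorem shifts_b : Shifts (gen q Gen.b) 0 (-1) := by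
  intro p p' h
  rw [rep_gen] at h
  obtain ⟨rfl, -⟩ := weighted_apply_ne_zero h
  simp only
  omega

theorem shifts_c : Shifts (gen q Gen.c) 0 1 := by
  intro p p' h
  rw [rep_gen] at h
  obtain ⟨rfl, -⟩ := weighted_apply_ne_zero h
  exact ⟨(add_zero _).symm, rfl⟩

theorem shifts_d : Shifts (gen q Gen.d) 1 0 := by
  intro p p' h
  rw [rep_gen] at h
  obtain ⟨rfl, -⟩ := weighted_apply_ne_zero h
  simp only
  omega

/-- The Haar state sees only diagonal matrix coefficients, and a nontrivial shift has none. -/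
theorem Shifts.haar_eq_zero {x : CoordAlg q} {r t : ℤ} (hx : Shifts x r t) (h : r ≠ 0 ∨ t ≠ 0) :
    haar q x = 0 := by
  have h1 : ∀ n, haarTerm q x n = 0 := by
    intro n
    rw [haarTerm]
    by_cases h0 : rep q x (Finsupp.single (n, 0) 1) (n, 0) = 0
    · rw [h0, mul_zero]
    · have := hx _ _ h0
      simp only at this
      omega
  change _ * ∑' n, haarTerm q x n = 0
  simp [h1]

/-- Different shifts send `e_{n,0}` to vectors with disjoint supports. -/
theorem Shifts.haar_star_mul_eq_zero {x y : CoordAlg q} {r t r' t' : ℤ} (hx : Shifts x r t)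
    (hy : Shifts y r' t') (h : r ≠ r' ∨ t ≠ t') : haar q (star x * y) = 0 := by
  rw [haar_star_mul]
  have h1 : ∀ n : ℕ, pairing (rep q x (Finsupp.single (n, 0) 1))
      (rep q y (Finsupp.single (n, 0) 1)) = 0 := by
    intro n
    refine Finset.sum_eq_zero fun p _ => ?_
    by_contra h0
    have h2 := hx (n, 0) p (fun h3 => h0 (by simp [h3]))
    have h3 := hy (n, 0) p (right_ne_zero_of_mul h0)
    omega
  simp [h1]

theorem shifts_monA (i j k : ℕ) : Shifts (monA q i j k) (-i) (k - j) := by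
  have h := (shifts_a (q := q).pow i).mul ((shifts_b.pow j).mul (shifts_c.pow k))
  rwa [show (i : ℤ) * -1 + (j * 0 + k * 0) = -i by ring,
    show (i : ℤ) * 0 + (j * -1 + k * 1) = k - j by ring] at h

theorem shifts_monD (i j k : ℕ) : Shifts (monD q i j k) i (k - j) := by
  have h := (shifts_d (q := q).pow i).mul ((shifts_b.pow j).mul (shifts_c.pow k))
  rwa [show (i : ℤ) * 1 + (j * 0 + k * 0) = i by ring,
    show (i : ℤ) * 0 + (j * -1 + k * 1) = k - j by ring] at h

/-! ### The Haar state on ordered monomials -/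

theorem rep_b_single (n : ℕ) (l : ℤ) (z : ℂ) : rep q (gen q Gen.b) (Finsupp.single (n, l) z) =
    Finsupp.single (n, l - 1) (z * (-((q : ℝ) : ℂ) ^ (n + 1))) := by
  rw [rep_gen]
  refine (weighted_single _ _ _ _).trans ?_
  push_cast; rfl

theorem rep_c_single (n : ℕ) (l : ℤ) (z : ℂ) : rep q (gen q Gen.c) (Finsupp.single (n, l) z) =
    Finsupp.single (n, l + 1) (z * ((q : ℝ) : ℂ) ^ n) := by
  rw [rep_gen]
  refine (weighted_single _ _ _ _).trans ?_
  push_cast; rfl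

theorem rep_bc_pow_single (n j : ℕ) (l : ℤ) (z : ℂ) :
    rep q ((gen q Gen.b * gen q Gen.c) ^ j) (Finsupp.single (n, l) z) =
      Finsupp.single (n, l) (z * (-((q : ℝ) : ℂ) ^ (2 * n + 1)) ^ j) := by
  induction j generalizing z with
  | zero => simp
  | succ j ih =>
    rw [pow_succ, map_mul, Module.End.mul_apply, map_mul, Module.End.mul_apply, rep_c_single,
      rep_b_single, add_sub_cancel_right, ih]
    congr 1
    ring

theorem q_pow_lt_one {n : ℕ} (hn : n ≠ 0) : (q : ℝ) ^ n < 1 := pow_lt_one₀ q.2.1.le q.2.2 hn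

theorem one_sub_q_pow_ne_zero {n : ℕ} (hn : n ≠ 0) : (1 - ((q : ℝ) : ℂ) ^ n) ≠ 0 := by
  have := (sub_pos.mpr (q_pow_lt_one (q := q) hn)).ne'
  exact_mod_cast this

/-- The element `bc` is diagonal with entries `-q^{2n+1}`, so the value is a geometric series. -/
theorem haar_bc_pow (j : ℕ) : haar q ((gen q Gen.b * gen q Gen.c) ^ j) =
    (1 - ((q : ℝ) : ℂ) ^ 2) * ((-((q : ℝ) : ℂ)) ^ j / (1 - ((q : ℝ) : ℂ) ^ (2 * j + 2))) := by
  change _ * ∑' n, haarTerm q _ n = _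
  have h1 : ∀ n, haarTerm q ((gen q Gen.b * gen q Gen.c) ^ j) n =
      (-((q : ℝ) : ℂ)) ^ j * (((q : ℝ) : ℂ) ^ (2 * j + 2)) ^ n := by
    intro n
    rw [haarTerm, rep_bc_pow_single, Finsupp.single_eq_same, neg_pow, neg_pow ((q : ℝ) : ℂ)]
    push_cast
    ring
  rw [tsum_congr h1, tsum_mul_left, tsum_geometric_of_norm_lt_one, div_eq_mul_inv]
  · push_cast; rfl
  · rw [norm_pow, Complex.norm_real, Real.norm_eq_abs, abs_of_pos q.2.1]
    exact q_pow_lt_one (by omega)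

theorem linearMap_ext_mon {V : Type*} [AddCommGroup V] [Module ℂ V] {f g : CoordAlg q →ₗ[ℂ] V}
    (hA : ∀ i j k, f (monA q i j k) = g (monA q i j k))
    (hD : ∀ i j k, f (monD q i j k) = g (monD q i j k)) (x : CoordAlg q) : f x = g x := by
  obtain ⟨M, hx⟩ := exists_mem_genSpan_pow x
  have hx := genSpan_pow_le M hx
  refine LinearMap.eqOn_span (s := _) ?_ hx
  rintro x ⟨i, j, k, -, rfl | rfl⟩
  exacts [hA i j k, hD i j k]

/-- Monomials are eigenvectors of `K`. By their shifts, `h` kills all of them except those with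
equal powers of `b` and `c` and no `a` or `d`, and on these `K` is the identity. -/
theorem haar_actK (x : CoordAlg q) : haar q (actK q x) = haar q x := by
  have hs := sqrtQ_ne_zero q
  refine linearMap_ext_mon (f := haar q ∘ₗ (actK q).toLinearMap) (g := haar q) ?_ ?_ x
  · intro i j k
    have h1 : actK q (monA q i j k) =
        (sqrtQ q ^ i * ((sqrtQ q)⁻¹ ^ j * sqrtQ q ^ k)) • monA q i j k := by
      simp only [monA, map_mul, map_pow, actK_a, actK_b, actK_c, smul_pow, smul_mul_assoc,
        mul_smul_comm, smul_smul]
      congr 1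
      ring
    rw [LinearMap.comp_apply, AlgHom.toLinearMap_apply, h1, map_smul]
    by_cases h : i = 0 ∧ j = k
    · obtain ⟨rfl, rfl⟩ := h
      rw [pow_zero, one_mul, ← mul_pow, inv_mul_cancel₀ hs, one_pow, one_smul]
    · rw [(shifts_monA i j k).haar_eq_zero (by omega), smul_zero]
  · intro i j k
    have h1 : actK q (monD q i j k) =
        ((sqrtQ q)⁻¹ ^ i * ((sqrtQ q)⁻¹ ^ j * sqrtQ q ^ k)) • monD q i j k := by
      simp only [monD, map_mul, map_pow, actK_d, actK_b, actK_c, smul_pow, smul_mul_assoc,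
        mul_smul_comm, smul_smul]
      congr 1
      ring
    rw [LinearMap.comp_apply, AlgHom.toLinearMap_apply, h1, map_smul]
    by_cases h : i = 0 ∧ j = k
    · obtain ⟨rfl, rfl⟩ := h
      rw [pow_zero, one_mul, ← mul_pow, inv_mul_cancel₀ hs, one_pow, one_smul]
    · rw [(shifts_monD i j k).haar_eq_zero (by omega), smul_zero]

/-! ### Vanishing of the Haar state on the image of `∂_f` -/

/-- The factor in `∂_f (x^n) = c_n x^{n-1} ∂_f x` for `x = a` and `x = c`. -/
def powCoeff (q : Set.Ioo (0 : ℝ) 1) : ℕ → ℂ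
  | 0 => 0
  | n + 1 => sqrtQ q * powCoeff q n + ((sqrtQ q)⁻¹ ^ 3) ^ n

/-- The closed form `c_n = q^{3(1-n)/2} (1 - q^{2n}) / (1 - q²)`, with denominators cleared. -/
theorem powCoeff_mul (n : ℕ) : powCoeff q n * (1 - ((q : ℝ) : ℂ) ^ 2) * sqrtQ q ^ (3 * n) =
    sqrtQ q ^ 3 * (1 - ((q : ℝ) : ℂ) ^ (2 * n)) := by
  have hs := sqrtQ_ne_zero q
  induction n with
  | zero => simp [powCoeff]
  | succ n ih =>
    have h1 : ((sqrtQ q)⁻¹ ^ 3) ^ n * sqrtQ q ^ (3 * n) = 1 := by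
      rw [pow_mul, ← mul_pow, ← mul_pow, inv_mul_cancel₀ hs, one_pow, one_pow]
    rw [powCoeff]
    have h2 := sqrtQ_mul_self q
    rw [h2] at ih ⊢
    linear_combination sqrtQ q ^ 4 * ih + (1 - (sqrtQ q * sqrtQ q) ^ 2) * sqrtQ q ^ 3 * h1

theorem actF_pow {x y : CoordAlg q} (hK : actK q x = sqrtQ q • x)
    (hKinv : actKinv q x = (sqrtQ q)⁻¹ • x) (hF : actF q x = y)
    (hyx : y * x = ((q : ℝ) : ℂ)⁻¹ • (x * y)) (n : ℕ) :
    actF q (x ^ (n + 1)) = powCoeff q (n + 1) • (x ^ n * y) := by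
  induction n with
  | zero => simp [hF, powCoeff]
  | succ n ih =>
    rw [pow_succ' x (n + 1), actF_mul, ih, hK, hF, map_pow, hKinv, smul_pow, mul_smul_comm,
      mul_smul_comm,
      mul_pow_of_qcomm hyx, smul_mul_assoc, smul_smul, smul_smul, ← mul_assoc, ← pow_succ', ← add_smul,
      powCoeff.eq_2 q (n + 1)]
    congr 1
    have : ((q : ℝ) : ℂ)⁻¹ = (sqrtQ q)⁻¹ * (sqrtQ q)⁻¹ := by rw [sqrtQ_mul_self, mul_inv]
    rw [this]
    ring

theorem actF_a_pow (n : ℕ) : actF q (gen q Gen.a ^ (n + 1)) =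
    powCoeff q (n + 1) • (gen q Gen.a ^ n * gen q Gen.b) := by
  refine actF_pow actK_a actKinv_a actF_a ?_ n
  rw [(isQuad_gen q).ab, smul_smul, inv_mul_cancel₀ (q_ne_zero q), one_smul]

theorem actF_c_pow (n : ℕ) : actF q (gen q Gen.c ^ (n + 1)) =
    powCoeff q (n + 1) • (gen q Gen.c ^ n * gen q Gen.d) := by
  refine actF_pow actK_c actKinv_c actF_c ?_ n
  rw [(isQuad_gen q).cd, smul_smul, inv_mul_cancel₀ (q_ne_zero q), one_smul]

theorem actF_pow_eq_zero {x : CoordAlg q} (hF : actF q x = 0) (n : ℕ) : actF q (x ^ n) = 0 := by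
  induction n with
  | zero => rw [pow_zero, actF_one]
  | succ n ih => rw [pow_succ, actF_mul, hF, ih, mul_zero, zero_mul, add_zero]

theorem actF_bc (j k : ℕ) : ∃ z : ℂ, actF q (gen q Gen.b ^ j * gen q Gen.c ^ (k + 1)) =
    z • (gen q Gen.b ^ j * (gen q Gen.c ^ k * gen q Gen.d)) ∧
    z = (sqrtQ q)⁻¹ ^ j * powCoeff q (k + 1) := by
  refine ⟨_, ?_, rfl⟩
  rw [actF_mul, actF_pow_eq_zero actF_b, zero_mul, add_zero, map_pow, actK_b, smul_pow, actF_c_pow,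
    smul_mul_smul_comm]

theorem mul_d_of_bc (j : ℕ) : gen q Gen.a * (gen q Gen.b ^ j * (gen q Gen.c ^ j * gen q Gen.d)) =
    ((q : ℝ) : ℂ) ^ (2 * j) • ((gen q Gen.b * gen q Gen.c) ^ j +
      ((q : ℝ) : ℂ) • (gen q Gen.b * gen q Gen.c) ^ (j + 1)) := by
  have hcomm : Commute (gen q Gen.b) (gen q Gen.c) := gen_bc
  have h : (gen q Gen.b * gen q Gen.c) * gen q Gen.d =
      ((q : ℝ) : ℂ) ^ 2 • (gen q Gen.d * (gen q Gen.b * gen q Gen.c)) := by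
    rw [mul_assoc, (isQuad_gen q).cd, mul_smul_comm, ← mul_assoc, (isQuad_gen q).bd,
      smul_mul_assoc, smul_smul, mul_assoc, pow_two]
  have h2 : (gen q Gen.b * gen q Gen.c) ^ j * gen q Gen.d =
      ((q : ℝ) : ℂ) ^ (2 * j) • (gen q Gen.d * (gen q Gen.b * gen q Gen.c) ^ j) := by
    induction j with
    | zero => simp
    | succ j ih =>
      rw [pow_succ', mul_assoc, ih, mul_smul_comm, ← mul_assoc, h, smul_mul_assoc, smul_smul,
        mul_assoc]
      congr 1
      ring
  rw [← mul_assoc (gen q Gen.b ^ j), ← hcomm.mul_pow, h2, mul_smul_comm, ← mul_assoc, gen_a_mul_d,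
    add_mul, one_mul, smul_mul_assoc, ← pow_succ']

/-- The one family where shifts do not decide. `F (a b^j c^{j+1})` is a combination of `(bc)^j` and
`(bc)^{j+1}`, and the values of `h` on these two powers make the contributions cancel. -/
theorem haar_actF_special (j : ℕ) : haar q (actF q (monA q 1 j (j + 1))) = 0 := by
  have hs := sqrtQ_ne_zero q
  obtain ⟨z, hz, hz'⟩ := actF_bc (q := q) j j
  have h1 : actKinv q (gen q Gen.b ^ j * gen q Gen.c ^ (j + 1)) =
      (sqrtQ q)⁻¹ • (gen q Gen.b ^ j * gen q Gen.c ^ (j + 1)) := by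
    rw [map_mul, map_pow, map_pow, actKinv_b, actKinv_c, smul_pow, smul_pow, smul_mul_smul_comm,
      pow_succ, ← mul_assoc, ← mul_pow, mul_inv_cancel₀ hs, one_pow, one_mul]
  rw [monA, pow_one, actF_mul, actK_a, actF_a, hz, smul_mul_smul_comm, mul_d_of_bc, h1,
    mul_smul_comm, ← mul_assoc, ← pow_succ',
    ← (show Commute (gen q Gen.b) (gen q Gen.c) from gen_bc).mul_pow]
  simp only [map_add, map_smul, smul_eq_mul, haar_bc_pow]
  have e1 := one_sub_q_pow_ne_zero (q := q) (n := 2 * j + 2) (by omega)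
  have e2 := one_sub_q_pow_ne_zero (q := q) (n := 2 * (j + 1) + 2) (by omega)
  have hc := powCoeff_mul (q := q) (j + 1)
  -- By the closed form of `powCoeff`, `z q^{2j}` is `(1 - q^{2j+2}) / (1 - q²)`, which cancels the
  -- denominator of `h((bc)^j)`.
  have hz2 : z * (1 - ((q : ℝ) : ℂ) ^ 2) * ((q : ℝ) : ℂ) ^ (2 * j) =
      1 - ((q : ℝ) : ℂ) ^ (2 * j + 2) := by
    have h3 : sqrtQ q ^ (3 * (j + 1)) * (sqrtQ q)⁻¹ ^ j = sqrtQ q ^ 3 * ((q : ℝ) : ℂ) ^ j := by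
      rw [sqrtQ_mul_self, inv_pow, ← div_eq_mul_inv, div_eq_iff (pow_ne_zero _ hs)]; ring
    have h4 : (sqrtQ q)⁻¹ ^ j * sqrtQ q ^ j = 1 := by rw [← mul_pow, inv_mul_cancel₀ hs, one_pow]
    apply mul_right_cancel₀ (pow_ne_zero 3 hs)
    rw [hz', sqrtQ_mul_self] at *
    have h5 : (sqrtQ q)⁻¹ ^ j * powCoeff q (j + 1) * (1 - (sqrtQ q * sqrtQ q) ^ 2) *
        (sqrtQ q * sqrtQ q) ^ (2 * j) * sqrtQ q ^ 3 = (sqrtQ q)⁻¹ ^ j * sqrtQ q ^ j *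
        (powCoeff q (j + 1) * (1 - (sqrtQ q * sqrtQ q) ^ 2) * sqrtQ q ^ (3 * (j + 1))) := by ring
    rw [h5, hc, h4]
    ring
  have hz3 : sqrtQ q * z * ((q : ℝ) : ℂ) ^ (2 * j) * (1 - ((q : ℝ) : ℂ) ^ 2) =
      sqrtQ q * (1 - ((q : ℝ) : ℂ) ^ (2 * j + 2)) := by rw [← hz2]; ring
  have hA : (-((q : ℝ) : ℂ)) ^ j / (1 - ((q : ℝ) : ℂ) ^ (2 * j + 2)) *
      (1 - ((q : ℝ) : ℂ) ^ (2 * j + 2)) = (-((q : ℝ) : ℂ)) ^ j := div_mul_cancel₀ _ e1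
  have hB : (-((q : ℝ) : ℂ)) ^ j / (1 - ((q : ℝ) : ℂ) ^ (2 * (j + 1) + 2)) *
      (1 - ((q : ℝ) : ℂ) ^ (2 * (j + 1) + 2)) = (-((q : ℝ) : ℂ)) ^ j := div_mul_cancel₀ _ e2
  have hσ : (sqrtQ q)⁻¹ * ((q : ℝ) : ℂ) = sqrtQ q := by
    rw [sqrtQ_mul_self, inv_mul_cancel_left₀ hs]
  rw [pow_succ (-((q : ℝ) : ℂ)) j, mul_div_right_comm]
  generalize (-((q : ℝ) : ℂ)) ^ j / (1 - ((q : ℝ) : ℂ) ^ (2 * j + 2)) = A at *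
  generalize (-((q : ℝ) : ℂ)) ^ j / (1 - ((q : ℝ) : ℂ) ^ (2 * (j + 1) + 2)) = B at *
  linear_combination (A - ((q : ℝ) : ℂ) ^ 2 * B) * hz3 + sqrtQ q * hA - sqrtQ q * hB -
    (1 - ((q : ℝ) : ℂ) ^ 2) * B * hσ

/-- Apart from the monomials `a b^j c^{j+1}`, each term of the Leibniz rule is zero or a nontrivial
shift. -/
theorem haar_actF (x : CoordAlg q) : haar q (actF q x) = 0 := by
  refine linearMap_ext_mon (f := haar q ∘ₗ actF q) (g := 0) ?_ ?_ x
  · intro i j k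
    rw [LinearMap.comp_apply, LinearMap.zero_apply]
    by_cases h : i = 1 ∧ k = j + 1
    · obtain ⟨rfl, rfl⟩ := h
      exact haar_actF_special j
    · have hKinv : actKinv q (gen q Gen.b ^ j * gen q Gen.c ^ k) =
          (sqrtQ q ^ j * (sqrtQ q)⁻¹ ^ k) • (gen q Gen.b ^ j * gen q Gen.c ^ k) := by
        simp only [map_mul, map_pow, actKinv_b, actKinv_c, smul_pow, smul_mul_smul_comm]
      rw [monA, actF_mul, map_add, map_pow, actK_a, smul_pow, hKinv]
      have h1 : haar q (sqrtQ q ^ i • gen q Gen.a ^ i *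
          actF q (gen q Gen.b ^ j * gen q Gen.c ^ k)) = 0 := by
        rcases k with _ | k
        · rw [pow_zero, mul_one, actF_pow_eq_zero actF_b, mul_zero, map_zero]
        · obtain ⟨z, hz, -⟩ := actF_bc (q := q) j k
          rw [hz, smul_mul_smul_comm]
          refine (((shifts_a.pow i).mul ((shifts_b.pow j).mul ((shifts_c.pow k).mul
            shifts_d))).smul _).haar_eq_zero ?_
          omega
      have h2 : haar q (actF q (gen q Gen.a ^ i) * ((sqrtQ q ^ j * (sqrtQ q)⁻¹ ^ k) •
          (gen q Gen.b ^ j * gen q Gen.c ^ k))) = 0 := by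
        rcases i with _ | i
        · rw [pow_zero, actF_one, zero_mul, map_zero]
        · rw [actF_a_pow, smul_mul_smul_comm]
          refine ((((shifts_a.pow i).mul shifts_b).mul ((shifts_b.pow j).mul
            (shifts_c.pow k))).smul _).haar_eq_zero ?_
          push_cast at *
          omega
      rw [h1, h2, add_zero]
  · intro i j k
    rw [LinearMap.comp_apply, LinearMap.zero_apply, monD, actF_mul, actF_pow_eq_zero actF_d,
      zero_mul, add_zero, map_pow, actK_d, smul_pow]
    rcases k with _ | k
    · rw [pow_zero, mul_one, actF_pow_eq_zero actF_b, mul_zero, map_zero]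
    · obtain ⟨z, hz, -⟩ := actF_bc (q := q) j k
      rw [hz, smul_mul_smul_comm]
      refine (((shifts_d.pow i).mul ((shifts_b.pow j).mul ((shifts_c.pow k).mul
        shifts_d))).smul _).haar_eq_zero ?_
      omega

/-- `∂_e` and `∂_f` are adjoint to each other for the inner product of the Haar state. -/
theorem haar_star_mul_actF (x y : CoordAlg q) :
    haar q (star x * actF q y) = haar q (star (actE q x) * y) := by
  have hq := q_ne_zero q
  -- The Leibniz rule on this product gives `h(x^* F y)` plus a term whose second factor is `K⁻¹ y`;
  -- there `h ∘ K = h` removes the `K⁻¹`.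
  have h1 := haar_actF (actKinv q (star x) * y)
  have h2 : actK q (actF q (actKinv q (star x))) = -star (actE q x) := by
    have h3 := actF_actK (actKinv q (star x))
    rw [actK_actKinv, actF_star] at h3
    have h4 := congrArg (fun w => ((q : ℝ) : ℂ)⁻¹ • w) h3
    simp only [neg_smul, smul_neg, smul_smul, inv_mul_cancel₀ hq, one_smul] at h4
    exact h4.symm
  rw [actF_mul, actK_actKinv, map_add, ← haar_actK (_ * actKinv q y), map_mul (actK q), h2, actK_actKinv,
    neg_mul, map_neg, add_neg_eq_zero] at h1
  exact h1

/-! ## Quantum integers -/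

theorem sqrt_q_pos (q : Set.Ioo (0 : ℝ) 1) : 0 < Real.sqrt (q : ℝ) := Real.sqrt_pos.mpr q.2.1

theorem sqrt_q_lt_one (q : Set.Ioo (0 : ℝ) 1) : Real.sqrt (q : ℝ) < 1 := by
  rw [Real.sqrt_lt' one_pos, one_pow]; exact q.2.2

theorem sqrt_q_sq (q : Set.Ioo (0 : ℝ) 1) : Real.sqrt (q : ℝ) ^ (2 : ℤ) = q := by
  exact_mod_cast Real.sq_sqrt q.2.1.le

theorem q_sub_inv_neg (q : Set.Ioo (0 : ℝ) 1) : (q : ℝ) - (q : ℝ)⁻¹ < 0 := by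
  have := (one_lt_inv₀ q.2.1).mpr q.2.2
  linarith [q.2.2]

/-- The quantum number `[k/2] = (q^{k/2} - q^{-k/2}) / (q - q⁻¹)`. -/
def qNum (q : Set.Ioo (0 : ℝ) 1) (k : ℤ) : ℝ :=
  (Real.sqrt (q : ℝ) ^ k - Real.sqrt (q : ℝ) ^ (-k)) / ((q : ℝ) - (q : ℝ)⁻¹)

theorem qNum_zero : qNum q 0 = 0 := by simp [qNum]

theorem qNum_strictMono : StrictMono (qNum q) := by
  intro k l h
  have h1 := zpow_right_strictAnti₀ (sqrt_q_pos q) (sqrt_q_lt_one q) h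
  have h2 := zpow_right_strictAnti₀ (sqrt_q_pos q) (sqrt_q_lt_one q) (neg_lt_neg h)
  refine div_lt_div_of_neg_of_lt (q_sub_inv_neg q) ?_
  linarith

theorem qNum_pos {k : ℤ} (h : 0 < k) : 0 < qNum q k := by
  rw [← qNum_zero (q := q)]; exact qNum_strictMono h

theorem qNum_neg (k : ℤ) : qNum q (-k) = -qNum q k := by
  rw [qNum, qNum, neg_neg, ← neg_div, neg_sub]

theorem qNum_mul (k l : ℤ) : qNum q k * qNum q l =
    (Real.sqrt (q : ℝ) ^ (k + l) + Real.sqrt (q : ℝ) ^ (-(k + l)) - Real.sqrt (q : ℝ) ^ (k - l) -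
      Real.sqrt (q : ℝ) ^ (l - k)) / ((q : ℝ) - (q : ℝ)⁻¹) ^ 2 := by
  have h := (sqrt_q_pos q).ne'
  rw [qNum, qNum, div_mul_div_comm, ← pow_two]
  congr 1
  rw [neg_add, sub_eq_add_neg k, sub_eq_add_neg l, add_comm l, zpow_add₀ h, zpow_add₀ h,
    zpow_add₀ h, zpow_add₀ h]
  ring

/-- The identity `[p+1][m-p] + [m-2p-2] = [p+2][m-p-1]`, which is the induction step in computing
`E` on a ladder. -/
theorem qNum_ladder (m p : ℤ) : qNum q (2 * (p + 1)) * qNum q (2 * (m - p)) +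
    qNum q (2 * (m - 2 * (p + 1))) = qNum q (2 * (p + 1 + 1)) * qNum q (2 * (m - (p + 1))) := by
  have h := (sqrt_q_pos q).ne'
  have hd := (q_sub_inv_neg q).ne
  have h2 : (Real.sqrt (q : ℝ) ^ (-2 : ℤ)) = (q : ℝ)⁻¹ := by rw [zpow_neg, sqrt_q_sq]
  have h3 : ∀ k, qNum q k = (Real.sqrt (q : ℝ) ^ k - Real.sqrt (q : ℝ) ^ (-k)) *
      ((q : ℝ) - (q : ℝ)⁻¹) / ((q : ℝ) - (q : ℝ)⁻¹) ^ 2 := fun k => by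
    rw [qNum, pow_two, mul_div_mul_right _ _ hd]
  rw [qNum_mul, qNum_mul, h3, ← add_div]
  congr 1
  generalize hD : (q : ℝ) - (q : ℝ)⁻¹ = D
  rw [show 2 * (p + 1) + 2 * (m - p) = 2 * (p + 1 + 1) + 2 * (m - (p + 1)) by ring]
  rw [show 2 * (p + 1) - 2 * (m - p) = -(2 * (m - 2 * (p + 1))) + (-2) by ring,
    show 2 * (m - p) - 2 * (p + 1) = 2 * (m - 2 * (p + 1)) + 2 by ring,
    show 2 * (p + 1 + 1) - 2 * (m - (p + 1)) = -(2 * (m - 2 * (p + 1))) + 2 by ring,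
    show 2 * (m - (p + 1)) - 2 * (p + 1 + 1) = 2 * (m - 2 * (p + 1)) + (-2) by ring,
    zpow_add₀ h _ 2, zpow_add₀ h _ (-2), zpow_add₀ h _ 2, zpow_add₀ h _ (-2), h2, sqrt_q_sq, ← hD]
  ring

/-! ## The ladder of weight vectors -/

/-- The weight vector `∂_f^p (a^i c^j)`. -/
def ladder (q : Set.Ioo (0 : ℝ) 1) (i j p : ℕ) : CoordAlg q :=
  (opF q ^ p) (gen q Gen.a ^ i * gen q Gen.c ^ j)

theorem ladder_zero (i j : ℕ) : ladder q i j 0 = gen q Gen.a ^ i * gen q Gen.c ^ j := rfl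

theorem actF_ladder (i j p : ℕ) : actF q (ladder q i j p) = ladder q i j (p + 1) := by
  rw [ladder, ladder, pow_succ', Module.End.mul_apply]; rfl

theorem actK_ladder (i j p : ℕ) : actK q (ladder q i j p) =
    sqrtQ q ^ ((i : ℤ) + j - 2 * p) • ladder q i j p := by
  have hs := sqrtQ_ne_zero q
  induction p with
  | zero =>
    rw [ladder_zero, map_mul, map_pow, map_pow, actK_a, actK_c, smul_pow, smul_pow,
      smul_mul_smul_comm, ← pow_add]
    simp [← zpow_natCast]
  | succ p ih =>
    have h := actF_actK (ladder q i j p)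
    rw [ih, map_smul, actF_ladder] at h
    have h2 : actK q (ladder q i j (p + 1)) = ((q : ℝ) : ℂ)⁻¹ • (((q : ℝ) : ℂ) •
        actK q (ladder q i j (p + 1))) := by
      rw [smul_smul, inv_mul_cancel₀ (q_ne_zero q), one_smul]
    rw [h2, ← h, smul_smul, sqrtQ_mul_self]
    congr 1
    have h3 : (i : ℤ) + j - 2 * (p : ℤ) = (i : ℤ) + j - 2 * ((p + 1 : ℕ) : ℤ) + 1 + 1 := by
      push_cast; ring
    rw [h3, zpow_add_one₀ hs, zpow_add_one₀ hs]
    field_simp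

theorem actKinv_ladder (i j p : ℕ) : actKinv q (ladder q i j p) =
    sqrtQ q ^ (-((i : ℤ) + j - 2 * p)) • ladder q i j p := by
  have h := congrArg (actKinv q) (actK_ladder (q := q) i j p)
  rw [actKinv_actK, map_smul] at h
  conv_rhs => rw [h]
  rw [smul_smul, zpow_neg, inv_mul_cancel₀ (zpow_ne_zero _ (sqrtQ_ne_zero q)), one_smul]

/-- `E` kills `a` and `c`, hence by the Leibniz rule every `a^i c^j`: these are highest weight
vectors. -/
theorem actE_ladder_zero (i j : ℕ) : actE q (ladder q i j 0) = 0 := by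
  have key : ∀ (x : CoordAlg q), actE q x = 0 → ∀ n : ℕ, actE q (x ^ n) = 0 := by
    intro x hx n
    induction n with
    | zero => rw [pow_zero, actE_one]
    | succ n ih => rw [pow_succ, actE_mul, hx, ih, mul_zero, zero_mul, add_zero]
  rw [ladder_zero, actE_mul, key _ actE_a, key _ actE_c, mul_zero, zero_mul, add_zero]

/-- The commutator of `∂_e` and `∂_f` on a weight vector. -/
theorem actE_actF_ladder (i j p : ℕ) :
    actE q (actF q (ladder q i j p)) = actF q (actE q (ladder q i j p)) +
      ((qNum q (2 * ((i : ℤ) + j - 2 * p)) : ℝ) : ℂ) • ladder q i j p := by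
  have hd : ((q : ℝ) : ℂ) - ((q : ℝ) : ℂ)⁻¹ ≠ 0 := by exact_mod_cast (q_sub_inv_neg q).ne
  have h := actE_actF_sub (ladder q i j p)
  rw [actK_ladder, map_smul, actK_ladder, actKinv_ladder, map_smul, actKinv_ladder, smul_smul,
    smul_smul, ← sub_smul, ← zpow_add₀ (sqrtQ_ne_zero q), ← zpow_add₀ (sqrtQ_ne_zero q)] at h
  rw [← sub_eq_iff_eq_add', ← one_smul ℂ (actE q _ - _), ← inv_mul_cancel₀ hd, mul_smul, h,
    smul_smul]
  congr 1
  rw [qNum]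
  rw [two_mul ((i : ℤ) + j - 2 * p), neg_add ((i : ℤ) + j - 2 * p), div_eq_inv_mul]
  push_cast
  rfl

/-- As for `sl_2`: commuting `E` past one `F` adds the quantum integer of the weight, and these add
up along the ladder. -/
theorem actE_ladder_succ (i j p : ℕ) : actE q (ladder q i j (p + 1)) =
    ((qNum q (2 * ((p : ℤ) + 1)) * qNum q (2 * ((i : ℤ) + j - p)) : ℝ) : ℂ) • ladder q i j p := by
  induction p with
  | zero =>
    rw [← actF_ladder, actE_actF_ladder, actE_ladder_zero, map_zero, zero_add]
    congr 2
    have h1 : qNum q 2 = 1 := by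
      rw [qNum, zpow_neg, sqrt_q_sq, div_self (q_sub_inv_neg q).ne]
    simp [h1]
  | succ p ih =>
    rw [← actF_ladder, actE_actF_ladder, ih, map_smul, actF_ladder, ← add_smul, ← Complex.ofReal_add]
    have := qNum_ladder (q := q) ((i : ℤ) + j) p
    rw [Nat.cast_succ, this]

theorem inner_actF_right (x y : CoordAlg q) :
    ⟪incl q x, incl q (actF q y)⟫_ℂ = ⟪incl q (actE q x), incl q y⟫_ℂ := by
  rw [inner_incl, inner_incl, haar_star_mul_actF]

theorem inner_actF_left (x y : CoordAlg q) :
    ⟪incl q (actF q x), incl q y⟫_ℂ = ⟪incl q x, incl q (actE q y)⟫_ℂ := by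
  rw [← inner_conj_symm, inner_actF_right, inner_conj_symm]

theorem inner_ladder_succ (i j p i' j' p' : ℕ) :
    ⟪incl q (ladder q i j (p + 1)), incl q (ladder q i' j' (p' + 1))⟫_ℂ =
      ((qNum q (2 * ((p' : ℤ) + 1)) * qNum q (2 * ((i' : ℤ) + j' - p')) : ℝ) : ℂ) *
        ⟪incl q (ladder q i j p), incl q (ladder q i' j' p')⟫_ℂ := by
  rw [← actF_ladder, inner_actF_left, actE_ladder_succ, map_smul, inner_smul_right]

/-- Remove `F` from both vectors in pairs by adjointness. If one side runs out first, `E` meets a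
highest weight vector; if both do together, `a^i c^j` and `a^{i'} c^{j'}` have different shifts. -/
theorem inner_ladder_eq_zero {i j p i' j' p' : ℕ} (h : (i, j, p) ≠ (i', j', p')) :
    ⟪incl q (ladder q i j p), incl q (ladder q i' j' p')⟫_ℂ = 0 := by
  induction p generalizing p' with
  | zero =>
    rcases p' with _ | p'
    · rw [inner_incl, ladder_zero, ladder_zero]
      refine ((shifts_a.pow i).mul (shifts_c.pow j)).haar_star_mul_eq_zero
        ((shifts_a.pow i').mul (shifts_c.pow j')) ?_
      simp only [ne_eq, Prod.mk.injEq, and_true] at h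
      omega
    · rw [← actF_ladder, inner_actF_right, actE_ladder_zero, map_zero, inner_zero_left]
  | succ p ih =>
    rcases p' with _ | p'
    · rw [← actF_ladder, inner_actF_left, actE_ladder_zero, map_zero, inner_zero_right]
    · rw [inner_ladder_succ, ih, mul_zero]
      simpa using h

theorem pairing_self_pos {u : Fock} {p : ℕ × ℤ} (h : u p ≠ 0) : 0 < (pairing u u).re := by
  unfold pairing
  rw [Finsupp.sum, Complex.re_sum]
  refine Finset.sum_pos' (fun p' _ => ?_) ⟨p, Finsupp.mem_support_iff.mpr h, ?_⟩
  · rw [← Complex.normSq_eq_conj_mul_self, Complex.ofReal_re]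
    exact Complex.normSq_nonneg _
  · rw [← Complex.normSq_eq_conj_mul_self, Complex.ofReal_re]
    exact Complex.normSq_pos.mpr h

theorem haar_star_mul_self_pos {x : CoordAlg q} {n : ℕ} {p : ℕ × ℤ}
    (h : rep q x (Finsupp.single (n, 0) 1) p ≠ 0) : 0 < (haar q (star x * x)).re := by
  have h1 : ∀ n, haarTerm q (star x * x) n = (((q : ℝ) ^ (2 * n) : ℝ) : ℂ) *
      pairing (rep q x (Finsupp.single (n, 0) 1)) (rep q x (Finsupp.single (n, 0) 1)) := by
    intro n
    rw [haarTerm, map_mul, Module.End.mul_apply, ← pairing_single_left, ← pairing_rep_star,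
      star_star]
  change 0 < (_ * ∑' n, haarTerm q (star x * x) n).re
  have h2 := summable_haarTerm q (star x * x)
  rw [Complex.re_ofReal_mul, Complex.re_tsum h2]
  have h3 : 0 < 1 - (q : ℝ) ^ 2 := sub_pos.mpr (q_pow_lt_one two_ne_zero)
  refine mul_pos h3 (Summable.tsum_pos (Complex.hasSum_re h2.hasSum).summable (fun k => ?_) n ?_)
  · rw [h1, Complex.re_ofReal_mul]
    exact mul_nonneg (pow_nonneg q.2.1.le _) (pairing_self_nonneg _)
  · rw [h1, Complex.re_ofReal_mul]
    exact mul_pos (pow_pos q.2.1 _) (pairing_self_pos h)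

theorem rep_c_pow_single (j n : ℕ) (l : ℤ) (z : ℂ) (hz : z ≠ 0) :
    ∃ w : ℂ, w ≠ 0 ∧ rep q (gen q Gen.c ^ j) (Finsupp.single (n, l) z) =
      Finsupp.single (n, l + j) w := by
  induction j generalizing l z with
  | zero => exact ⟨z, hz, by simp⟩
  | succ j ih =>
    obtain ⟨w, hw, h⟩ := ih (l + 1) (z * ((q : ℝ) : ℂ) ^ n)
      (mul_ne_zero hz (pow_ne_zero _ (q_ne_zero q)))
    refine ⟨w, hw, ?_⟩
    rw [pow_succ, map_mul, Module.End.mul_apply, rep_c_single, h]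
    congr 2
    push_cast; ring

theorem rep_a_pow_single (i : ℕ) (l : ℤ) (z : ℂ) (hz : z ≠ 0) :
    ∃ w : ℂ, w ≠ 0 ∧ rep q (gen q Gen.a ^ i) (Finsupp.single (i, l) z) =
      Finsupp.single (0, l) w := by
  induction i generalizing z with
  | zero => exact ⟨z, hz, by simp⟩
  | succ i ih =>
    have hpos : 0 < Real.sqrt (1 - (q : ℝ) ^ (2 * (i + 1))) :=
      Real.sqrt_pos.mpr (sub_pos.mpr (q_pow_lt_one (by omega)))
    obtain ⟨w, hw, h⟩ := ih (z * (Real.sqrt (1 - (q : ℝ) ^ (2 * (i + 1))) : ℝ))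
      (mul_ne_zero hz (by exact_mod_cast hpos.ne'))
    refine ⟨w, hw, ?_⟩
    rw [pow_succ, map_mul, Module.End.mul_apply, rep_gen]
    refine (congrArg _ (weighted_single _ _ _ _)).trans ?_
    exact h

/-- The vector `a^i c^j e_{i,0}` is a nonzero multiple of `e_{0,j}`, and each step down the ladder
multiplies the squared norm by `[p+1][i+j-p] > 0`. -/
theorem inner_ladder_self_pos {i j p : ℕ} (h : p ≤ i + j) :
    0 < (⟪incl q (ladder q i j p), incl q (ladder q i j p)⟫_ℂ).re := by
  induction p with
  | zero =>
    obtain ⟨w, hw, h1⟩ := rep_c_pow_single (q := q) j i 0 1 one_ne_zero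
    obtain ⟨w', hw', h2⟩ := rep_a_pow_single (q := q) i (0 + j) w hw
    rw [inner_incl, ladder_zero]
    refine haar_star_mul_self_pos (n := i) (p := (0, 0 + j)) ?_
    rw [map_mul, Module.End.mul_apply, h1, h2, Finsupp.single_eq_same]
    exact hw'
  | succ p ih =>
    rw [inner_ladder_succ, Complex.re_ofReal_mul]
    exact mul_pos (mul_pos (qNum_pos (by omega)) (qNum_pos (by omega))) (ih (by omega))

/-! ## The orthonormal basis of weight vectors -/

/-- The index set of the basis of weight vectors. -/
abbrev WeightIndex : Type := {x : ℕ × ℕ × ℕ // x.2.2 ≤ x.1 + x.2.1}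

/-- The normalized weight vector. -/
def wvec (q : Set.Ioo (0 : ℝ) 1) (i j p : ℕ) : CoordAlg q :=
  ((‖incl q (ladder q i j p)‖⁻¹ : ℝ) : ℂ) • ladder q i j p

theorem norm_ladder_pos {i j p : ℕ} (h : p ≤ i + j) : 0 < ‖incl q (ladder q i j p)‖ := by
  rw [norm_pos_iff]
  intro h0
  have := inner_ladder_self_pos (q := q) h
  simp [h0] at this

theorem ladder_eq_smul_wvec {i j p : ℕ} (h : p ≤ i + j) :
    ladder q i j p = ((‖incl q (ladder q i j p)‖ : ℝ) : ℂ) • wvec q i j p := by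
  rw [wvec, smul_smul, ← Complex.ofReal_mul, mul_inv_cancel₀ (norm_ladder_pos h).ne',
    Complex.ofReal_one, one_smul]

theorem inner_wvec_eq_zero {i j p i' j' p' : ℕ} (h : (i, j, p) ≠ (i', j', p')) :
    ⟪incl q (wvec q i j p), incl q (wvec q i' j' p')⟫_ℂ = 0 := by
  rw [wvec, wvec, map_smul, map_smul, inner_smul_left, inner_smul_right, inner_ladder_eq_zero h,
    mul_zero, mul_zero]

theorem norm_wvec {i j p : ℕ} (h : p ≤ i + j) : ‖incl q (wvec q i j p)‖ = 1 := by
  rw [wvec, map_smul, norm_smul, Complex.norm_real, Real.norm_eq_abs, abs_inv, abs_norm,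
    inv_mul_cancel₀ (norm_ladder_pos h).ne']

theorem inner_wvec_self {i j p : ℕ} (h : p ≤ i + j) :
    ⟪incl q (wvec q i j p), incl q (wvec q i j p)⟫_ℂ = 1 := by
  rw [inner_self_eq_norm_sq_to_K, norm_wvec h]; simp

theorem orthonormal_wvec :
    Orthonormal ℂ fun r : WeightIndex => incl q (wvec q r.1.1 r.1.2.1 r.1.2.2) := by
  refine ⟨fun r => norm_wvec r.2, fun r r' h => inner_wvec_eq_zero fun h' => h ?_⟩
  exact Subtype.ext h'

theorem linearIndependent_wvec :
    LinearIndependent ℂ fun r : WeightIndex => wvec q r.1.1 r.1.2.1 r.1.2.2 :=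
  LinearIndependent.of_comp (incl q) orthonormal_wvec.linearIndependent

theorem ladder_mem (i j p : ℕ) : ladder q i j p ∈ genSpan q ^ (i + j) := by
  induction p with
  | zero =>
    rw [ladder_zero, pow_add]
    exact Submodule.mul_mem_mul (Submodule.pow_mem_pow _ (gen_mem_genSpan _) _)
      (Submodule.pow_mem_pow _ (gen_mem_genSpan _) _)
  | succ p ih => rw [← actF_ladder]; exact actF_mem ih

/-- For `i + j = m` there are `(m+1)²` pairs `(i, p)`, as many as codes of ordered monomials of
degree `m`; independence comes from orthogonality, so the dimension count applies. -/
theorem mem_span_wvec (x : CoordAlg q) :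
    x ∈ Submodule.span ℂ (Set.range fun r : WeightIndex => wvec q r.1.1 r.1.2.1 r.1.2.2) := by
  obtain ⟨M, hx⟩ := exists_mem_genSpan_pow x
  let φ : DegIndex M → WeightIndex := fun r =>
    ⟨(r.2.1, r.1 - r.2.1, r.2.2), by have := r.2.1.2; have := r.2.2.2; simp only; omega⟩
  have hφ : Function.Injective φ := by
    rintro ⟨⟨m, hm⟩, ⟨i, hi⟩, ⟨p, hp⟩⟩ ⟨⟨m', hm'⟩, ⟨i', hi'⟩, ⟨p', hp'⟩⟩ h
    simp only [φ, Subtype.mk.injEq, Prod.mk.injEq] at h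
    simp only at hi hp hi' hp'
    obtain ⟨rfl, h2, rfl⟩ := h
    obtain rfl : m = m' := by omega
    rfl
  refine Submodule.span_mono ?_ (genSpan_pow_le_span (linearIndependent_wvec.comp φ hφ) ?_ hx)
  · rintro _ ⟨r, rfl⟩
    exact ⟨φ r, rfl⟩
  · intro r
    refine Submodule.smul_mem _ _ (genSpan_pow_mono ?_ (ladder_mem _ _ _))
    have := r.2.1.2
    have := r.1.2
    simp only [φ]
    omega

/-- A spanning family with orthonormal images: `h` is faithful. This makes the operators on `𝒜 ⊕ 𝒜`
well defined inside the Hilbert space. -/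
theorem incl_injective : Function.Injective (incl q) := by
  rw [← LinearMap.ker_eq_bot, LinearMap.ker_eq_bot']
  intro x hx
  obtain ⟨c, rfl⟩ := (Finsupp.mem_span_range_iff_exists_finsupp).mp (mem_span_wvec x)
  have h := linearIndependent_iff.mp (orthonormal_wvec (q := q)).linearIndependent c (by
    rw [← hx, Finsupp.linearCombination_apply, map_finsuppSum]
    simp only [map_smul])
  rw [h, Finsupp.sum_zero_index]

/-- The squared norm of `F^{i+j+1} (a^i c^j)` contains the factor `[0]`; faithfulness turns norm
zero into zero. -/
theorem ladder_eq_zero {i j p : ℕ} (h : i + j < p) : ladder q i j p = 0 := by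
  obtain ⟨k, rfl⟩ := Nat.exists_eq_add_of_le h
  induction k with
  | zero =>
    apply incl_injective (q := q)
    rw [map_zero, ← inner_self_eq_zero (𝕜 := ℂ), Nat.succ_eq_add_one, add_zero, inner_ladder_succ]
    simp [qNum_zero]
  | succ k ih => rw [← add_assoc, ← actF_ladder, ih (by omega), map_zero]

theorem wvec_eq_zero {i j p : ℕ} (h : i + j < p) : wvec q i j p = 0 := by
  rw [wvec, ladder_eq_zero h, smul_zero]

theorem norm_ladder_succ (i j p : ℕ) : ‖incl q (ladder q i j (p + 1))‖ =
    Real.sqrt (qNum q (2 * ((p : ℤ) + 1)) * qNum q (2 * ((i : ℤ) + j - p))) *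
      ‖incl q (ladder q i j p)‖ := by
  have h := congrArg Complex.re (inner_ladder_succ (q := q) i j p i j p)
  rw [Complex.re_ofReal_mul, ← RCLike.re_eq_complex_re, ← norm_sq_eq_re_inner,
    ← norm_sq_eq_re_inner] at h
  rw [← Real.sqrt_sq (norm_nonneg (incl q (ladder q i j (p + 1)))), h,
    Real.sqrt_mul' _ (sq_nonneg _), Real.sqrt_sq (norm_nonneg _)]

/-- The matrix element of `∂_e` and `∂_f` between neighbouring weight vectors. -/
def ladderCoeff (q : Set.Ioo (0 : ℝ) 1) (i j p : ℕ) : ℝ :=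
  Real.sqrt (qNum q (2 * (p : ℤ)) * qNum q (2 * ((i : ℤ) + j + 1 - p)))

theorem norm_ladder_succ' (i j p : ℕ) : ‖incl q (ladder q i j (p + 1))‖ =
    ladderCoeff q i j (p + 1) * ‖incl q (ladder q i j p)‖ := by
  rw [norm_ladder_succ, ladderCoeff]
  push_cast
  rw [show (i : ℤ) + j + 1 - (p + 1) = (i : ℤ) + j - p by ring]

theorem ladderCoeff_top (i j : ℕ) : ladderCoeff q i j (i + j + 1) = 0 := by
  rw [ladderCoeff]; push_cast; rw [sub_self, mul_zero, qNum_zero, mul_zero, Real.sqrt_zero]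

theorem actK_wvec (i j p : ℕ) : actK q (wvec q i j p) =
    sqrtQ q ^ ((i : ℤ) + j - 2 * p) • wvec q i j p := by
  rw [wvec, map_smul, actK_ladder, smul_comm]

theorem actF_wvec {i j p : ℕ} (h : p ≤ i + j) : actF q (wvec q i j p) =
    ((ladderCoeff q i j (p + 1) : ℝ) : ℂ) • wvec q i j (p + 1) := by
  rcases h.lt_or_eq with h | rfl
  · have h0 := (norm_ladder_pos (q := q) h.le).ne'
    rw [wvec, map_smul, actF_ladder, ladder_eq_smul_wvec (Nat.succ_le_of_lt h), smul_smul,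
      norm_ladder_succ', ← Complex.ofReal_mul]
    congr 2
    field_simp
  · rw [ladderCoeff_top, wvec_eq_zero (q := q) (Nat.lt_succ_self (i + j)), smul_zero, wvec,
      map_smul, actF_ladder, ladder_eq_zero (Nat.lt_succ_self _), smul_zero]

theorem actE_wvec_zero (i j : ℕ) : actE q (wvec q i j 0) = 0 := by
  rw [wvec, map_smul, actE_ladder_zero, smul_zero]

theorem actE_wvec_succ {i j p : ℕ} (h : p ≤ i + j) : actE q (wvec q i j (p + 1)) =
    ((ladderCoeff q i j (p + 1) : ℝ) : ℂ) • wvec q i j p := by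
  rcases h.lt_or_eq with h | rfl
  · have h0 := (norm_ladder_pos (q := q) h.le).ne'
    have h1 := (norm_ladder_pos (q := q) (Nat.succ_le_of_lt h)).ne'
    rw [Nat.succ_eq_add_one, norm_ladder_succ'] at h1
    have h2 : qNum q (2 * ((p : ℤ) + 1)) * qNum q (2 * ((i : ℤ) + j - p)) =
        ladderCoeff q i j (p + 1) * ladderCoeff q i j (p + 1) := by
      rw [ladderCoeff, Real.mul_self_sqrt]
      · push_cast
        rw [show (i : ℤ) + j + 1 - (p + 1) = (i : ℤ) + j - p by ring]
      · exact mul_nonneg (qNum_pos (by omega)).le (qNum_pos (by omega)).le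
    rw [wvec, wvec, map_smul, actE_ladder_succ, smul_smul, smul_smul, h2, norm_ladder_succ',
      ← Complex.ofReal_mul, ← Complex.ofReal_mul]
    congr 2
    have := left_ne_zero_of_mul h1
    field_simp
  · rw [ladderCoeff_top, wvec_eq_zero (q := q) (Nat.lt_succ_self (i + j)), map_zero,
      Complex.ofReal_zero, zero_smul]

/-! ## Diagonal operators on a Hilbert space -/

section Diagonal

open Filter Topology

variable {H : Type*} [NormedAddCommGroup H] [InnerProductSpace ℂ H] {ι : Type*}

theorem hilbertBasis_ext (b : HilbertBasis ι ℂ H) {v w : H} (h : ∀ i, ⟪b i, v⟫_ℂ = ⟪b i, w⟫_ℂ) :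
    v = w := by
  apply b.repr.injective
  ext i
  rw [b.repr_apply_apply, b.repr_apply_apply, h]

/-- The graph of the (unbounded) diagonal operator with diagonal entries `d`. -/
def diagGraph (b : HilbertBasis ι ℂ H) (d : ι → ℂ) : Submodule ℂ (H × H) where
  carrier := {p | ∀ i, ⟪b i, p.2⟫_ℂ = d i * ⟪b i, p.1⟫_ℂ}
  add_mem' := by
    intro p p' hp hp' i
    simp only [Set.mem_ofPred_eq, Prod.fst_add, Prod.snd_add, inner_add_right] at *
    rw [hp, hp', mul_add]
  zero_mem' := by intro i; simp
  smul_mem' := by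
    intro z p hp i
    simp only [Set.mem_ofPred_eq, Prod.smul_fst, Prod.smul_snd, inner_smul_right] at *
    rw [hp, mul_left_comm]

theorem mem_diagGraph {b : HilbertBasis ι ℂ H} {d : ι → ℂ} {p : H × H} :
    p ∈ diagGraph b d ↔ ∀ i, ⟪b i, p.2⟫_ℂ = d i * ⟪b i, p.1⟫_ℂ := Iff.rfl

theorem basis_mem_diagGraph (b : HilbertBasis ι ℂ H) (d : ι → ℂ) (i : ι) :
    (b i, d i • b i) ∈ diagGraph b d := by
  classical
  intro j
  simp only [inner_smul_right, orthonormal_iff_ite.mp b.orthonormal]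
  split_ifs with h
  · rw [h]
  · simp

theorem isClosed_diagGraph (b : HilbertBasis ι ℂ H) (d : ι → ℂ) :
    IsClosed (diagGraph b d : Set (H × H)) := by
  have : (diagGraph b d : Set (H × H)) = ⋂ i, {p | ⟪b i, p.2⟫_ℂ = d i * ⟪b i, p.1⟫_ℂ} := by
    ext p; simp [mem_diagGraph]
  rw [this]
  exact isClosed_iInter fun i => isClosed_eq (by fun_prop) (by fun_prop)

/-- A point `(v, w)` of the diagonal graph is the sum of `⟨b_i, v⟩ (b_i, d_i b_i)`: the same partial
sums approximate both components, so finite combinations of basis vectors form a core. -/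
theorem topologicalClosure_span_eq_diagGraph (b : HilbertBasis ι ℂ H) (d : ι → ℂ) :
    (Submodule.span ℂ (Set.range fun i => (b i, d i • b i))).topologicalClosure =
      diagGraph b d := by
  apply le_antisymm
  · refine Submodule.topologicalClosure_minimal _ (Submodule.span_le.mpr ?_)
      (isClosed_diagGraph b d)
    rintro _ ⟨i, rfl⟩
    exact basis_mem_diagGraph b d i
  · rintro ⟨v, w⟩ h
    have h1 : HasSum (fun i => ⟪b i, v⟫_ℂ • (b i, d i • b i)) (v, w) := by
      have hv := b.hasSum_repr v
      have hw := b.hasSum_repr w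
      have h2 : (fun i => b.repr w i • b i) = fun i => b.repr v i • d i • b i := by
        funext i
        have := h i
        simp only at this
        rw [b.repr_apply_apply, b.repr_apply_apply, this, smul_smul, mul_comm]
      rw [h2] at hw
      simp only [b.repr_apply_apply] at hv hw
      exact HasSum.prodMk hv hw
    refine mem_closure_of_tendsto h1 (Eventually.of_forall fun s => ?_)
    exact Submodule.sum_mem _ fun i _ => Submodule.smul_mem _ _ (Submodule.subset_span ⟨i, rfl⟩)

theorem toLinearPMap_diagGraph_graph (b : HilbertBasis ι ℂ H) (d : ι → ℂ) :
    (diagGraph b d).toLinearPMap.graph = diagGraph b d := by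
  refine Submodule.toLinearPMap_graph_eq _ fun p hp h0 => hilbertBasis_ext b fun i => ?_
  rw [hp i, h0]; simp

theorem graph_closure_eq_diagGraph (b : HilbertBasis ι ℂ H) (d : ι → ℂ) {T : H →ₗ.[ℂ] H}
    (hT : T.graph = Submodule.span ℂ (Set.range fun i => (b i, d i • b i))) :
    T.closure.graph = diagGraph b d := by
  have h : T.graph.topologicalClosure = diagGraph b d := by
    rw [hT, topologicalClosure_span_eq_diagGraph]
  have hc : T.IsClosable := ⟨(diagGraph b d).toLinearPMap, by
    rw [h, toLinearPMap_diagGraph_graph]⟩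
  rw [← hc.graph_closure_eq_closure_graph, h]

/-- Testing the adjoint against `(b_i, d_i b_i)` forces `⟨b_i, w⟩ = d_i ⟨b_i, v⟩` since `d_i` is
real; the converse is Parseval. -/
theorem isSelfAdjoint_of_graph_eq_diagGraph [CompleteSpace H] (b : HilbertBasis ι ℂ H)
    {d : ι → ℂ} (hd : ∀ i, conj (d i) = d i) {T : H →ₗ.[ℂ] H} (hT : T.graph = diagGraph b d) :
    IsSelfAdjoint T := by
  have hdense : Dense (T.domain : Set H) := by
    have h1 := b.dense_span
    rw [← Submodule.dense_iff_topologicalClosure_eq_top] at h1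
    refine h1.mono (Submodule.span_le.mpr ?_)
    rintro _ ⟨i, rfl⟩
    have := basis_mem_diagGraph b d i
    rw [← hT] at this
    exact LinearPMap.mem_domain_of_mem_graph this
  rw [LinearPMap.isSelfAdjoint_def]
  apply LinearPMap.eq_of_eq_graph
  rw [LinearPMap.adjoint_graph_eq_graph_adjoint hdense, hT]
  ext ⟨v, w⟩
  rw [Submodule.mem_adjoint_iff, mem_diagGraph]
  constructor
  · intro h i
    have := h _ _ (basis_mem_diagGraph b d i)
    rw [inner_smul_left, hd, sub_eq_zero] at this
    exact this.symm
  · intro h x y hxy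
    rw [sub_eq_zero, ← b.tsum_inner_mul_inner, ← b.tsum_inner_mul_inner]
    refine tsum_congr fun i => ?_
    have h1 := hxy i
    have h2 := h i
    simp only at h1 h2
    rw [h2, ← inner_conj_symm, h1, map_mul, hd, inner_conj_symm]
    ring

theorem exists_diag_operator (b : HilbertBasis ι ℂ H) {m : ι → ℂ} {C : ℝ} (hm : ∀ i, ‖m i‖ ≤ C) :
    ∃ R : H →L[ℂ] H, ∀ v i, ⟪b i, R v⟫_ℂ = m i * ⟪b i, v⟫_ℂ := by
  have h2 : 0 < (2 : ENNReal).toReal := by norm_num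
  have hle : ∀ (f : lp (fun _ : ι => ℂ) 2) i, ‖m i * f i‖ ^ (2 : ENNReal).toReal ≤
      C ^ (2 : ENNReal).toReal * ‖f i‖ ^ (2 : ENNReal).toReal := by
    intro f i
    have hC : 0 ≤ C := (norm_nonneg _).trans (hm i)
    rw [norm_mul, Real.mul_rpow (norm_nonneg _) (norm_nonneg _)]
    exact mul_le_mul_of_nonneg_right (Real.rpow_le_rpow (norm_nonneg _) (hm i) h2.le)
      (by positivity)
  have hs : ∀ f : lp (fun _ : ι => ℂ) 2, Summable fun i => ‖m i * f i‖ ^ (2 : ENNReal).toReal :=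
    fun f => Summable.of_nonneg_of_le (fun i => by positivity) (hle f)
      (((lp.memℓp f).summable h2).mul_left _)
  rcases isEmpty_or_nonempty ι with hι | ⟨⟨i₀⟩⟩
  · exact ⟨0, fun v i => hι.elim i⟩
  have hC : 0 ≤ C := (norm_nonneg _).trans (hm i₀)
  let L : lp (fun _ : ι => ℂ) 2 →ₗ[ℂ] lp (fun _ : ι => ℂ) 2 :=
    { toFun := fun f => ⟨fun i => m i * f i, memℓp_gen (hs f)⟩
      map_add' := fun f g => by ext i; exact mul_add _ _ _
      map_smul' := fun z f => by ext i; exact mul_left_comm _ _ _ }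
  have hL : ∀ f i, L f i = m i * f i := fun f i => rfl
  let L' : lp (fun _ : ι => ℂ) 2 →L[ℂ] lp (fun _ : ι => ℂ) 2 := L.mkContinuous C (by
    intro f
    rw [← Real.rpow_le_rpow_iff (norm_nonneg _) (by positivity) h2,
      Real.mul_rpow hC (norm_nonneg _), lp.norm_rpow_eq_tsum h2, lp.norm_rpow_eq_tsum h2,
      ← tsum_mul_left]
    exact (hs f).tsum_le_tsum (hle f) (((lp.memℓp f).summable h2).mul_left _))
  refine ⟨(b.repr.symm : lp (fun _ : ι => ℂ) 2 →L[ℂ] H) ∘L L' ∘L (b.repr : H →L[ℂ] _),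
    fun v i => ?_⟩
  rw [← b.repr_apply_apply, ← b.repr_apply_apply]
  change b.repr (b.repr.symm (L (b.repr v))) i = _
  rw [LinearIsometryEquiv.apply_symm_apply]
  exact hL _ _

theorem inner_of_eigenbasis (b : HilbertBasis ι ℂ H) {t : ι → ℂ} {T : H →L[ℂ] H}
    (hT : ∀ i, T (b i) = t i • b i) (v : H) (i : ι) : ⟪b i, T v⟫_ℂ = t i * ⟪b i, v⟫_ℂ := by
  classical
  have h := ((b.hasSum_repr v).mapL T).mapL (innerSL ℂ (b i))
  simp only [map_smul, hT, innerSL_apply_apply, b.repr_apply_apply,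
    orthonormal_iff_ite.mp b.orthonormal, smul_eq_mul, mul_ite, mul_one, mul_zero] at h
  rw [← h.tsum_eq, tsum_eq_single i]
  · rw [if_pos rfl, mul_comm]
  · intro j hj; rw [if_neg (Ne.symm hj)]

theorem exists_isBoundedInverse (b : HilbertBasis ι ℂ H) {d : ι → ℂ} {ε : ℝ} (hε : 0 < ε)
    (hd : ∀ i, ε ≤ ‖d i‖) {T : H →ₗ.[ℂ] H} (hT : T.graph = diagGraph b d) :
    ∃ R, IsBoundedInverse T R := by
  have hd0 : ∀ i, d i ≠ 0 := fun i => norm_pos_iff.mp (hε.trans_le (hd i))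
  obtain ⟨R, hR⟩ := exists_diag_operator b (m := fun i => (d i)⁻¹) (C := ε⁻¹) (fun i => by
    rw [norm_inv]; exact inv_anti₀ hε (hd i))
  refine ⟨R, fun v w => ?_⟩
  rw [hT, mem_diagGraph]
  constructor
  · intro h
    refine hilbertBasis_ext b fun i => ?_
    rw [hR, h i, inv_mul_cancel_left₀ (hd0 i)]
  · rintro rfl i
    rw [hR, mul_inv_cancel_left₀ (hd0 i)]

theorem boundedInverse_apply {b : HilbertBasis ι ℂ H} {d : ι → ℂ} {T : H →ₗ.[ℂ] H}
    (hT : T.graph = diagGraph b d) (h : ∃ R, IsBoundedInverse T R) (hd : ∀ i, d i ≠ 0) (i : ι) :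
    boundedInverse T (b i) = (d i)⁻¹ • b i := by
  have hR : IsBoundedInverse T (boundedInverse T) := by
    rw [boundedInverse, dif_pos h]; exact h.choose_spec
  rw [← hR, hT]
  have := Submodule.smul_mem _ (d i)⁻¹ (basis_mem_diagGraph b d i)
  rwa [Prod.smul_mk, smul_smul, inv_mul_cancel₀ (hd i), one_smul] at this

theorem ext_of_eigenbasis (b : HilbertBasis ι ℂ H) {T S : H →L[ℂ] H} (h : ∀ i, T (b i) = S (b i)) :
    T = S :=
  ContinuousLinearMap.ext_on (Submodule.dense_iff_topologicalClosure_eq_top.mpr b.dense_span) (by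
    rintro _ ⟨i, rfl⟩; exact h i)

theorem mem_spectrum_of_eigenvector {T : H →L[ℂ] H} {μ : ℂ} {v : H} (hv : v ≠ 0)
    (h : T v = μ • v) : μ ∈ spectrum ℂ T := by
  rw [spectrum.mem_iff]
  rintro ⟨u, hu⟩
  apply hv
  have h1 : (u : H →L[ℂ] H) v = 0 := by
    rw [hu, sub_apply, h, Algebra.algebraMap_eq_smul_one]
    simp
  have h2 : (↑u⁻¹ * (u : H →L[ℂ] H)) v = 0 := by
    rw [mul_apply_eq_comp, h1, map_zero]
  rwa [u.inv_mul, one_apply_eq_self] at h2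

theorem inner_mul_inner_symm (x y : H) :
    ⟪x, y⟫_ℂ * ⟪y, x⟫_ℂ = ((‖⟪x, y⟫_ℂ‖ ^ 2 : ℝ) : ℂ) := by
  rw [← inner_conj_symm y x, Complex.mul_conj, Complex.normSq_eq_norm_sq]

theorem isClosed_of_mem_iff {b : HilbertBasis ι ℂ H} {s : Set ι} {V : Submodule ℂ H}
    (hV : ∀ v, v ∈ V ↔ ∀ i ∉ s, ⟪b i, v⟫_ℂ = 0) :
    IsClosed (V : Set H) := by
  have : (V : Set H) = ⋂ i, ⋂ _ : i ∉ s, {v | ⟪b i, v⟫_ℂ = 0} := by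
    ext v; simp [hV]
  rw [this]
  exact isClosed_iInter fun i => isClosed_iInter fun _ => isClosed_eq (by fun_prop) (by fun_prop)

theorem basis_mem_of_mem_iff {b : HilbertBasis ι ℂ H} {s : Set ι} {V : Submodule ℂ H}
    (hV : ∀ v, v ∈ V ↔ ∀ i ∉ s, ⟪b i, v⟫_ℂ = 0) {i : ι} (hi : i ∈ s) :
    b i ∈ V := by
  rw [hV]
  intro j hj
  exact b.orthonormal.2 (by rintro rfl; exact hj hi)

theorem hasSum_inner_eigenbasis (b : HilbertBasis ι ℂ H) {t : ι → ℂ} {T : H →L[ℂ] H}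
    (hT : ∀ i, T (b i) = t i • b i) (v : H) :
    HasSum (fun i => t i * ((‖⟪b i, v⟫_ℂ‖ ^ 2 : ℝ) : ℂ)) ⟪v, T v⟫_ℂ := by
  have h := b.hasSum_inner_mul_inner v (T v)
  have h2 : (fun i => ⟪v, b i⟫_ℂ * ⟪b i, T v⟫_ℂ) =
      fun i => t i * ((‖⟪b i, v⟫_ℂ‖ ^ 2 : ℝ) : ℂ) := by
    funext i
    rw [inner_of_eigenbasis b hT, ← inner_mul_inner_symm]
    ring
  rwa [h2] at h

variable [CompleteSpace H]

/-! ### Normality and functional calculus of diagonal operators -/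

theorem adjoint_of_eigenbasis (b : HilbertBasis ι ℂ H) {t : ι → ℂ} {T : H →L[ℂ] H}
    (hT : ∀ i, T (b i) = t i • b i) (i : ι) : star T (b i) = conj (t i) • b i := by
  classical
  refine hilbertBasis_ext b fun j => ?_
  rw [ContinuousLinearMap.star_eq_adjoint, ContinuousLinearMap.adjoint_inner_right, hT,
    inner_smul_left, inner_smul_right]
  simp only [orthonormal_iff_ite.mp b.orthonormal]
  split_ifs with h
  · rw [h]
  · simp

theorem isStarNormal_of_eigenbasis (b : HilbertBasis ι ℂ H) {t : ι → ℂ} {T : H →L[ℂ] H}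
    (hT : ∀ i, T (b i) = t i • b i) : IsStarNormal T := by
  refine ⟨ext_of_eigenbasis b fun i => ?_⟩
  rw [mul_apply_eq_comp, mul_apply_eq_comp, hT, map_smul,
    adjoint_of_eigenbasis b hT, map_smul, hT, smul_comm]

/-- The continuous functional calculus acts on eigenvectors by the value at the eigenvalue. -/
theorem cfc_apply_eigenvector {T : H →L[ℂ] H} (hT : IsStarNormal T) {μ : ℂ} {v : H}
    (h : T v = μ • v) (hstar : star T v = conj μ • v) {f : ℂ → ℂ}
    (hf : ContinuousOn f (spectrum ℂ T)) : cfc f T v = f μ • v := by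
  by_cases hv : v = 0
  · rw [hv, map_zero, smul_zero]
  have hμ := mem_spectrum_of_eigenvector hv h
  rw [cfc_apply f T hT hf]
  -- Stone–Weierstrass: the claim holds for constants, the coordinate and its conjugate, and
  -- survives sums, products and limits.
  have key : ∀ g : C(spectrum ℂ T, ℂ), cfcHom hT g v = g ⟨μ, hμ⟩ • v := by
    intro g
    induction g using ContinuousMap.induction_on_of_compact with
    | const r =>
      have : ContinuousMap.const (spectrum ℂ T) r = algebraMap ℂ C(spectrum ℂ T, ℂ) r := rfl
      rw [this, AlgHomClass.commutes, Algebra.algebraMap_eq_smul_one]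
      rfl
    | id => rw [cfcHom_id]; exact h
    | star_id => rw [map_star, cfcHom_id]; exact hstar
    | add f g hf hg => rw [map_add, add_apply, hf, hg, ← add_smul]; rfl
    | mul f g hf hg =>
      rw [map_mul, mul_apply_eq_comp, hg, map_smul, hf, smul_smul, mul_comm]; rfl
    | frequently f hf =>
      have hclosed : IsClosed {g : C(spectrum ℂ T, ℂ) | cfcHom hT g v = g ⟨μ, hμ⟩ • v} := by
        refine isClosed_eq ?_ ?_
        · exact (ContinuousLinearMap.apply ℂ H v).continuous.comp (cfcHom_continuous hT)
        · exact (continuous_eval_const _).smul continuous_const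
      exact hclosed.mem_of_frequently_of_tendsto hf tendsto_id
  exact key _

/-! ## Traces of diagonal operators -/

theorem onb_hasSum {V : Submodule ℂ H} {u : H} (hu : u ∈ V) :
    HasSum (fun v : onb V => ‖⟪u, (v.1 : H)⟫_ℂ‖ ^ 2) (‖u‖ ^ 2) := by
  obtain ⟨c, hc⟩ := onb_spec V
  have hu' : u ∈ V.topologicalClosure := V.le_topologicalClosure hu
  have h := Complex.hasSum_re (c.hasSum_inner_mul_inner ⟨u, hu'⟩ ⟨u, hu'⟩)
  have h2 : (fun v : onb V => (⟪(⟨u, hu'⟩ : V.topologicalClosure), c v⟫_ℂ *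
      ⟪c v, (⟨u, hu'⟩ : V.topologicalClosure)⟫_ℂ).re) = fun v => ‖⟪u, (v.1 : H)⟫_ℂ‖ ^ 2 := by
    funext v
    rw [hc, Submodule.coe_inner, Submodule.coe_inner, inner_mul_inner_symm, Complex.ofReal_re]
  rw [h2, Submodule.coe_inner] at h
  rw [norm_sq_eq_re_inner (𝕜 := ℂ) u]
  exact h

section Trace

variable {b : HilbertBasis ι ℂ H} {s : Set ι} {V : Submodule ℂ H}

theorem inner_onb_eq_zero (hV : ∀ v, v ∈ V ↔ ∀ i ∉ s, ⟪b i, v⟫_ℂ = 0) {i : ι} (hi : i ∉ s)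
    (v : onb V) : ⟪b i, (v.1 : H)⟫_ℂ = 0 := by
  have h := V.topologicalClosure_minimal le_rfl (isClosed_of_mem_iff hV) v.1.2
  exact (hV _).mp h i hi

theorem hasSum_onb_basis (hV : ∀ v, v ∈ V ↔ ∀ i ∉ s, ⟪b i, v⟫_ℂ = 0) {i : ι} (hi : i ∈ s) :
    HasSum (fun v : onb V => ‖⟪b i, (v.1 : H)⟫_ℂ‖ ^ 2) 1 := by
  have h := onb_hasSum (basis_mem_of_mem_iff hV hi)
  rwa [b.orthonormal.1 i, one_pow] at h

/-- The trace of a positive diagonal operator is the sum of its eigenvalues. -/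
theorem tsum_onb_ofReal (hV : ∀ v, v ∈ V ↔ ∀ i ∉ s, ⟪b i, v⟫_ℂ = 0) {t : ι → ℝ}
    (ht : ∀ i, 0 ≤ t i) {T : H →L[ℂ] H} (hT : ∀ i, T (b i) = (t i : ℂ) • b i) :
    ∑' v : onb V, ENNReal.ofReal (⟪(v.1 : H), T (v.1 : H)⟫_ℂ).re =
      ∑' i : s, ENNReal.ofReal (t i) := by
  have h1 : ∀ v : onb V, ENNReal.ofReal (⟪(v.1 : H), T (v.1 : H)⟫_ℂ).re =
      ∑' i, ENNReal.ofReal (t i) * ENNReal.ofReal (‖⟪b i, (v.1 : H)⟫_ℂ‖ ^ 2) := by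
    intro v
    have h := Complex.hasSum_re (hasSum_inner_eigenbasis b hT (v.1 : H))
    simp only [← Complex.ofReal_mul, Complex.ofReal_re] at h
    rw [← h.tsum_eq, ENNReal.ofReal_tsum_of_nonneg (fun i => mul_nonneg (ht i) (sq_nonneg _))
      h.summable]
    exact tsum_congr fun i => ENNReal.ofReal_mul (ht i)
  -- After the interchange, the weight of `t i` is the squared norm of the projection of `b i` to
  -- `V`: `1` for `i ∈ s`, and `0` otherwise.
  rw [tsum_congr h1, ENNReal.tsum_comm, tsum_subtype s fun i => ENNReal.ofReal (t i)]
  refine tsum_congr fun i => ?_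
  rw [ENNReal.tsum_mul_left]
  by_cases hi : i ∈ s
  · have h := hasSum_onb_basis hV hi
    rw [← ENNReal.ofReal_tsum_of_nonneg (fun v => sq_nonneg _) h.summable, h.tsum_eq,
      ENNReal.ofReal_one, mul_one, Set.indicator_of_mem hi]
  · rw [Set.indicator_of_notMem hi]
    simp [inner_onb_eq_zero hV hi]

/-- The trace of a diagonal trace class operator is the sum of its eigenvalues. -/
theorem tsum_onb (hV : ∀ v, v ∈ V ↔ ∀ i ∉ s, ⟪b i, v⟫_ℂ = 0) {t : ι → ℂ}
    (ht : Summable fun i : s => ‖t i‖) {T : H →L[ℂ] H} (hT : ∀ i, T (b i) = t i • b i) :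
    ∑' v : onb V, ⟪(v.1 : H), T (v.1 : H)⟫_ℂ = ∑' i : s, t i := by
  let F : s → onb V → ℂ := fun i v => t i * ((‖⟪b i, (v.1 : H)⟫_ℂ‖ ^ 2 : ℝ) : ℂ)
  have h1 : ∀ v : onb V, ⟪(v.1 : H), T (v.1 : H)⟫_ℂ = ∑' i : s, F i v := by
    intro v
    rw [← (hasSum_inner_eigenbasis b hT (v.1 : H)).tsum_eq]
    refine (tsum_subtype_eq_of_support_subset fun i hi => ?_).symm
    by_contra hs
    apply hi
    simp [inner_onb_eq_zero hV hs v]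
  -- The norms of `F i v` sum over `v` to `‖t i‖`, so the double sum converges absolutely and may be
  -- interchanged.
  have h2 : Summable (Function.uncurry F) := by
    apply Summable.of_norm
    have h3 : (fun x : s × onb V => ‖Function.uncurry F x‖) =
        fun x => ‖t x.1‖ * ‖⟪b x.1, (x.2.1 : H)⟫_ℂ‖ ^ 2 := by
      funext x
      simp [Function.uncurry, F]
    have h4 : ∀ i : s, HasSum (fun v : onb V => ‖t i‖ * ‖⟪b i, (v.1 : H)⟫_ℂ‖ ^ 2) ‖t i‖ := by
      intro i
      have h := hasSum_onb_basis hV i.2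
      have h' := h.mul_left ‖t i‖
      rwa [mul_one] at h'
    rw [h3, summable_prod_of_nonneg fun x => by positivity]
    refine ⟨fun i => (h4 i).summable, ?_⟩
    have h5 : (fun i : s => ∑' v : onb V, ‖t i‖ * ‖⟪b i, (v.1 : H)⟫_ℂ‖ ^ 2) = fun i : s => ‖t i‖ :=
      funext fun i => (h4 i).tsum_eq
    exact h5 ▸ ht
  have h3 : ∀ i : s, ∑' v, F i v = t i := by
    intro i
    simp only [F]
    rw [tsum_mul_left, ← Complex.ofReal_tsum, (hasSum_onb_basis hV i.2).tsum_eq,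
      Complex.ofReal_one, mul_one]
  exact (tsum_congr h1).trans (h2.tsum_comm.trans (tsum_congr h3))

end Trace

end Diagonal

/-! ## The eigenvectors of the Dirac operator -/

theorem inner_inclH (x y x' y' : CoordAlg q) : ⟪inclH q (x, y), inclH q (x', y')⟫_ℂ =
    ⟪incl q x, incl q x'⟫_ℂ + ⟪incl q y, incl q y'⟫_ℂ :=
  WithLp.prod_inner_apply _ _

theorem inclH_injective : Function.Injective (inclH q) := by
  rintro ⟨x, y⟩ ⟨x', y'⟩ h
  have h' := (WithLp.linearEquiv 2 ℂ (HaarSpace q × HaarSpace q)).symm.injective h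
  simp only [LinearMap.prodMap_apply, Prod.mk.injEq] at h'
  rw [incl_injective h'.1, incl_injective h'.2]

theorem inclH_inner_eq (x y : CoordAlg q) (v : HilbertH q) : ⟪inclH q (x, y), v⟫_ℂ =
    ⟪incl q x, v.fst⟫_ℂ + ⟪incl q y, v.snd⟫_ℂ :=
  WithLp.prod_inner_apply _ _

/-- The vector `(x e_{p-1}, y e_p)`. -/
def pairVec (q : Set.Ioo (0 : ℝ) 1) (x y : ℝ) (i j p : ℕ) : CoordAlg q × CoordAlg q :=
  ((x : ℂ) • wvec q i j (p - 1), (y : ℂ) • wvec q i j p)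

theorem inner_pairVec (x y x' y' : ℝ) (i j p i' j' p' : ℕ) :
    ⟪inclH q (pairVec q x y i j p), inclH q (pairVec q x' y' i' j' p')⟫_ℂ =
      x * x' * ⟪incl q (wvec q i j (p - 1)), incl q (wvec q i' j' (p' - 1))⟫_ℂ +
      y * y' * ⟪incl q (wvec q i j p), incl q (wvec q i' j' p')⟫_ℂ := by
  rw [pairVec, pairVec, inner_inclH]
  simp only [map_smul, inner_smul_left, inner_smul_right, Complex.conj_ofReal]
  ring

/-- The truncated `p - 1` gives `p = 0` and `p = 1` the same first basis vector; the hypotheses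
remove it at `p = 0`. -/
theorem inner_pairVec_eq_zero {x y x' y' : ℝ} {i j p i' j' p' : ℕ}
    (h : (i, j, p) ≠ (i', j', p')) (h0 : p = 0 → x = 0) (h0' : p' = 0 → x' = 0) :
    ⟪inclH q (pairVec q x y i j p), inclH q (pairVec q x' y' i' j' p')⟫_ℂ = 0 := by
  rw [inner_pairVec, inner_wvec_eq_zero h, mul_zero, add_zero]
  by_cases hp : p = 0
  · simp [h0 hp]
  by_cases hp' : p' = 0
  · simp [h0' hp']
  rw [inner_wvec_eq_zero, mul_zero]
  simp only [ne_eq, Prod.mk.injEq] at h ⊢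
  omega

/-- At `p = i + j + 1` the second basis vector is zero, not a unit vector, so its coefficient must
vanish. -/
theorem inner_pairVec_self {x y x' y' : ℝ} {i j p : ℕ} (hp : p ≤ i + j + 1)
    (h1 : p = i + j + 1 → y = 0) :
    ⟪inclH q (pairVec q x y i j p), inclH q (pairVec q x' y' i j p)⟫_ℂ =
      ((x * x' + y * y' : ℝ) : ℂ) := by
  rw [inner_pairVec, inner_wvec_self (by omega)]
  by_cases hp : p = i + j + 1
  · simp [h1 hp]
  · rw [inner_wvec_self (by omega)]
    push_cast; ring

/-! ### The rotation that diagonalizes the two-dimensional blocks -/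

/-- The coefficient `(([N/2] - [k/2]) / (2 [N/2]))^{1/2}`, where `N = i + j + 1` and
`k = N - 2 p`. -/
def mixC (q : Set.Ioo (0 : ℝ) 1) (i j p : ℕ) : ℝ :=
  Real.sqrt ((qNum q (i + j + 1) - qNum q (i + j + 1 - 2 * p)) / (2 * qNum q (i + j + 1)))

/-- The coefficient `(([N/2] + [k/2]) / (2 [N/2]))^{1/2}`, where `N = i + j + 1` and
`k = N - 2 p`. -/
def mixS (q : Set.Ioo (0 : ℝ) 1) (i j p : ℕ) : ℝ :=
  Real.sqrt ((qNum q (i + j + 1) + qNum q (i + j + 1 - 2 * p)) / (2 * qNum q (i + j + 1)))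

theorem qNum_top_pos (i j : ℕ) : 0 < qNum q ((i : ℤ) + j + 1) := qNum_pos (by omega)

theorem qNum_sub_nonneg (i j p : ℕ) :
    0 ≤ qNum q ((i : ℤ) + j + 1) - qNum q ((i : ℤ) + j + 1 - 2 * p) :=
  sub_nonneg.mpr (qNum_strictMono.monotone (by omega))

theorem qNum_add_nonneg {i j p : ℕ} (hp : p ≤ i + j + 1) :
    0 ≤ qNum q ((i : ℤ) + j + 1) + qNum q ((i : ℤ) + j + 1 - 2 * p) := by
  rw [← sub_neg_eq_add, ← qNum_neg]
  exact sub_nonneg.mpr (qNum_strictMono.monotone (by omega))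

theorem mixC_sq (i j p : ℕ) : mixC q i j p * mixC q i j p =
    (qNum q (i + j + 1) - qNum q (i + j + 1 - 2 * p)) / (2 * qNum q (i + j + 1)) :=
  Real.mul_self_sqrt (div_nonneg (qNum_sub_nonneg i j p)
    (mul_nonneg zero_le_two (qNum_top_pos i j).le))

theorem mixS_sq {i j p : ℕ} (hp : p ≤ i + j + 1) : mixS q i j p * mixS q i j p =
    (qNum q (i + j + 1) + qNum q (i + j + 1 - 2 * p)) / (2 * qNum q (i + j + 1)) :=
  Real.mul_self_sqrt (div_nonneg (qNum_add_nonneg hp)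
    (mul_nonneg zero_le_two (qNum_top_pos i j).le))

theorem mixC_sq_add_mixS_sq {i j p : ℕ} (hp : p ≤ i + j + 1) :
    mixC q i j p * mixC q i j p + mixS q i j p * mixS q i j p = 1 := by
  have := (qNum_top_pos (q := q) i j).ne'
  rw [mixC_sq, mixS_sq hp]
  field_simp
  ring

theorem mixS_top (i j : ℕ) : mixS q i j (i + j + 1) = 0 := by
  rw [mixS]
  push_cast
  rw [show (i : ℤ) + j + 1 - 2 * (i + j + 1) = -(i + j + 1) by ring, qNum_neg, add_neg_cancel,
    zero_div, Real.sqrt_zero]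

/-- From `[x]² - [y]² = [x-y][x+y]` with `x = N/2`, `y = k/2`, so that `x - y = p` and `x + y = N -
p`. -/
theorem ladderCoeff_eq (i j p : ℕ) : ladderCoeff q i j p =
    Real.sqrt ((qNum q (i + j + 1) - qNum q (i + j + 1 - 2 * p)) *
      (qNum q (i + j + 1) + qNum q (i + j + 1 - 2 * p))) := by
  rw [ladderCoeff]
  congr 1
  have h : ∀ k l : ℤ, (qNum q k - qNum q l) * (qNum q k + qNum q l) =
      qNum q (k - l) * qNum q (k + l) := by
    intro k l
    have e : (qNum q k - qNum q l) * (qNum q k + qNum q l) =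
        qNum q k * qNum q k - qNum q l * qNum q l := by ring
    rw [e, qNum_mul, qNum_mul, qNum_mul, ← sub_div]
    congr 1
    rw [sub_self, sub_self, show k - l + (k + l) = k + k by ring,
      show k - l - (k + l) = -(l + l) by ring, show k + l - (k - l) = l + l by ring]
    ring
  rw [h]
  congr 2 <;> ring

/-- With `A = [N/2] - [k/2]` and `B = [N/2] + [k/2]` this is `√(AB) √A = A √B` up to the common
normalization. It and its companion for `mixS` are the eigenvector equations of the block. -/
theorem ladderCoeff_mul_mixC {i j p : ℕ} (hp : p ≤ i + j + 1) :
    ladderCoeff q i j p * mixC q i j p =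
      (qNum q (i + j + 1) - qNum q (i + j + 1 - 2 * p)) * mixS q i j p := by
  have h1 := qNum_sub_nonneg (q := q) i j p
  have h2 := qNum_add_nonneg (q := q) hp
  rw [ladderCoeff_eq, mixC, mixS, Real.sqrt_div h1, Real.sqrt_div h2, Real.sqrt_mul h1,
    mul_div_assoc', mul_div_assoc']
  congr 1
  rw [mul_right_comm, Real.mul_self_sqrt h1]

theorem ladderCoeff_mul_mixS {i j p : ℕ} (hp : p ≤ i + j + 1) :
    ladderCoeff q i j p * mixS q i j p =
      (qNum q (i + j + 1) + qNum q (i + j + 1 - 2 * p)) * mixC q i j p := by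
  have h1 := qNum_sub_nonneg (q := q) i j p
  have h2 := qNum_add_nonneg (q := q) hp
  rw [ladderCoeff_eq, mixC, mixS, Real.sqrt_div h1, Real.sqrt_div h2, Real.sqrt_mul h1,
    mul_div_assoc', mul_div_assoc']
  congr 1
  rw [mul_assoc, Real.mul_self_sqrt h2, mul_comm]

/-- The endomorphism of `𝒜 ⊕ 𝒜` of which the Dirac operator is the closure. -/
def diracEnd (q : Set.Ioo (0 : ℝ) 1) : Module.End ℂ (CoordAlg q × CoordAlg q) :=
  blockOp
    ((((q : ℝ) : ℂ) - ((q : ℝ) : ℂ)⁻¹)⁻¹ • (((q : ℝ) : ℂ)⁻¹ • (opK q * opK q) - 1))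
    (sqrtQ q • (opE q * opK q))
    ((sqrtQ q)⁻¹ • (opF q * opK q))
    ((((q : ℝ) : ℂ) - ((q : ℝ) : ℂ)⁻¹)⁻¹ • (1 - ((q : ℝ) : ℂ) • (opK q * opK q)))

/-- The endomorphism of `𝒜 ⊕ 𝒜` of which the modular operator is the closure. -/
def modularEnd (q : Set.Ioo (0 : ℝ) 1) : Module.End ℂ (CoordAlg q × CoordAlg q) :=
  blockOp ((sqrtQ q)⁻¹ • opK q) 0 0 (sqrtQ q • opK q)

theorem blockOp_apply (T₁₁ T₁₂ T₂₁ T₂₂ : Module.End ℂ (CoordAlg q)) (x y : CoordAlg q) :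
    blockOp T₁₁ T₁₂ T₂₁ T₂₂ (x, y) = (T₁₁ x + T₁₂ y, T₂₁ x + T₂₂ y) := rfl

theorem sqrtQ_zpow (k : ℤ) : sqrtQ q ^ k = ((Real.sqrt (q : ℝ) ^ k : ℝ) : ℂ) := by
  rw [sqrtQ]; push_cast; rfl

theorem diracEnd_diag (k : ℤ) : (((q : ℝ) : ℂ) - ((q : ℝ) : ℂ)⁻¹)⁻¹ *
    (sqrtQ q ^ k * sqrtQ q ^ k - 1) = ((Real.sqrt (q : ℝ) ^ k * qNum q k : ℝ) : ℂ) := by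
  have h := zpow_ne_zero k (sqrtQ_ne_zero q)
  rw [qNum, Complex.ofReal_mul, Complex.ofReal_div, Complex.ofReal_sub, ← sqrtQ_zpow,
    ← sqrtQ_zpow, zpow_neg, mul_div_assoc', mul_sub (sqrtQ q ^ k), mul_inv_cancel₀ h]
  push_cast
  rw [div_eq_inv_mul]

theorem diracEnd_fst {i j p : ℕ} (hp : p ≤ i + j) :
    diracEnd q (wvec q i j p, 0) =
      (((Real.sqrt (q : ℝ) ^ ((i : ℤ) + j + 1 - 2 * (p + 1 : ℕ)) *
          qNum q (i + j + 1 - 2 * (p + 1 : ℕ)) : ℝ) : ℂ) • wvec q i j p,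
        ((Real.sqrt (q : ℝ) ^ ((i : ℤ) + j + 1 - 2 * (p + 1 : ℕ)) *
          ladderCoeff q i j (p + 1) : ℝ) : ℂ) • wvec q i j (p + 1)) := by
  have hs := sqrtQ_ne_zero q
  have hk : sqrtQ q ^ ((i : ℤ) + j - 2 * p) =
      sqrtQ q ^ ((i : ℤ) + j + 1 - 2 * (p + 1 : ℕ)) * sqrtQ q := by
    rw [← zpow_add_one₀ hs]; congr 1; push_cast; ring
  have h1 : opK q (wvec q i j p) = _ := actK_wvec i j p
  have h2 : opF q (wvec q i j p) = _ := actF_wvec hp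
  simp only [diracEnd, blockOp_apply, map_zero,
    add_zero, LinearMap.smul_apply, LinearMap.sub_apply, Module.End.mul_apply,
    Module.End.one_apply, h1, h2, map_smul, ← diracEnd_diag, hk]
  refine Prod.ext ?_ ?_
  · simp only [sqrtQ_mul_self]
    match_scalars
    field_simp
  · simp only [Complex.ofReal_mul, ← sqrtQ_zpow]
    match_scalars
    field_simp

theorem diracEnd_snd_succ {i j p : ℕ} (hp : p ≤ i + j) :
    diracEnd q (0, wvec q i j (p + 1)) =
      (((Real.sqrt (q : ℝ) ^ ((i : ℤ) + j + 1 - 2 * (p + 1 : ℕ)) *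
          ladderCoeff q i j (p + 1) : ℝ) : ℂ) • wvec q i j p,
        -(((Real.sqrt (q : ℝ) ^ ((i : ℤ) + j + 1 - 2 * (p + 1 : ℕ)) *
          qNum q (i + j + 1 - 2 * (p + 1 : ℕ)) : ℝ) : ℂ) • wvec q i j (p + 1))) := by
  have hs := sqrtQ_ne_zero q
  have hk : sqrtQ q ^ ((i : ℤ) + j - 2 * (p + 1 : ℕ)) =
      sqrtQ q ^ ((i : ℤ) + j + 1 - 2 * (p + 1 : ℕ)) * (sqrtQ q)⁻¹ := by
    rw [← zpow_sub_one₀ hs]; congr 1; push_cast; ring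
  have h1 : opK q (wvec q i j (p + 1)) = _ := actK_wvec i j (p + 1)
  have h2 : opE q (wvec q i j (p + 1)) = _ := actE_wvec_succ hp
  simp only [diracEnd, blockOp_apply, map_zero,
    zero_add, LinearMap.smul_apply, LinearMap.sub_apply, Module.End.mul_apply,
    Module.End.one_apply, h1, h2, map_smul, ← diracEnd_diag, hk]
  refine Prod.ext ?_ ?_
  · simp only [Complex.ofReal_mul, ← sqrtQ_zpow]
    match_scalars
    field_simp
  · simp only [sqrtQ_mul_self]
    match_scalars
    field_simp
    ring

theorem diracEnd_snd_zero (i j : ℕ) :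
    diracEnd q (0, wvec q i j 0) =
      (0, -(((Real.sqrt (q : ℝ) ^ ((i : ℤ) + j + 1) * qNum q (i + j + 1) : ℝ) : ℂ) •
        wvec q i j 0)) := by
  have hs := sqrtQ_ne_zero q
  have hk : sqrtQ q ^ ((i : ℤ) + j - 2 * (0 : ℕ)) =
      sqrtQ q ^ ((i : ℤ) + j + 1) * (sqrtQ q)⁻¹ := by
    rw [← zpow_sub_one₀ hs]; congr 1; push_cast; ring
  have h1 : opK q (wvec q i j 0) = _ := actK_wvec i j 0
  have h2 : opE q (wvec q i j 0) = _ := actE_wvec_zero i j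
  simp only [diracEnd, blockOp_apply, map_zero,
    zero_add, LinearMap.smul_apply, LinearMap.sub_apply, Module.End.mul_apply,
    Module.End.one_apply, h1, h2, map_smul, ← diracEnd_diag, hk, smul_zero]
  refine Prod.ext rfl ?_
  simp only [sqrtQ_mul_self]
  match_scalars
  field_simp
  ring

/-- Each block is `q^{k/2}` times a symmetric traceless matrix with determinant `-[N/2]²`. -/
theorem diracEnd_pairVec {i j p : ℕ} (hp : p ≤ i + j) (x y : ℝ) :
    diracEnd q (pairVec q x y i j (p + 1)) =
      pairVec q
        (Real.sqrt (q : ℝ) ^ ((i : ℤ) + j + 1 - 2 * (p + 1 : ℕ)) *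
          (qNum q (i + j + 1 - 2 * (p + 1 : ℕ)) * x + ladderCoeff q i j (p + 1) * y))
        (Real.sqrt (q : ℝ) ^ ((i : ℤ) + j + 1 - 2 * (p + 1 : ℕ)) *
          (ladderCoeff q i j (p + 1) * x - qNum q (i + j + 1 - 2 * (p + 1 : ℕ)) * y))
        i j (p + 1) := by
  have h : pairVec q x y i j (p + 1) =
      (x : ℂ) • (wvec q i j p, (0 : CoordAlg q)) + (y : ℂ) • (0, wvec q i j (p + 1)) := by
    simp [pairVec]
  rw [h, map_add, map_smul, map_smul, diracEnd_fst hp, diracEnd_snd_succ hp, pairVec]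
  refine Prod.ext ?_ ?_
  · simp only [Prod.fst_add, Prod.smul_fst, Nat.add_sub_cancel]
    match_scalars
    ring
  · simp only [Prod.snd_add, Prod.smul_snd]
    match_scalars
    ring

/-- The factors `q^{∓1/2}` in `Δ` compensate for the weight difference between `e_{p-1}` and `e_p`,
so every block lies in one eigenspace of `Δ`. -/
theorem modularEnd_pairVec {i j p : ℕ} {x : ℝ} (hx : p = 0 → x = 0) (y : ℝ) :
    modularEnd q (pairVec q x y i j p) =
      ((Real.sqrt (q : ℝ) ^ ((i : ℤ) + j + 1 - 2 * p) : ℝ) : ℂ) • pairVec q x y i j p := by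
  have hs := sqrtQ_ne_zero q
  have h1 : ∀ p, opK q (wvec q i j p) = _ := actK_wvec i j
  simp only [modularEnd, blockOp_apply, pairVec,
    LinearMap.zero_apply, add_zero, zero_add, smul_zero, LinearMap.smul_apply, map_smul, h1,
    ← sqrtQ_zpow]
  refine Prod.ext ?_ ?_
  · by_cases hp : p = 0
    · simp [hx hp]
    · simp only [Prod.smul_fst, smul_smul]
      congr 1
      have : (i : ℤ) + j - 2 * ((p - 1 : ℕ) : ℤ) = (i : ℤ) + j + 1 - 2 * p + 1 := by omega
      rw [this, zpow_add_one₀ hs]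
      field_simp
  · simp only [Prod.smul_snd, smul_smul]
    congr 1
    have : (i : ℤ) + j + 1 - 2 * p = (i : ℤ) + j - 2 * p + 1 := by ring
    rw [this, zpow_add_one₀ hs]
    ring

/-- The index set of the eigenbasis of the Dirac operator. -/
abbrev EigIndex : Type := WeightIndex ⊕ WeightIndex

/-- The eigenvectors of the Dirac operator. -/
def eigVec (q : Set.Ioo (0 : ℝ) 1) : EigIndex → CoordAlg q × CoordAlg q
  | .inl r => pairVec q (mixC q r.1.1 r.1.2.1 (r.1.2.2 + 1)) (-mixS q r.1.1 r.1.2.1 (r.1.2.2 + 1))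
      r.1.1 r.1.2.1 (r.1.2.2 + 1)
  | .inr r => if r.1.2.2 = 0 then pairVec q 0 1 r.1.1 r.1.2.1 0 else
      pairVec q (mixS q r.1.1 r.1.2.1 r.1.2.2) (mixC q r.1.1 r.1.2.1 r.1.2.2)
        r.1.1 r.1.2.1 r.1.2.2

/-- Twice the weight of the eigenvectors. -/
def eigWt : EigIndex → ℤ
  | .inl r => (r.1.1 : ℤ) + r.1.2.1 + 1 - 2 * (r.1.2.2 + 1 : ℕ)
  | .inr r => (r.1.1 : ℤ) + r.1.2.1 + 1 - 2 * r.1.2.2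

/-- The absolute values of the eigenvalues of the Dirac operator. -/
def eigAbs (q : Set.Ioo (0 : ℝ) 1) (r : EigIndex) : ℝ :=
  Real.sqrt (q : ℝ) ^ eigWt r *
    Sum.elim (fun r : WeightIndex => qNum q (r.1.1 + r.1.2.1 + 1))
      (fun r : WeightIndex => qNum q (r.1.1 + r.1.2.1 + 1)) r

/-- The eigenvalues of the Dirac operator. -/
def eigVal (q : Set.Ioo (0 : ℝ) 1) (r : EigIndex) : ℝ :=
  Sum.elim (fun _ => -1) (fun r : WeightIndex => if r.1.2.2 = 0 then -1 else 1) r * eigAbs q r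

theorem eigAbs_pos (r : EigIndex) : 0 < eigAbs q r := by
  rcases r with r | r <;> exact mul_pos (zpow_pos (sqrt_q_pos q) _) (qNum_pos (by omega))

theorem abs_eigVal (r : EigIndex) : |eigVal q r| = eigAbs q r := by
  rw [eigVal, abs_mul, abs_of_pos (eigAbs_pos r)]
  rcases r with r | r
  · simp
  · simp only [Sum.elim_inr]; split_ifs <;> simp

theorem pairVec_smul (z x y : ℝ) (i j p : ℕ) :
    (z : ℂ) • pairVec q x y i j p = pairVec q (z * x) (z * y) i j p := by
  simp [pairVec, smul_smul, -Complex.coe_smul]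

/-- The left summand carries the negative eigenvalues, including the one-dimensional block at `p + 1
= N`, where `mixS` vanishes. The right one carries the positive eigenvalues and, at `p = 0`, the
isolated vector `(0, e_0)`, whose eigenvalue is negative. -/
theorem diracEnd_eigVec (r : EigIndex) :
    diracEnd q (eigVec q r) = ((eigVal q r : ℝ) : ℂ) • eigVec q r := by
  rcases r with ⟨⟨i, j, p⟩, hp⟩ | ⟨⟨i, j, p⟩, hp⟩
  · simp only at hp
    have h1 := ladderCoeff_mul_mixC (q := q) (i := i) (j := j) (p := p + 1) (by omega)
    have h2 := ladderCoeff_mul_mixS (q := q) (i := i) (j := j) (p := p + 1) (by omega)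
    simp only [eigVec, eigVal, eigAbs, eigWt, Sum.elim_inl]
    rw [diracEnd_pairVec hp, pairVec_smul]
    congr 1
    · linear_combination -(Real.sqrt (q : ℝ) ^ ((i : ℤ) + j + 1 - 2 * (p + 1 : ℕ))) * h2
    · linear_combination (Real.sqrt (q : ℝ) ^ ((i : ℤ) + j + 1 - 2 * (p + 1 : ℕ))) * h1
  · rcases p with _ | p
    · have h : pairVec q 0 1 i j 0 = (0, wvec q i j 0) := by simp [pairVec]
      simp only [eigVec, eigVal, eigAbs, eigWt, Sum.elim_inr, if_true, h]
      rw [diracEnd_snd_zero]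
      refine Prod.ext (by simp) ?_
      simp
    · simp only at hp
      have h1 := ladderCoeff_mul_mixC (q := q) (i := i) (j := j) (p := p + 1) (by omega)
      have h2 := ladderCoeff_mul_mixS (q := q) (i := i) (j := j) (p := p + 1) (by omega)
      simp only [eigVec, eigVal, eigAbs, eigWt, Sum.elim_inr, Nat.add_eq_zero_iff, one_ne_zero,
        and_false, if_false]
      rw [diracEnd_pairVec (by omega), pairVec_smul]
      congr 1
      · linear_combination (Real.sqrt (q : ℝ) ^ ((i : ℤ) + j + 1 - 2 * (p + 1 : ℕ))) * h1
      · linear_combination (Real.sqrt (q : ℝ) ^ ((i : ℤ) + j + 1 - 2 * (p + 1 : ℕ))) * h2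

theorem modularEnd_eigVec (r : EigIndex) :
    modularEnd q (eigVec q r) = ((Real.sqrt (q : ℝ) ^ eigWt r : ℝ) : ℂ) • eigVec q r := by
  rcases r with ⟨⟨i, j, p⟩, hp⟩ | ⟨⟨i, j, p⟩, hp⟩
  · exact modularEnd_pairVec (by omega) _
  · simp only [eigVec, eigWt]
    split_ifs with h
    · subst h
      exact modularEnd_pairVec (fun _ => rfl) _
    · exact modularEnd_pairVec (fun h' => absurd h' h) _

theorem orthonormal_eigVec : Orthonormal ℂ fun r => inclH q (eigVec q r) := by
  classical
  rw [orthonormal_iff_ite]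
  have hll : ∀ r r' : WeightIndex, ⟪inclH q (eigVec q (.inl r)), inclH q (eigVec q (.inl r'))⟫_ℂ =
      if r = r' then 1 else 0 := by
    rintro ⟨⟨i, j, p⟩, hp⟩ ⟨⟨i', j', p'⟩, hp'⟩
    simp only at hp hp'
    split_ifs with h
    · simp only [Subtype.mk.injEq, Prod.mk.injEq] at h
      obtain ⟨rfl, rfl, rfl⟩ := h
      simp only [eigVec]
      rw [inner_pairVec_self (by omega), neg_mul_neg, mixC_sq_add_mixS_sq (by omega),
        Complex.ofReal_one]
      intro h
      rw [h, mixS_top, neg_zero]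
    · refine inner_pairVec_eq_zero (fun h' => h ?_) (by omega) (by omega)
      simp only [Prod.mk.injEq, Subtype.mk.injEq] at h' ⊢
      omega
  have hlr : ∀ r r' : WeightIndex,
      ⟪inclH q (eigVec q (.inl r)), inclH q (eigVec q (.inr r'))⟫_ℂ = 0 := by
    rintro ⟨⟨i, j, p⟩, hp⟩ ⟨⟨i', j', p'⟩, hp'⟩
    simp only at hp hp'
    simp only [eigVec]
    split_ifs with h0
    · exact inner_pairVec_eq_zero (by simp) (by omega) (by simp)
    · by_cases h : (i, j, p + 1) = (i', j', p')
      · simp only [Prod.mk.injEq] at h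
        obtain ⟨rfl, rfl, rfl⟩ := h
        rw [inner_pairVec_self (by omega) (by omega)]
        simp [mul_comm]
      · exact inner_pairVec_eq_zero h (by omega) (by omega)
  have hrr : ∀ r r' : WeightIndex, ⟪inclH q (eigVec q (.inr r)), inclH q (eigVec q (.inr r'))⟫_ℂ =
      if r = r' then 1 else 0 := by
    rintro ⟨⟨i, j, p⟩, hp⟩ ⟨⟨i', j', p'⟩, hp'⟩
    simp only at hp hp'
    split_ifs with h
    · simp only [Subtype.mk.injEq, Prod.mk.injEq] at h
      obtain ⟨rfl, rfl, rfl⟩ := h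
      simp only [eigVec]
      split_ifs with h0
      · rw [inner_pairVec_self (by omega) (by omega)]
        simp
      · rw [inner_pairVec_self (by omega) (by omega), add_comm,
          mixC_sq_add_mixS_sq (by omega), Complex.ofReal_one]
    · have h2 : (i, j, p) ≠ (i', j', p') := fun h' => h (Subtype.ext h')
      simp only [eigVec]
      split_ifs with h0 h0' h0'
      · subst h0 h0'; exact inner_pairVec_eq_zero h2 (by simp) (by simp)
      · subst h0; exact inner_pairVec_eq_zero h2 (by simp) (by omega)
      · subst h0'; exact inner_pairVec_eq_zero h2 (by omega) (by simp)
      · exact inner_pairVec_eq_zero h2 (by omega) (by omega)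
  rintro (r | r) (r' | r')
  · simpa using hll r r'
  · simpa using hlr r r'
  · rw [← inner_conj_symm, hlr]; simp
  · simpa using hrr r r'

/-- The inverse rotation. At `p = i + j` the second eigenvector does not exist, but its coefficient
`mixS` is zero. -/
theorem fst_wvec_mem {i j p : ℕ} (hp : p ≤ i + j) :
    (wvec q i j p, (0 : CoordAlg q)) ∈ Submodule.span ℂ (Set.range (eigVec q)) := by
  have h1 : eigVec q (.inl ⟨(i, j, p), hp⟩) ∈ Submodule.span ℂ (Set.range (eigVec q)) :=
    Submodule.subset_span ⟨_, rfl⟩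
  have h3 := mixC_sq_add_mixS_sq (q := q) (i := i) (j := j) (p := p + 1) (by omega)
  rcases hp.lt_or_eq with hlt | rfl
  · have h2 : eigVec q (.inr ⟨(i, j, p + 1), hlt⟩) ∈ Submodule.span ℂ (Set.range (eigVec q)) :=
      Submodule.subset_span ⟨_, rfl⟩
    have h4 := Submodule.add_mem _ (Submodule.smul_mem _ ((mixC q i j (p + 1) : ℝ) : ℂ) h1)
      (Submodule.smul_mem _ ((mixS q i j (p + 1) : ℝ) : ℂ) h2)
    simp only [eigVec, Nat.add_eq_zero_iff, one_ne_zero, and_false, if_false, pairVec_smul] at h4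
    convert h4 using 1
    simp only [pairVec, Nat.add_sub_cancel, Prod.mk_add_mk, ← add_smul, ← Complex.ofReal_add, h3]
    refine Prod.ext (by simp) ?_
    rw [mul_neg, mul_comm, neg_add_cancel]
    simp
  · have h4 := Submodule.smul_mem _ ((mixC q i j (i + j + 1) : ℝ) : ℂ) h1
    rw [mixS_top, mul_zero, add_zero] at h3
    simp only [eigVec, pairVec_smul, mixS_top] at h4
    convert h4 using 1
    simp [pairVec, h3]

theorem snd_wvec_mem {i j p : ℕ} (hp : p ≤ i + j) :
    ((0 : CoordAlg q), wvec q i j p) ∈ Submodule.span ℂ (Set.range (eigVec q)) := by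
  have h2 : eigVec q (.inr ⟨(i, j, p), hp⟩) ∈ Submodule.span ℂ (Set.range (eigVec q)) :=
    Submodule.subset_span ⟨_, rfl⟩
  rcases p with _ | p
  · convert h2 using 1
    simp [eigVec, pairVec]
  · have h1 : eigVec q (.inl ⟨(i, j, p), by simp only; omega⟩) ∈
        Submodule.span ℂ (Set.range (eigVec q)) := Submodule.subset_span ⟨_, rfl⟩
    have h3 := mixC_sq_add_mixS_sq (q := q) (i := i) (j := j) (p := p + 1) (by omega)
    have h4 := Submodule.add_mem _ (Submodule.smul_mem _ ((-mixS q i j (p + 1) : ℝ) : ℂ) h1)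
      (Submodule.smul_mem _ ((mixC q i j (p + 1) : ℝ) : ℂ) h2)
    simp only [eigVec, Nat.add_eq_zero_iff, one_ne_zero, and_false, if_false, pairVec_smul] at h4
    convert h4 using 1
    simp only [pairVec, Nat.add_sub_cancel, Prod.mk_add_mk, ← add_smul, ← Complex.ofReal_add]
    refine Prod.ext ?_ ?_
    · rw [neg_mul, mul_comm, neg_add_cancel]
      simp
    · rw [neg_mul_neg, add_comm (mixS q i j (p + 1) * _), h3]
      simp

theorem span_eigVec : Submodule.span ℂ (Set.range (eigVec q)) = ⊤ := by
  rw [eq_top_iff]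
  rintro ⟨x, y⟩ -
  have hx : x ∈ (Submodule.span ℂ (Set.range (eigVec q))).comap
      (LinearMap.inl ℂ (CoordAlg q) (CoordAlg q)) := by
    refine (Submodule.span_le.mpr ?_) (mem_span_wvec x)
    rintro _ ⟨r, rfl⟩
    exact fst_wvec_mem r.2
  have hy : y ∈ (Submodule.span ℂ (Set.range (eigVec q))).comap
      (LinearMap.inr ℂ (CoordAlg q) (CoordAlg q)) := by
    refine (Submodule.span_le.mpr ?_) (mem_span_wvec y)
    rintro _ ⟨r, rfl⟩
    exact snd_wvec_mem r.2
  rw [Submodule.mem_comap] at hx hy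
  have h := Submodule.add_mem _ hx hy
  simpa using h

/-! ### The eigenbasis and the graphs of the closed operators -/

theorem denseRange_incl : DenseRange (incl q) := by
  have h := UniformSpace.Completion.denseRange_coe (α := PreGNS q)
  exact h.comp (toPreGNS q).surjective.denseRange (UniformSpace.Completion.continuous_coe _)

/-- The orthonormal basis of eigenvectors of the Dirac operator. -/
def eigBasis (q : Set.Ioo (0 : ℝ) 1) : HilbertBasis EigIndex ℂ (HilbertH q) :=
  HilbertBasis.mkOfOrthogonalEqBot (orthonormal_eigVec (q := q)) (by
    rw [Submodule.eq_bot_iff]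
    intro v hv
    have h : ∀ x y, ⟪inclH q (x, y), v⟫_ℂ = 0 := by
      intro x y
      rw [Submodule.mem_orthogonal] at hv
      refine hv _ ?_
      have h1 : (x, y) ∈ Submodule.span ℂ (Set.range (eigVec q)) := by
        rw [span_eigVec]; trivial
      have h2 := Submodule.mem_map_of_mem (f := inclH q) h1
      rw [Submodule.map_span, ← Set.range_comp] at h2
      exact h2
    have h1 : v.fst = 0 := by
      refine (Dense.eq_zero_of_inner_right ℂ denseRange_incl ?_)
      rintro _ ⟨x, rfl⟩
      have := h x 0
      rwa [inclH_inner_eq, map_zero, inner_zero_left, add_zero] at this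
    have h2 : v.snd = 0 := by
      refine (Dense.eq_zero_of_inner_right ℂ denseRange_incl ?_)
      rintro _ ⟨x, rfl⟩
      have := h 0 x
      rwa [inclH_inner_eq, map_zero, inner_zero_left, zero_add] at this
    exact WithLp.ofLp_injective 2 (Prod.ext h1 h2))

theorem eigBasis_apply (r : EigIndex) : eigBasis q r = inclH q (eigVec q r) := by
  rw [eigBasis, HilbertBasis.coe_mkOfOrthogonalEqBot]

/-- The eigenvectors span `𝒜 ⊕ 𝒜` algebraically, so the graph before closure is exactly the span of
the diagonal pairs. -/
theorem unbounded_graph (T : Module.End ℂ (CoordAlg q × CoordAlg q)) {t : EigIndex → ℂ}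
    (hT : ∀ r, T (eigVec q r) = t r • eigVec q r) :
    (unbounded q T).graph =
      Submodule.span ℂ (Set.range fun r => (eigBasis q r, t r • eigBasis q r)) := by
  rw [unbounded, Submodule.toLinearPMap_graph_eq]
  · rw [LinearMap.range_eq_map, ← span_eigVec, Submodule.map_span, ← Set.range_comp]
    congr 2
    funext r
    simp only [Function.comp_apply, LinearMap.prod_apply, LinearMap.comp_apply, hT, map_smul,
      eigBasis_apply, Function.prod]
  · rintro _ ⟨x, rfl⟩ h
    have : x = 0 := inclH_injective (by rw [map_zero]; exact h)
    rw [this, map_zero]; rfl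

theorem dirac_graph : (dirac q).graph = diagGraph (eigBasis q) fun r => (eigVal q r : ℂ) :=
  graph_closure_eq_diagGraph _ _ (unbounded_graph _ diracEnd_eigVec)

theorem modular_graph : (modular q).graph =
    diagGraph (eigBasis q) fun r => ((Real.sqrt (q : ℝ) ^ eigWt r : ℝ) : ℂ) :=
  graph_closure_eq_diagGraph _ _ (unbounded_graph _ modularEnd_eigVec)

theorem isSelfAdjoint_dirac : IsSelfAdjoint (dirac q) :=
  isSelfAdjoint_of_graph_eq_diagGraph _ (fun _ => Complex.conj_ofReal _) dirac_graph

/-! ## The trace of the complex powers of the Dirac operator -/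

theorem zpow_mul_qNum (k : ℤ) : Real.sqrt (q : ℝ) ^ k * qNum q k =
    (1 - (q : ℝ) ^ k) / ((q : ℝ)⁻¹ - q) := by
  have h := (sqrt_q_pos q).ne'
  have h2 : Real.sqrt (q : ℝ) ^ k * Real.sqrt (q : ℝ) ^ k = (q : ℝ) ^ k := by
    rw [← mul_zpow, Real.mul_self_sqrt q.2.1.le]
  have h3 : (q : ℝ)⁻¹ - q = -(q - (q : ℝ)⁻¹) := by ring
  rw [qNum, ← mul_div_assoc, mul_sub, h2, ← zpow_add₀ h, add_neg_cancel, zpow_zero, h3,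
    div_neg, ← neg_div, neg_sub]

/-- Since `k ≤ N` and `q < 1`, `q^{k/2} [N/2] ≥ q^{N/2} [N/2] = (1 - q^N) / (q⁻¹ - q)`, which is
smallest at `N = 1`. -/
theorem exists_eigAbs_bound (q : Set.Ioo (0 : ℝ) 1) : ∃ ε > 0, ∀ r, ε ≤ eigAbs q r := by
  have hd := q_sub_inv_neg q
  refine ⟨(1 - q) / ((q : ℝ)⁻¹ - q), div_pos (by linarith [q.2.2]) (by linarith), ?_⟩
  have key : ∀ k N : ℤ, 1 ≤ N → k ≤ N → (1 - q) / ((q : ℝ)⁻¹ - q) ≤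
      Real.sqrt (q : ℝ) ^ k * qNum q N := by
    intro k N h1 hk
    calc (1 - (q : ℝ)) / ((q : ℝ)⁻¹ - q) ≤ (1 - (q : ℝ) ^ N) / ((q : ℝ)⁻¹ - q) := by
          refine div_le_div_of_nonneg_right (sub_le_sub_left ?_ _) (by linarith)
          simpa using zpow_le_zpow_right_of_le_one₀ q.2.1 q.2.2.le h1
      _ = Real.sqrt (q : ℝ) ^ N * qNum q N := (zpow_mul_qNum N).symm
      _ ≤ _ := mul_le_mul_of_nonneg_right
          (zpow_le_zpow_right_of_le_one₀ (sqrt_q_pos q) (sqrt_q_lt_one q).le hk)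
          (qNum_pos (by omega)).le
  rintro (r | r)
  · exact key _ _ (by omega) (by simp only [eigWt]; omega)
  · exact key _ _ (by omega) (by simp only [eigWt]; omega)

theorem eigVal_ne_zero (r : EigIndex) : (eigVal q r : ℂ) ≠ 0 := by
  have := eigAbs_pos (q := q) r
  rw [← abs_eigVal, abs_pos] at this
  exact_mod_cast this

theorem exists_boundedInverse_dirac (q : Set.Ioo (0 : ℝ) 1) :
    ∃ R, IsBoundedInverse (dirac q) R := by
  obtain ⟨ε, hε, h⟩ := exists_eigAbs_bound q
  refine exists_isBoundedInverse (eigBasis q) hε (fun r => ?_) dirac_graph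
  rw [Complex.norm_real, Real.norm_eq_abs, abs_eigVal]
  exact h r

theorem rpow_half_eq (k : ℤ) : (q : ℝ) ^ ((k : ℝ) / 2) = Real.sqrt (q : ℝ) ^ k := by
  rw [Real.sqrt_eq_rpow, ← Real.rpow_intCast, ← Real.rpow_mul q.2.1.le]
  congr 1; ring

/-- As `k ↦ q^{k/2}` is injective, an eigenvector of `Δ` has coordinates only along basis vectors of
weight `k`. -/
theorem mem_eigenH (k : ℤ) (v : HilbertH q) :
    v ∈ eigenH q k ↔ ∀ r ∉ eigWt ⁻¹' {k}, ⟪eigBasis q r, v⟫_ℂ = 0 := by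
  have h1 : v ∈ eigenH q k ↔ (v, (((q : ℝ) ^ ((k : ℝ) / 2) : ℝ) : ℂ) • v) ∈ (modular q).graph :=
    Iff.rfl
  rw [h1, modular_graph, mem_diagGraph]
  refine forall_congr' fun r => ?_
  rw [inner_smul_right, rpow_half_eq, mul_eq_mul_right_iff, Complex.ofReal_inj,
    (zpow_right_strictAnti₀ (sqrt_q_pos q) (sqrt_q_lt_one q)).injective.eq_iff, eq_comm,
    Set.mem_preimage, Set.mem_singleton_iff, or_iff_not_imp_left]

/-- An operator which is diagonal in the eigenbasis of the Dirac operator lies in `ℳ`. -/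
theorem mem_vonNeumann {T : HilbertH q →L[ℂ] HilbertH q} {t : EigIndex → ℂ}
    (hT : ∀ r, T (eigBasis q r) = t r • eigBasis q r) : T ∈ vonNeumann q := by
  intro k v hv
  rw [mem_eigenH] at hv ⊢
  intro r hr
  rw [inner_of_eigenbasis _ hT, hv r hr, mul_zero]

theorem abs_apply_eigenbasis {T : HilbertH q →L[ℂ] HilbertH q} {t : EigIndex → ℂ}
    (hT : ∀ r, T (eigBasis q r) = t r • eigBasis q r) (r : EigIndex) :
    CFC.abs T (eigBasis q r) = ((‖t r‖ : ℝ) : ℂ) • eigBasis q r := by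
  have hn := isStarNormal_of_eigenbasis _ hT
  have h1 := cfc_comp_norm (fun x : ℂ => x) T
  rw [cfc_id' ℂ (CFC.abs T) (CFC.abs_nonneg T).isSelfAdjoint.isStarNormal] at h1
  rw [← h1]
  exact cfc_apply_eigenvector hn (hT r) (adjoint_of_eigenbasis _ hT r) (by fun_prop)

theorem psiPos_eq_tsum {T : HilbertH q →L[ℂ] HilbertH q} {t : EigIndex → ℝ} (ht : ∀ r, 0 ≤ t r)
    (hT : ∀ r, T (eigBasis q r) = (t r : ℂ) • eigBasis q r) :
    psiPos q T = ∑' r, ENNReal.ofReal (Real.sqrt (q : ℝ) ^ eigWt r * t r) := by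
  rw [← ENNReal.tsum_fiberwise _ eigWt, psiPos]
  refine tsum_congr fun k => ?_
  rw [tsum_onb_ofReal (mem_eigenH k) ht hT, ← ENNReal.tsum_mul_left]
  refine tsum_congr fun r => ?_
  have hr : eigWt r.1 = k := r.2
  rw [rpow_half_eq, hr, ENNReal.ofReal_mul (zpow_nonneg (sqrt_q_pos q).le _)]

theorem mem_traceIdeal {T : HilbertH q →L[ℂ] HilbertH q} {t : EigIndex → ℂ}
    (hT : ∀ r, T (eigBasis q r) = t r • eigBasis q r)
    (hs : Summable fun r => ((Real.sqrt (q : ℝ) ^ eigWt r : ℝ) : ℂ) * t r) :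
    T ∈ traceIdeal q := by
  refine ⟨mem_vonNeumann hT, ?_⟩
  rw [psiPos_eq_tsum (fun r => norm_nonneg (t r)) (abs_apply_eigenbasis hT)]
  refine lt_top_iff_ne_top.mpr (Summable.tsum_ofReal_ne_top ?_)
  refine hs.norm.congr fun r => ?_
  rw [norm_mul, Complex.norm_real, Real.norm_of_nonneg (zpow_nonneg (sqrt_q_pos q).le _)]

theorem psi_eq_tsum {T : HilbertH q →L[ℂ] HilbertH q} {t : EigIndex → ℂ}
    (hT : ∀ r, T (eigBasis q r) = t r • eigBasis q r)
    (hs : Summable fun r => ((Real.sqrt (q : ℝ) ^ eigWt r : ℝ) : ℂ) * t r) :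
    psi q T = ∑' r, ((Real.sqrt (q : ℝ) ^ eigWt r : ℝ) : ℂ) * t r := by
  rw [← (hs.hasSum.tsum_fiberwise eigWt).tsum_eq, psi]
  refine tsum_congr fun k => ?_
  have h0 : ((Real.sqrt (q : ℝ) ^ k : ℝ) : ℂ) ≠ 0 := by
    exact_mod_cast (zpow_pos (sqrt_q_pos q) k).ne'
  have h1 : ∀ r : eigWt ⁻¹' {k}, ((Real.sqrt (q : ℝ) ^ eigWt r.1 : ℝ) : ℂ) * t r.1 =
      ((Real.sqrt (q : ℝ) ^ k : ℝ) : ℂ) * t r.1 := by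
    intro r
    have hr : eigWt r.1 = k := r.2
    rw [hr]
  have h2 : Summable fun r : eigWt ⁻¹' {k} => t r.1 := by
    have := (hs.subtype (eigWt ⁻¹' {k})).congr (g := fun r : eigWt ⁻¹' {k} =>
      ((Real.sqrt (q : ℝ) ^ k : ℝ) : ℂ) * t r.1) h1
    exact (summable_mul_left_iff h0).mp this
  rw [tsum_congr h1, tsum_mul_left, tsum_onb (mem_eigenH k) h2.norm hT, rpow_half_eq]

/-- For `Re z > 0` the function `s ↦ |s|^z` is continuous even at `0`, so the continuous calculus of
the inverse applies to eigenvectors. -/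
theorem absPowNeg_dirac_apply {z : ℂ} (hz : 0 < z.re) (r : EigIndex) :
    absPowNeg (dirac q) z (eigBasis q r) =
      (((eigAbs q r)⁻¹ : ℝ) : ℂ) ^ z • eigBasis q r := by
  have hR := boundedInverse_apply (dirac_graph (q := q)) (exists_boundedInverse_dirac q)
    eigVal_ne_zero
  have h := cfc_apply_eigenvector (isStarNormal_of_eigenbasis _ hR) (hR r)
    (adjoint_of_eigenbasis _ hR r) (f := fun s : ℂ => ((‖s‖ : ℝ) : ℂ) ^ z)
    ((Complex.continuous_ofReal_cpow_const hz).comp continuous_norm).continuousOn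
  rw [absPowNeg, h, norm_inv, Complex.norm_real, Real.norm_eq_abs, abs_eigVal]

/-- The contribution of an eigenvector of the Dirac operator to the zeta function. -/
def zetaTerm (q : Set.Ioo (0 : ℝ) 1) (z : ℂ) (r : EigIndex) : ℂ :=
  ((Real.sqrt (q : ℝ) ^ eigWt r : ℝ) : ℂ) * (((eigAbs q r)⁻¹ : ℝ) : ℂ) ^ z

theorem absPowNeg_mem_traceIdeal {z : ℂ} (hz : 0 < z.re) (hs : Summable (zetaTerm q z)) :
    absPowNeg (dirac q) z ∈ traceIdeal q :=
  mem_traceIdeal (absPowNeg_dirac_apply hz) hs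

theorem zetaQ_eq_tsum {z : ℂ} (hz : 0 < z.re) (hs : Summable (zetaTerm q z)) :
    zetaQ q z = ∑' r, zetaTerm q z r :=
  psi_eq_tsum (absPowNeg_dirac_apply hz) hs

/-! ## Binomial coefficients -/

theorem choose_eq_eval (z : ℂ) (j : ℕ) :
    Ring.choose (z + j - 1) j = (ascPochhammer ℂ j).eval z / (j.factorial : ℂ) := by
  have h := Ring.factorial_nsmul_multichoose_eq_ascPochhammer z j
  rw [Polynomial.ascPochhammer_smeval_eq_eval, nsmul_eq_mul, Ring.multichoose_eq] at h
  rw [← h, mul_div_cancel_left₀]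
  exact_mod_cast j.factorial_ne_zero

/-- Factor by factor `|z + j| ≤ k + 1 + j`, so the rising factorial of `z` is bounded by that of `k
+ 1`. The bound is uniform on discs, as the continuation requires. -/
theorem norm_ascPochhammer_eval_le {z : ℂ} {k : ℕ} (hz : ‖z‖ ≤ k + 1) (j : ℕ) :
    ‖(ascPochhammer ℂ j).eval z‖ ≤ j.factorial * ((j + k).choose k : ℝ) := by
  induction j with
  | zero => simp
  | succ j ih =>
    have h : ((j + 1).factorial : ℝ) * ((j + 1 + k).choose k : ℝ) =
        (j.factorial * ((j + k).choose k : ℝ)) * (k + 1 + j) := by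
      have h1 := Nat.add_choose_mul_factorial_mul_factorial (j + 1) k
      have h2 := Nat.add_choose_mul_factorial_mul_factorial j k
      have h3 : (j + 1 + k).factorial = (k + 1 + j) * (j + k).factorial := by
        rw [show j + 1 + k = (j + k) + 1 by ring, Nat.factorial_succ]; ring
      have h4 : (k.factorial : ℝ) ≠ 0 := by exact_mod_cast k.factorial_ne_zero
      apply mul_right_cancel₀ h4
      have h1' : ((j + 1 + k).choose k : ℝ) * (j + 1).factorial * k.factorial =
        (k + 1 + j) * (j + k).factorial := by exact_mod_cast h1.trans h3
      have h2' : ((j + k).choose k : ℝ) * j.factorial * k.factorial =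
        (j + k).factorial := by exact_mod_cast h2
      linear_combination h1' - (k + 1 + j : ℝ) * h2'
    rw [ascPochhammer_succ_eval, norm_mul, h]
    refine mul_le_mul ih ?_ (norm_nonneg _) (by positivity)
    calc ‖z + j‖ ≤ ‖z‖ + ‖(j : ℂ)‖ := norm_add_le _ _
      _ ≤ k + 1 + j := by rw [Complex.norm_natCast]; linarith

theorem norm_choose_le {z : ℂ} {k : ℕ} (hz : ‖z‖ ≤ k + 1) (j : ℕ) :
    ‖Ring.choose (z + j - 1) j‖ ≤ ((j + k).choose k : ℝ) := by
  rw [choose_eq_eval, norm_div, Complex.norm_natCast, div_le_iff₀ (by positivity), mul_comm]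
  exact norm_ascPochhammer_eval_le hz j

theorem summable_choose_mul_pow (k : ℕ) {x : ℝ} (h0 : 0 ≤ x) (h1 : x < 1) :
    Summable fun j => ((j + k).choose k : ℝ) * x ^ j :=
  summable_choose_mul_geometric_of_norm_lt_one k (by rwa [Real.norm_of_nonneg h0])

theorem summable_norm_choose_mul_pow (z : ℂ) {x : ℝ} (h0 : 0 ≤ x) (h1 : x < 1) :
    Summable fun j : ℕ => ‖Ring.choose (z + j - 1) j‖ * x ^ j := by
  obtain ⟨k, hk⟩ := exists_nat_ge ‖z‖
  refine (summable_choose_mul_pow k h0 h1).of_nonneg_of_le (fun j => by positivity) fun j => ?_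
  exact mul_le_mul_of_nonneg_right (norm_choose_le (by linarith) j) (by positivity)

/-- The binomial series. -/
theorem hasSum_choose_mul_pow (z : ℂ) {x : ℝ} (h0 : 0 ≤ x) (h1 : x < 1) :
    HasSum (fun j : ℕ => Ring.choose (z + j - 1) j * (x : ℂ) ^ j)
      ((((1 - x)⁻¹ : ℝ) : ℂ) ^ z) := by
  have hx : (x : ℂ) ∈ Metric.eball (0 : ℂ) 1 := by
    rw [← ENNReal.ofReal_one, Metric.eball_ofReal, mem_ball_zero_iff, Complex.norm_real,
      Real.norm_of_nonneg h0]
    exact h1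
  have h := (Complex.one_div_one_sub_cpow_hasFPowerSeriesOnBall_zero z).hasSum hx
  simp only [FormalMultilinearSeries.ofScalars_apply_eq, smul_eq_mul, zero_add] at h
  have harg : ((1 - x : ℝ) : ℂ).arg ≠ Real.pi := by
    rw [Complex.arg_ofReal_of_nonneg (by linarith)]; exact Real.pi_ne_zero.symm
  rwa [Complex.ofReal_inv, Complex.inv_cpow _ _ harg, Complex.ofReal_sub, Complex.ofReal_one,
    ← one_div]

/-! ## Sums over the index set -/

theorem hasSum_triple {u v w : ℂ} (hu : ‖u‖ < 1) (hv : ‖v‖ < 1) (hw : ‖w‖ < 1) :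
    HasSum (fun x : ℕ × ℕ × ℕ => u ^ x.1 * (v ^ x.2.1 * w ^ x.2.2))
      ((1 - u)⁻¹ * ((1 - v)⁻¹ * (1 - w)⁻¹)) := by
  have hn : ∀ {u : ℂ}, ‖u‖ < 1 → Summable fun n : ℕ => ‖u ^ n‖ := fun h => by
    simpa only [norm_pow] using summable_geometric_of_lt_one (norm_nonneg _) h
  have h2 : Summable fun x : ℕ × ℕ => v ^ x.1 * w ^ x.2 :=
    summable_mul_of_summable_norm (hn hv) (hn hw)
  have h3 : Summable fun x : ℕ × ℕ × ℕ => u ^ x.1 * (v ^ x.2.1 * w ^ x.2.2) :=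
    summable_mul_of_summable_norm (f := fun n : ℕ => u ^ n)
      (g := fun x : ℕ × ℕ => v ^ x.1 * w ^ x.2) (hn hu) h2.norm
  have h4 : HasSum (fun x : ℕ × ℕ => v ^ x.1 * w ^ x.2) ((1 - v)⁻¹ * (1 - w)⁻¹) :=
    (hasSum_geometric_of_norm_lt_one hv).mul (hasSum_geometric_of_norm_lt_one hw) h2
  exact HasSum.mul (f := fun n : ℕ => u ^ n) (g := fun x : ℕ × ℕ => v ^ x.1 * w ^ x.2)
    (hasSum_geometric_of_norm_lt_one hu) h4 h3

/-- The index set of the weight vectors, cut into the parts `p ≤ i` and `p > i`. -/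
def weightIndexParam : (ℕ × ℕ × ℕ) ⊕ (ℕ × ℕ × ℕ) → WeightIndex
  | .inl x => ⟨(x.1 + x.2.1, x.2.2, x.1), by simp only; omega⟩
  | .inr x => ⟨(x.1, x.2.1 + 1 + x.2.2, x.1 + 1 + x.2.1), by simp only; omega⟩

theorem weightIndexParam_bijective : Function.Bijective weightIndexParam := by
  constructor
  · rintro (⟨a, b, c⟩ | ⟨a, b, c⟩) (⟨a', b', c'⟩ | ⟨a', b', c'⟩) h <;>
      simp only [weightIndexParam, Subtype.mk.injEq, Prod.mk.injEq] at h <;>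
      simp only [Sum.inl.injEq, Sum.inr.injEq, Prod.mk.injEq, reduceCtorEq] <;> omega
  · rintro ⟨⟨i, j, p⟩, hp⟩
    simp only at hp
    rcases le_or_gt p i with h | h
    · refine ⟨.inl (p, i - p, j), Subtype.ext (Prod.ext ?_ rfl)⟩
      simp only [weightIndexParam]
      omega
    · refine ⟨.inr (i, p - i - 1, i + j - p), Subtype.ext (Prod.ext rfl (Prod.ext ?_ ?_))⟩ <;>
      · simp only [weightIndexParam]
        omega

/-- Cutting at `p ≤ i` resolves the constraint `p ≤ i + j` into two unconstrained triple geometric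
series. -/
theorem hasSum_weightIndex {u v : ℂ} (hu : ‖u‖ < 1) (hv : ‖v‖ < 1) :
    HasSum (fun r : WeightIndex => u ^ r.1.2.2 * v ^ (r.1.1 + r.1.2.1 - r.1.2.2))
      ((1 - u * v) / ((1 - u) ^ 2 * (1 - v) ^ 2)) := by
  rw [← (Equiv.ofBijective _ weightIndexParam_bijective).hasSum_iff]
  have hu1 : 1 - u ≠ 0 := by
    intro h; rw [← sub_eq_zero.mp h, norm_one] at hu; exact lt_irrefl _ hu
  have hv1 : 1 - v ≠ 0 := by
    intro h; rw [← sub_eq_zero.mp h, norm_one] at hv; exact lt_irrefl _ hv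
  have h1 : (1 - u * v) / ((1 - u) ^ 2 * (1 - v) ^ 2) =
      (1 - u)⁻¹ * ((1 - v)⁻¹ * (1 - v)⁻¹) + u * ((1 - u)⁻¹ * ((1 - u)⁻¹ * (1 - v)⁻¹)) := by
    field_simp; ring
  rw [h1]
  refine HasSum.sum ((hasSum_triple hu hv hv).congr_fun ?_)
    (((hasSum_triple hu hu hv).mul_left u).congr_fun ?_)
  · rintro ⟨a, b, c⟩
    simp only [Function.comp, Equiv.ofBijective_apply, weightIndexParam]
    rw [show a + b + c - a = b + c by omega, pow_add]
  · rintro ⟨a, b, c⟩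
    simp only [Function.comp, Equiv.ofBijective_apply, weightIndexParam]
    rw [show a + (b + 1 + c) - (a + 1 + b) = c by omega, pow_add, pow_add]
    ring

/-- Summation of the binomial series over the index set. -/
theorem hasSum_weightIndex_choose (z : ℂ) {u v : ℂ} (hu : ‖u‖ < 1) (hv : ‖v‖ < 1) :
    ∃ s : ℂ, HasSum (fun r : WeightIndex => u ^ r.1.2.2 * v ^ (r.1.1 + r.1.2.1 - r.1.2.2) *
        (((1 - (q : ℝ) ^ (r.1.1 + r.1.2.1 + 1))⁻¹ : ℝ) : ℂ) ^ z) s ∧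
      HasSum (fun j : ℕ => Ring.choose (z + j - 1) j * ((q : ℝ) : ℂ) ^ j *
        ((1 - u * ((q : ℝ) : ℂ) ^ j * (v * ((q : ℝ) : ℂ) ^ j)) /
          ((1 - u * ((q : ℝ) : ℂ) ^ j) ^ 2 * (1 - v * ((q : ℝ) : ℂ) ^ j) ^ 2))) s := by
  have hq0 := q.2.1
  have hq1 := q.2.2
  -- The binomial term `q^{j(p+n+1)}` splits as `q^j (q^j)^p (q^j)^n`, so it merely replaces `u, v`
  -- by `u q^j, v q^j`. Since `q^j ≤ 1`, a product of two summable families dominates.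
  let F : WeightIndex × ℕ → ℂ := fun x => Ring.choose (z + x.2 - 1) x.2 * ((q : ℝ) : ℂ) ^ x.2 *
    ((u * ((q : ℝ) : ℂ) ^ x.2) ^ x.1.1.2.2 *
      (v * ((q : ℝ) : ℂ) ^ x.2) ^ (x.1.1.1 + x.1.1.2.1 - x.1.1.2.2))
  have hF : Summable F := by
    have h1 := (hasSum_weightIndex hu hv).summable.norm
    have h2 := summable_norm_choose_mul_pow z hq0.le hq1
    refine Summable.of_norm_bounded (h1.mul_of_nonneg h2 (fun _ => norm_nonneg _)
      fun j => by positivity) ?_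
    rintro ⟨⟨⟨i, k, p⟩, hp⟩, j⟩
    have hqj : (q : ℝ) ^ j ≤ 1 := pow_le_one₀ hq0.le hq1.le
    have hb : ∀ (w : ℂ) (n : ℕ), ‖w * ((q : ℝ) : ℂ) ^ j‖ ^ n ≤ ‖w‖ ^ n := by
      intro w n
      rw [norm_mul, norm_pow, Complex.norm_real, Real.norm_of_nonneg hq0.le]
      exact pow_le_pow_left₀ (by positivity) (mul_le_of_le_one_right (norm_nonneg _) hqj) n
    simp only [F, norm_mul (_ * _) (_ * _), norm_mul (Ring.choose _ _), norm_mul (_ ^ _), norm_pow,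
      Complex.norm_real (q : ℝ), Real.norm_of_nonneg hq0.le]
    rw [mul_comm]
    exact mul_le_mul_of_nonneg_right (mul_le_mul (hb _ _) (hb _ _) (by positivity) (by positivity))
      (by positivity)
  have hF' : HasSum (fun x : ℕ × WeightIndex => F (x.2, x.1)) (∑' x, F x) :=
    (Equiv.prodComm ℕ WeightIndex).hasSum_iff.mpr hF.hasSum
  refine ⟨∑' x, F x, hF.hasSum.prod_fiberwise ?_, hF'.prod_fiberwise ?_⟩
  · rintro ⟨⟨i, k, p⟩, hp⟩
    simp only at hp
    have h := (hasSum_choose_mul_pow z (pow_nonneg hq0.le (i + k + 1))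
      (pow_lt_one₀ hq0.le hq1 (by omega))).mul_left (u ^ p * v ^ (i + k - p))
    refine h.congr_fun fun j => ?_
    obtain ⟨n, hn⟩ := Nat.exists_eq_add_of_le hp
    simp only [F, hn, Nat.add_sub_cancel_left, Complex.ofReal_pow]
    ring
  · intro j
    have hqj : (q : ℝ) ^ j ≤ 1 := pow_le_one₀ hq0.le hq1.le
    have hb : ∀ w : ℂ, ‖w‖ < 1 → ‖w * ((q : ℝ) : ℂ) ^ j‖ < 1 := by
      intro w hw
      rw [norm_mul, norm_pow, Complex.norm_real, Real.norm_of_nonneg hq0.le]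
      exact (mul_le_of_le_one_right (norm_nonneg _) hqj).trans_lt hw
    have h := (hasSum_weightIndex (hb u hu) (hb v hv)).mul_left
      (Ring.choose (z + j - 1) j * ((q : ℝ) : ℂ) ^ j)
    exact HasSum.congr_fun (g := fun r => F (r, j)) h fun r => rfl

/-! ## The series for the zeta function -/

theorem ofReal_pow_cpow {x : ℝ} (hx : 0 ≤ x) (n : ℕ) (z : ℂ) :
    ((x ^ n : ℝ) : ℂ) ^ z = ((x : ℂ) ^ z) ^ n := by
  induction n with
  | zero => simp
  | succ n ih =>
    rw [pow_succ, Complex.ofReal_mul, Complex.mul_cpow_ofReal_nonneg (pow_nonneg hx n) hx, ih,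
      pow_succ]

theorem cpow_half : ((q : ℝ) : ℂ) ^ (1 / 2 : ℂ) = sqrtQ q := by
  rw [sqrtQ, Real.sqrt_eq_rpow, Complex.ofReal_cpow q.2.1.le]
  norm_num

theorem cpow_sub_half (z : ℂ) : ((q : ℝ) : ℂ) ^ (z - 1 / 2) * sqrtQ q = ((q : ℝ) : ℂ) ^ z := by
  rw [← cpow_half, ← Complex.cpow_add _ _ (q_ne_zero q), sub_add_cancel]

theorem cpow_sub_half_add (z : ℂ) (j : ℕ) : ((q : ℝ) : ℂ) ^ (z - 1 / 2 + j) =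
    ((q : ℝ) : ℂ) ^ (z - 1 / 2) * ((q : ℝ) : ℂ) ^ j := by
  rw [Complex.cpow_add _ _ (q_ne_zero q), Complex.cpow_natCast]

theorem cpow_add_half (j : ℕ) : ((q : ℝ) : ℂ) ^ ((j : ℂ) + 1 / 2) =
    sqrtQ q * ((q : ℝ) : ℂ) ^ j := by
  rw [Complex.cpow_add _ _ (q_ne_zero q), Complex.cpow_natCast, cpow_half, mul_comm]

theorem cpow_two_mul_add (z : ℂ) (j : ℕ) : ((q : ℝ) : ℂ) ^ (2 * j + z) =
    ((q : ℝ) : ℂ) ^ (z - 1 / 2) * ((q : ℝ) : ℂ) ^ j * (sqrtQ q * ((q : ℝ) : ℂ) ^ j) := by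
  rw [Complex.cpow_add _ _ (q_ne_zero q), ← cpow_sub_half z, two_mul,
    Complex.cpow_add _ _ (q_ne_zero q), Complex.cpow_natCast]
  ring

theorem seriesTerm_eq (z : ℂ) (j : ℕ) : seriesTerm q z j =
    (((q : ℝ) : ℂ) ^ (z - 1 / 2) + sqrtQ q) * (Ring.choose (z + j - 1) j * ((q : ℝ) : ℂ) ^ j *
      ((1 - ((q : ℝ) : ℂ) ^ (z - 1 / 2) * ((q : ℝ) : ℂ) ^ j * (sqrtQ q * ((q : ℝ) : ℂ) ^ j)) /
        ((1 - ((q : ℝ) : ℂ) ^ (z - 1 / 2) * ((q : ℝ) : ℂ) ^ j) ^ 2 *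
          (1 - sqrtQ q * ((q : ℝ) : ℂ) ^ j) ^ 2))) := by
  rw [seriesTerm, cpow_sub_half_add, cpow_add_half, cpow_two_mul_add]
  ring

/-- With `N = P + n`, the eigenvalue is `q^{-P} (1 - q^N) / (q⁻¹ - q)` in absolute value. All
factors are nonnegative reals, so the complex power distributes over them. -/
theorem zpow_mul_cpow {P n : ℕ} (h : 0 < P + n) (z : ℂ) {k : ℤ} (hk : k = n - P) :
    ((Real.sqrt (q : ℝ) ^ k : ℝ) : ℂ) *
      (((Real.sqrt (q : ℝ) ^ k * qNum q ((P : ℤ) + n))⁻¹ : ℝ) : ℂ) ^ z =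
    (((q : ℝ)⁻¹ - q : ℝ) : ℂ) ^ z * (((q : ℝ) : ℂ) ^ (z - 1 / 2)) ^ P * sqrtQ q ^ n *
      (((1 - (q : ℝ) ^ (P + n))⁻¹ : ℝ) : ℂ) ^ z := by
  have hs := (sqrt_q_pos q).ne'
  have hd := q_sub_inv_neg q
  have hpow : (q : ℝ) ^ (P + n) < 1 := pow_lt_one₀ q.2.1.le q.2.2 h.ne'
  have h1 : Real.sqrt (q : ℝ) ^ k = Real.sqrt (q : ℝ) ^ ((P : ℤ) + n) * ((q : ℝ) ^ P)⁻¹ := by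
    rw [hk, show ((n : ℤ) - P) = P + n + (-2) * P by ring, zpow_add₀ hs, zpow_mul, zpow_natCast,
      zpow_neg, sqrt_q_sq, inv_pow]
  have h2 : (Real.sqrt (q : ℝ) ^ k * qNum q ((P : ℤ) + n))⁻¹ =
      ((q : ℝ)⁻¹ - q) * ((q : ℝ) ^ P * (1 - (q : ℝ) ^ (P + n))⁻¹) := by
    rw [h1, mul_right_comm, zpow_mul_qNum]
    have h3 : (q : ℝ) ^ ((P : ℤ) + n) = (q : ℝ) ^ (P + n) := by exact_mod_cast rfl
    rw [h3, mul_inv, inv_inv, inv_div]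
    ring
  have h4 : 0 ≤ (1 - (q : ℝ) ^ (P + n))⁻¹ := inv_nonneg.mpr (by linarith)
  have h5 : 0 ≤ (q : ℝ) ^ P := pow_nonneg q.2.1.le _
  have h6 : ((Real.sqrt (q : ℝ) ^ k : ℝ) : ℂ) * sqrtQ q ^ P = sqrtQ q ^ n := by
    rw [← sqrtQ_zpow, hk, zpow_sub₀ (sqrtQ_ne_zero q), zpow_natCast, zpow_natCast,
      div_mul_cancel₀ _ (pow_ne_zero _ (sqrtQ_ne_zero q))]
  rw [h2, Complex.ofReal_mul, Complex.mul_cpow_ofReal_nonneg (by linarith) (mul_nonneg h5 h4),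
    Complex.ofReal_mul, Complex.mul_cpow_ofReal_nonneg h5 h4, ofReal_pow_cpow q.2.1.le,
    ← cpow_sub_half, mul_pow, ← h6]
  ring

theorem norm_cpow_sub_half (z : ℂ) :
    ‖((q : ℝ) : ℂ) ^ (z - 1 / 2)‖ = (q : ℝ) ^ (z.re - 1 / 2) := by
  rw [Complex.norm_cpow_eq_rpow_re_of_pos q.2.1]
  norm_num

theorem norm_sqrtQ : ‖sqrtQ q‖ = Real.sqrt (q : ℝ) := by
  rw [sqrtQ, Complex.norm_real, Real.norm_of_nonneg (sqrt_q_pos q).le]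

/-- The left eigenvectors have `(P, n) = (p+1, i+j-p)` and the right ones `(p, i+j+1-p)`. Relative
to `u^p v^{i+j-p}` this is an extra `u` or `v`, whence the factor `u + v`. -/
theorem exists_hasSum_zetaTerm {z : ℂ} (hz : 1 / 2 < z.re) :
    ∃ s, HasSum (seriesTerm q z) s ∧
      HasSum (zetaTerm q z) ((((q : ℝ)⁻¹ - q : ℝ) : ℂ) ^ z * s) := by
  have hu : ‖((q : ℝ) : ℂ) ^ (z - 1 / 2)‖ < 1 := by
    rw [norm_cpow_sub_half]; exact Real.rpow_lt_one q.2.1.le q.2.2 (by linarith)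
  have hv : ‖sqrtQ q‖ < 1 := by rw [norm_sqrtQ]; exact sqrt_q_lt_one q
  obtain ⟨s, h1, h2⟩ := hasSum_weightIndex_choose (q := q) z hu hv
  refine ⟨_, (h2.mul_left (((q : ℝ) : ℂ) ^ (z - 1 / 2) + sqrtQ q)).congr_fun (seriesTerm_eq z), ?_⟩
  rw [add_mul, mul_add]
  refine HasSum.sum (((h1.mul_left _).mul_left _).congr_fun ?_)
    (((h1.mul_left _).mul_left _).congr_fun ?_)
  · rintro ⟨⟨i, j, p⟩, hp⟩
    simp only at hp
    obtain ⟨n, hn⟩ := Nat.exists_eq_add_of_le hp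
    have h := zpow_mul_cpow (q := q) (P := p + 1) (n := n) (by omega) z
      (k := (i : ℤ) + j + 1 - 2 * (p + 1 : ℕ)) (by omega)
    simp only [Function.comp, zetaTerm, eigAbs, eigWt, Sum.elim_inl]
    rw [hn, Nat.add_sub_cancel_left, show p + n + 1 = p + 1 + n by ring,
      show (i : ℤ) + j + 1 = ((p + 1 : ℕ) : ℤ) + n by omega]
    rw [show (i : ℤ) + j + 1 = ((p + 1 : ℕ) : ℤ) + n by omega] at h
    rw [h]
    ring
  · rintro ⟨⟨i, j, p⟩, hp⟩
    simp only at hp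
    obtain ⟨n, hn⟩ := Nat.exists_eq_add_of_le hp
    have h := zpow_mul_cpow (q := q) (P := p) (n := n + 1) (by omega) z
      (k := (i : ℤ) + j + 1 - 2 * p) (by omega)
    simp only [Function.comp, zetaTerm, eigAbs, eigWt, Sum.elim_inr]
    rw [hn, Nat.add_sub_cancel_left, show p + n + 1 = p + (n + 1) by ring,
      show (i : ℤ) + j + 1 = (p : ℤ) + (n + 1 : ℕ) by omega]
    rw [show (i : ℤ) + j + 1 = (p : ℤ) + (n + 1 : ℕ) by omega] at h
    rw [h]
    ring

/-! ## Meromorphic continuation -/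

open Filter Topology

theorem mem_poleSet_iff {z : ℂ} :
    z ∈ poleSet q ↔ ∃ n : ℕ, ((q : ℝ) : ℂ) ^ (z - 1 / 2 + n) = 1 := by
  have hlog : ((Real.log (q : ℝ) : ℝ) : ℂ) ≠ 0 := by
    exact_mod_cast (Real.log_neg q.2.1 q.2.2).ne
  refine exists_congr fun n => ?_
  rw [Complex.cpow_def_of_ne_zero (q_ne_zero q), Complex.exp_eq_one_iff,
    ← Complex.ofReal_log q.2.1.le]
  refine exists_congr fun m => ?_
  constructor
  · rintro rfl
    field_simp
    ring
  · intro h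
    have h2 : z = 1 / 2 - n + (m * (2 * Real.pi * Complex.I)) / ((Real.log (q : ℝ) : ℝ) : ℂ) := by
      rw [← h]; field_simp; ring
    rw [h2]
    field_simp

theorem one_sub_cpow_add_half_ne_zero (j : ℕ) :
    1 - ((q : ℝ) : ℂ) ^ ((j : ℂ) + 1 / 2) ≠ 0 ∧ 1 + ((q : ℝ) : ℂ) ^ ((j : ℂ) + 1 / 2) ≠ 0 := by
  have h : ‖((q : ℝ) : ℂ) ^ ((j : ℂ) + 1 / 2)‖ < 1 := by
    rw [Complex.norm_cpow_eq_rpow_re_of_pos q.2.1]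
    refine Real.rpow_lt_one q.2.1.le q.2.2 ?_
    have : (0 : ℝ) ≤ j := j.cast_nonneg
    simp only [Complex.add_re, Complex.natCast_re, one_div, Complex.inv_re, Complex.re_ofNat,
      Complex.normSq_ofNat]
    norm_num
    linarith
  constructor
  · intro h0; rw [← sub_eq_zero.mp h0, norm_one] at h; exact lt_irrefl _ h
  · intro h0; rw [← neg_eq_of_add_eq_zero_right h0, norm_neg, norm_one] at h; exact lt_irrefl _ h

/-- The holomorphic part of the `j`-th term of the series. -/
def seriesNum (q : Set.Ioo (0 : ℝ) 1) (j : ℕ) (z : ℂ) : ℂ :=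
  Ring.choose (z + j - 1) j *
    ((((q : ℝ) : ℂ) ^ (z - 1 / 2 + j) + ((q : ℝ) : ℂ) ^ ((j : ℂ) + 1 / 2)) *
        (1 - ((q : ℝ) : ℂ) ^ (2 * j + z))) / (1 - ((q : ℝ) : ℂ) ^ ((j : ℂ) + 1 / 2)) ^ 2

theorem seriesTerm_eq_seriesNum_div (j : ℕ) (z : ℂ) : seriesTerm q z j =
    seriesNum q j z * ((1 - ((q : ℝ) : ℂ) ^ (z - 1 / 2 + j)) ^ 2)⁻¹ := by
  rw [seriesTerm, seriesNum]
  simp only [div_eq_mul_inv, mul_inv]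
  ring

theorem differentiable_cpow_sub_half_add (c : ℂ) :
    Differentiable ℂ fun z : ℂ => ((q : ℝ) : ℂ) ^ (z - 1 / 2 + c) :=
  fun z => DifferentiableAt.const_cpow (by fun_prop) (Or.inl (q_ne_zero q))

theorem differentiable_seriesNum (j : ℕ) : Differentiable ℂ (seriesNum q j) := by
  have h1 : Differentiable ℂ fun z : ℂ => Ring.choose (z + j - 1) j := by
    simp only [choose_eq_eval]
    exact (Polynomial.differentiable _).div_const _
  have h2 : Differentiable ℂ fun z : ℂ => ((q : ℝ) : ℂ) ^ (2 * j + z) :=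
    fun z => DifferentiableAt.const_cpow (by fun_prop) (Or.inl (q_ne_zero q))
  exact (h1.mul (((differentiable_cpow_sub_half_add (q := q) j).add_const _).mul
    (h2.const_sub 1))).div_const _

theorem analyticAt_one_sub_cpow (j : ℕ) (z₀ : ℂ) :
    AnalyticAt ℂ (fun z : ℂ => 1 - ((q : ℝ) : ℂ) ^ (z - 1 / 2 + j)) z₀ :=
  ((differentiable_cpow_sub_half_add (q := q) j).const_sub 1).analyticAt z₀

theorem seriesTerm_eq_fun (j : ℕ) : (fun z => seriesTerm q z j) =
    seriesNum q j * ((fun z : ℂ => 1 - ((q : ℝ) : ℂ) ^ (z - 1 / 2 + j)) ^ 2)⁻¹ :=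
  funext fun z => seriesTerm_eq_seriesNum_div j z

theorem meromorphicAt_seriesTerm (j : ℕ) (z₀ : ℂ) :
    MeromorphicAt (fun z => seriesTerm q z j) z₀ := by
  rw [seriesTerm_eq_fun]
  exact ((differentiable_seriesNum j).analyticAt z₀).meromorphicAt.mul
    ((analyticAt_one_sub_cpow j z₀).meromorphicAt.pow 2).inv

theorem analyticAt_seriesTerm {j : ℕ} {z₀ : ℂ} (h : ((q : ℝ) : ℂ) ^ (z₀ - 1 / 2 + j) ≠ 1) :
    AnalyticAt ℂ (fun z => seriesTerm q z j) z₀ := by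
  rw [seriesTerm_eq_fun]
  refine ((differentiable_seriesNum j).analyticAt z₀).mul
    (((analyticAt_one_sub_cpow j z₀).pow 2).inv ?_)
  exact pow_ne_zero 2 (sub_ne_zero.mpr h.symm)

/-- Compare absolute values. Consequently `z` determines `n`, and only one term of the series is
singular at a given pole. -/
theorem re_of_cpow_eq_one {n : ℕ} {z : ℂ} (h : ((q : ℝ) : ℂ) ^ (z - 1 / 2 + n) = 1) :
    z.re = 1 / 2 - n := by
  have h1 := congrArg norm h
  rw [Complex.norm_cpow_eq_rpow_re_of_pos q.2.1, norm_one] at h1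
  have h2 : (z - 1 / 2 + n).re = 0 := by
    by_contra hne
    rcases lt_or_gt_of_ne hne with hlt | hgt
    · exact (Real.one_lt_rpow_of_pos_of_lt_one_of_neg q.2.1 q.2.2 hlt).ne' h1
    · exact (Real.rpow_lt_one q.2.1.le q.2.2 hgt).ne h1
  simp only [Complex.add_re, Complex.sub_re, Complex.natCast_re, one_div, Complex.inv_re,
    Complex.re_ofNat, Complex.normSq_ofNat] at h2
  norm_num at h2
  linarith

/-- The rising factorial vanishes only at integers, and the real part here is a proper half-integer.
-/
theorem choose_ne_zero_of_re {n : ℕ} {z : ℂ} (h : z.re = 1 / 2 - n) (j : ℕ) :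
    Ring.choose (z + j - 1) j ≠ 0 := by
  rw [choose_eq_eval]
  refine div_ne_zero ?_ (by exact_mod_cast j.factorial_ne_zero)
  induction j with
  | zero => simp
  | succ j ih =>
    rw [ascPochhammer_succ_eval]
    refine mul_ne_zero ih fun h0 => ?_
    have h1 := congrArg Complex.re h0
    rw [Complex.add_re, Complex.natCast_re, Complex.zero_re, h] at h1
    have h2 : (1 + 2 * j : ℝ) = 2 * n := by linarith
    have h3 : 1 + 2 * j = 2 * n := by exact_mod_cast h2
    omega

/-- With `y = q^{n+1/2}`, the numerator at the pole is the binomial coefficient times `(1 + y)(1 -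
y) / (1 - y)²`, and `|y| < 1`. -/
theorem seriesNum_ne_zero {n : ℕ} {z : ℂ} (h : ((q : ℝ) : ℂ) ^ (z - 1 / 2 + n) = 1) :
    seriesNum q n z ≠ 0 := by
  obtain ⟨h1, h2⟩ := one_sub_cpow_add_half_ne_zero (q := q) n
  have h3 : ((q : ℝ) : ℂ) ^ (2 * n + z) = ((q : ℝ) : ℂ) ^ ((n : ℂ) + 1 / 2) := by
    rw [show 2 * (n : ℂ) + z = (z - 1 / 2 + n) + (n + 1 / 2) by ring,
      Complex.cpow_add _ _ (q_ne_zero q), h, one_mul]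
  rw [seriesNum, h, h3]
  exact div_ne_zero (mul_ne_zero (choose_ne_zero_of_re (re_of_cpow_eq_one h) n)
    (mul_ne_zero h2 h1)) (pow_ne_zero 2 h1)

/-- The derivative of `1 - q^{z-1/2+n}` at its zero is `-log q ≠ 0`; this simple zero is squared in
the denominator. -/
theorem meromorphicOrderAt_seriesTerm {n : ℕ} {z₀ : ℂ}
    (h : ((q : ℝ) : ℂ) ^ (z₀ - 1 / 2 + n) = 1) :
    meromorphicOrderAt (fun z => seriesTerm q z n) z₀ = ((-2 : ℤ) : WithTop ℤ) := by
  have hlog : Complex.log ((q : ℝ) : ℂ) ≠ 0 := by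
    rw [← Complex.ofReal_log q.2.1.le]
    exact_mod_cast (Real.log_neg q.2.1 q.2.2).ne
  have ha := analyticAt_one_sub_cpow (q := q) n z₀
  have hn := (differentiable_seriesNum (q := q) n).analyticAt z₀
  have hd : HasDerivAt (fun z : ℂ => 1 - ((q : ℝ) : ℂ) ^ (z - 1 / 2 + n))
      (-(Complex.log ((q : ℝ) : ℂ))) z₀ := by
    have h1 : HasDerivAt (fun z : ℂ => z - 1 / 2 + n) 1 z₀ :=
      ((hasDerivAt_id z₀).sub_const _).add_const _
    have h2 := (h1.const_cpow (c := ((q : ℝ) : ℂ)) (Or.inl (q_ne_zero q))).const_sub 1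
    rwa [h, one_mul, mul_one] at h2
  have h1 : meromorphicOrderAt (fun z : ℂ => 1 - ((q : ℝ) : ℂ) ^ (z - 1 / 2 + n)) z₀ =
      ((1 : ℤ) : WithTop ℤ) := by
    rw [ha.meromorphicOrderAt_eq, ha.analyticOrderAt_eq_one_of_zero_deriv_ne_zero
      (by rw [h, sub_self]) (by rw [hd.deriv]; exact neg_ne_zero.mpr hlog)]
    rfl
  have h0 : meromorphicOrderAt (seriesNum q n) z₀ = ((0 : ℤ) : WithTop ℤ) := by
    rw [hn.meromorphicOrderAt_eq, hn.analyticOrderAt_eq_zero.mpr (seriesNum_ne_zero h)]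
    rfl
  rw [seriesTerm_eq_fun, meromorphicOrderAt_mul hn.meromorphicAt (ha.meromorphicAt.pow 2).inv,
    meromorphicOrderAt_inv, meromorphicOrderAt_pow ha.meromorphicAt, h0, h1]
  rfl

/-- The tail of the series converges to a holomorphic function on a neighbourhood of any point. -/
theorem exists_analytic_tail (q : Set.Ioo (0 : ℝ) 1) (z₀ : ℂ) : ∃ J : ℕ, ∃ T : ℂ → ℂ,
    AnalyticAt ℂ T z₀ ∧
    (∀ j, J ≤ j → ((q : ℝ) : ℂ) ^ (z₀ - 1 / 2 + j) ≠ 1) ∧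
    ∀ᶠ z in 𝓝 z₀, Summable (seriesTerm q z) ∧
      ∑' j, seriesTerm q z j = ∑ j ∈ Finset.range J, seriesTerm q z j + T z := by
  have hq0 := q.2.1
  have hq1 := q.2.2
  obtain ⟨k, hk⟩ := exists_nat_gt ‖z₀‖
  -- `M` bounds `|q^{z-1/2}|` on the disc `|z| < k + 1`, and `J` is taken with `M q^J < 1/2`, which
  -- keeps later denominators away from zero.
  set M : ℝ := (q : ℝ) ^ (-((k : ℝ) + 1) - 1 / 2) with hM
  have hMpos : 0 < M := Real.rpow_pos_of_pos hq0 _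
  obtain ⟨J, hJ⟩ := exists_pow_lt_of_lt_one (show (0 : ℝ) < 1 / (2 * M) by positivity) hq1
  set s := Real.sqrt (q : ℝ) with hs
  have hs1 : s < 1 := sqrt_q_lt_one q
  have hs0 : 0 < s := sqrt_q_pos q
  have hX : ∀ z ∈ Metric.ball (0 : ℂ) (k + 1), ‖((q : ℝ) : ℂ) ^ (z - 1 / 2)‖ ≤ M := by
    intro z hz
    rw [norm_cpow_sub_half]
    refine Real.rpow_le_rpow_of_exponent_ge hq0 hq1.le ?_
    have h1 := (abs_le.mp (Complex.abs_re_le_norm z)).1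
    have h2 := mem_ball_zero_iff.mp hz
    linarith
  have hnj : ∀ j : ℕ, ‖((q : ℝ) : ℂ) ^ j‖ = (q : ℝ) ^ j := fun j => by
    rw [norm_pow, Complex.norm_real, Real.norm_of_nonneg hq0.le]
  have hXj : ∀ z ∈ Metric.ball (0 : ℂ) (k + 1), ∀ j, J ≤ j →
      ‖((q : ℝ) : ℂ) ^ (z - 1 / 2) * ((q : ℝ) : ℂ) ^ j‖ ≤ 1 / 2 := by
    intro z hz j hj
    rw [norm_mul, hnj]
    calc _ ≤ M * (1 / (2 * M)) := by
          refine mul_le_mul (hX z hz) ?_ (by positivity) hMpos.le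
          exact (pow_le_pow_of_le_one hq0.le hq1.le hj).trans hJ.le
      _ = 1 / 2 := by field_simp
  have hne : ∀ z ∈ Metric.ball (0 : ℂ) (k + 1), ∀ j, J ≤ j →
      ((q : ℝ) : ℂ) ^ (z - 1 / 2 + j) ≠ 1 := by
    intro z hz j hj h
    have h1 := hXj z hz j hj
    rw [← cpow_sub_half_add, h, norm_one] at h1
    norm_num at h1
  -- The factors bound, in order, the prefactor `q^{z-1/2} + q^{1/2}`, the binomial coefficient with
  -- `q^j`, and the quotient: numerator at most `2`, denominators at least `1/2` and `1 - s` before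
  -- squaring.
  let B : ℕ → ℝ := fun j => (M + 1) * (((j + k).choose k : ℝ) * (q : ℝ) ^ j *
    (2 / ((1 / 2) ^ 2 * (1 - s) ^ 2)))
  have hB : Summable B := ((summable_choose_mul_pow k hq0.le hq1).mul_right _).mul_left _
  have hbound : ∀ z ∈ Metric.ball (0 : ℂ) (k + 1), ∀ j, J ≤ j → ‖seriesTerm q z j‖ ≤ B j := by
    intro z hz j hj
    have hqj : (q : ℝ) ^ j ≤ 1 := pow_le_one₀ hq0.le hq1.le
    have h1 := hXj z hz j hj
    have hY : ‖sqrtQ q * ((q : ℝ) : ℂ) ^ j‖ ≤ s := by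
      rw [norm_mul, hnj, norm_sqrtQ]
      exact mul_le_of_le_one_right hs0.le hqj
    have h2 : 1 / 2 ≤ ‖1 - ((q : ℝ) : ℂ) ^ (z - 1 / 2) * ((q : ℝ) : ℂ) ^ j‖ := by
      have := norm_sub_norm_le (1 : ℂ) (((q : ℝ) : ℂ) ^ (z - 1 / 2) * ((q : ℝ) : ℂ) ^ j)
      rw [norm_one] at this
      linarith
    have h3 : 1 - s ≤ ‖1 - sqrtQ q * ((q : ℝ) : ℂ) ^ j‖ := by
      have := norm_sub_norm_le (1 : ℂ) (sqrtQ q * ((q : ℝ) : ℂ) ^ j)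
      rw [norm_one] at this
      linarith
    have h4 : ‖1 - ((q : ℝ) : ℂ) ^ (z - 1 / 2) * ((q : ℝ) : ℂ) ^ j *
        (sqrtQ q * ((q : ℝ) : ℂ) ^ j)‖ ≤ 2 := by
      refine (norm_sub_le _ _).trans ?_
      rw [norm_one, norm_mul (_ * _)]
      have := mul_le_mul h1 (hY.trans hs1.le) (norm_nonneg _) (by norm_num)
      linarith
    have h5 : ‖((q : ℝ) : ℂ) ^ (z - 1 / 2) + sqrtQ q‖ ≤ M + 1 := by
      refine (norm_add_le _ _).trans (add_le_add (hX z hz) ?_)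
      rw [norm_sqrtQ]; exact hs1.le
    rw [seriesTerm_eq, norm_mul, norm_mul (_ * _), norm_mul (Ring.choose _ _), norm_div,
      norm_mul (_ ^ 2), norm_pow (1 - _ ^ (z - 1 / 2) * _), norm_pow (1 - sqrtQ q * _), hnj]
    have h6 := norm_choose_le (z := z) (k := k) (mem_ball_zero_iff.mp hz).le j
    have h7 : 0 < 1 - s := by linarith
    refine mul_le_mul h5 (mul_le_mul (mul_le_mul_of_nonneg_right h6 (by positivity)) ?_
      (by positivity) (by positivity)) (by positivity) (by positivity)
    refine div_le_div₀ (by norm_num) h4 (by positivity) ?_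
    gcongr
  have hz₀ : Metric.ball (0 : ℂ) (k + 1) ∈ 𝓝 z₀ :=
    Metric.isOpen_ball.mem_nhds (mem_ball_zero_iff.mpr (by linarith))
  have hB' := (summable_nat_add_iff J).mpr hB
  refine ⟨J, fun z => ∑' j, seriesTerm q z (j + J), ?_, hne z₀ (mem_of_mem_nhds hz₀), ?_⟩
  · refine DifferentiableOn.analyticAt (Complex.differentiableOn_tsum_of_summable_norm hB'
      (fun j z hz => ?_) Metric.isOpen_ball fun j z hz => hbound z hz _ (by omega)) hz₀
    exact (analyticAt_seriesTerm (hne z hz _ (by omega))).differentiableAt.differentiableWithinAt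
  · filter_upwards [hz₀] with z hz
    have hsum : Summable (seriesTerm q z) := (summable_nat_add_iff J).mp
      (Summable.of_norm_bounded hB' fun j => hbound z hz _ (by omega))
    exact ⟨hsum, (hsum.sum_add_tsum_nat_add J).symm⟩

/-! ### The extension and its poles -/

/-- The meromorphic extension of the zeta function. -/
def zetaExt (q : Set.Ioo (0 : ℝ) 1) (z : ℂ) : ℂ :=
  (((q : ℝ)⁻¹ - (q : ℝ) : ℝ) : ℂ) ^ z * ∑' j, seriesTerm q z j

/-- Poles need no exclusion: there division by zero gives the singular term the value `0`. -/
theorem summable_seriesTerm (q : Set.Ioo (0 : ℝ) 1) (z : ℂ) : Summable (seriesTerm q z) := by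
  obtain ⟨_, _, _, _, h⟩ := exists_analytic_tail q z
  exact h.self_of_nhds.1

theorem ofReal_inv_sub_ne_zero (q : Set.Ioo (0 : ℝ) 1) :
    (((q : ℝ)⁻¹ - (q : ℝ) : ℝ) : ℂ) ≠ 0 := by
  have := q_sub_inv_neg q
  exact_mod_cast (show (0 : ℝ) < (q : ℝ)⁻¹ - q by linarith).ne'

theorem analyticAt_const_cpow {c : ℂ} (hc : c ≠ 0) (z₀ : ℂ) : AnalyticAt ℂ (fun z => c ^ z) z₀ :=
  Differentiable.analyticAt
    (fun _ => DifferentiableAt.const_cpow differentiableAt_id (Or.inl hc)) z₀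

theorem meromorphic_zetaExt : Meromorphic (zetaExt q) := by
  intro z₀
  obtain ⟨J, T, hT, -, h⟩ := exists_analytic_tail q z₀
  have h1 : MeromorphicAt (fun z => ∑ j ∈ Finset.range J, seriesTerm q z j + T z) z₀ :=
    (MeromorphicAt.fun_sum fun j _ => meromorphicAt_seriesTerm j z₀).add hT.meromorphicAt
  have h2 : MeromorphicAt (fun z => ∑' j, seriesTerm q z j) z₀ :=
    h1.congr ((h.mono fun z hz => hz.2.symm).filter_mono nhdsWithin_le_nhds)
  exact (analyticAt_const_cpow (ofReal_inv_sub_ne_zero q) z₀).meromorphicAt.mul h2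

theorem analyticAt_zetaExt {z₀ : ℂ} (hz₀ : z₀ ∉ poleSet q) : AnalyticAt ℂ (zetaExt q) z₀ := by
  rw [mem_poleSet_iff, not_exists] at hz₀
  obtain ⟨J, T, hT, -, h⟩ := exists_analytic_tail q z₀
  have h1 : AnalyticAt ℂ (fun z => ∑ j ∈ Finset.range J, seriesTerm q z j + T z) z₀ :=
    (Finset.analyticAt_fun_sum _ fun j _ => analyticAt_seriesTerm (hz₀ j)).add hT
  exact (analyticAt_const_cpow (ofReal_inv_sub_ne_zero q) z₀).mul
    (h1.congr (h.mono fun z hz => hz.2.symm))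

/-- Only the `n`-th term is singular at `z₀`, so the sum is a term of order `-2` plus an analytic
function; the prefactor has no zeros. -/
theorem meromorphicOrderAt_zetaExt {z₀ : ℂ} (hz₀ : z₀ ∈ poleSet q) :
    meromorphicOrderAt (zetaExt q) z₀ = ((-2 : ℤ) : WithTop ℤ) := by
  obtain ⟨n, hn⟩ := mem_poleSet_iff.mp hz₀
  obtain ⟨J, T, hT, hJ, h⟩ := exists_analytic_tail q z₀
  have hnJ : n ∈ Finset.range J := Finset.mem_range.mpr (not_le.mp fun hle => hJ n hle hn)
  set g : ℂ → ℂ := fun z => ∑ j ∈ (Finset.range J).erase n, seriesTerm q z j + T z with hg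
  have hga : AnalyticAt ℂ g z₀ := by
    refine (Finset.analyticAt_fun_sum _ fun j hj => analyticAt_seriesTerm fun h1 => ?_).add hT
    have h2 := re_of_cpow_eq_one h1
    rw [re_of_cpow_eq_one hn, sub_right_inj, Nat.cast_inj] at h2
    exact (Finset.mem_erase.mp hj).1 h2.symm
  have h1 : (fun z => ∑' j, seriesTerm q z j) =ᶠ[𝓝[≠] z₀] (fun z => seriesTerm q z n) + g := by
    refine (h.mono fun z hz => ?_).filter_mono nhdsWithin_le_nhds
    rw [Pi.add_apply, hg]
    simp only
    rw [hz.2, ← Finset.add_sum_erase _ _ hnJ, add_assoc]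
  have h2 : meromorphicOrderAt (fun z => ∑' j, seriesTerm q z j) z₀ = ((-2 : ℤ) : WithTop ℤ) := by
    rw [meromorphicOrderAt_congr h1, meromorphicOrderAt_add_eq_left_of_lt hga.meromorphicAt,
      meromorphicOrderAt_seriesTerm hn]
    rw [meromorphicOrderAt_seriesTerm hn]
    refine lt_of_lt_of_le ?_ hga.meromorphicOrderAt_nonneg
    exact_mod_cast (by norm_num : (-2 : ℤ) < 0)
  have h3 : MeromorphicAt (fun z => ∑' j, seriesTerm q z j) z₀ :=
    ((meromorphicAt_seriesTerm n z₀).add hga.meromorphicAt).congr h1.symm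
  have hc := ofReal_inv_sub_ne_zero q
  have ha := analyticAt_const_cpow hc z₀
  have h4 : meromorphicOrderAt (fun z : ℂ => (((q : ℝ)⁻¹ - (q : ℝ) : ℝ) : ℂ) ^ z) z₀ =
      ((0 : ℤ) : WithTop ℤ) := by
    rw [ha.meromorphicOrderAt_eq, ha.analyticOrderAt_eq_zero.mpr]
    · rfl
    · rw [Ne, Complex.cpow_eq_zero_iff]; exact fun h => hc h.1
  have h5 : zetaExt q = (fun z : ℂ => (((q : ℝ)⁻¹ - (q : ℝ) : ℝ) : ℂ) ^ z) *
      fun z => ∑' j, seriesTerm q z j := rfl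
  rw [h5, meromorphicOrderAt_mul ha.meromorphicAt h3, h4, h2]
  rfl

theorem zetaExt_eq_zetaQ {z : ℂ} (hz : 1 / 2 < z.re) : zetaExt q z = zetaQ q z := by
  obtain ⟨s, h1, h2⟩ := exists_hasSum_zetaTerm (q := q) hz
  rw [zetaQ_eq_tsum (by linarith) h2.summable, h2.tsum_eq, zetaExt, h1.tsum_eq]

theorem notMem_poleSet {z : ℂ} (hz : 1 / 2 < z.re) : z ∉ poleSet q := by
  rw [mem_poleSet_iff]
  rintro ⟨n, hn⟩
  have h1 := re_of_cpow_eq_one hn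
  have h2 : (0 : ℝ) ≤ n := n.cast_nonneg
  linarith

theorem differentiableOn_zetaQ : DifferentiableOn ℂ (zetaQ q) {z : ℂ | 1 / 2 < z.re} :=
  DifferentiableOn.congr (fun _ hz => (analyticAt_zetaExt
    (notMem_poleSet hz)).differentiableAt.differentiableWithinAt) fun _ hz =>
      (zetaExt_eq_zetaQ hz).symm

end SUq2

end

theorem proposition4p1 (q : Set.Ioo (0 : ℝ) 1) :
    -- `D_q` is selfadjoint with a bounded inverse, and `ζ_q(z) = Ψ(|D_q|^{-z})` is well defined
    -- for `Re z > 1/2`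
    (IsSelfAdjoint (SUq2.dirac q) ∧
      (∃ R, SUq2.IsBoundedInverse (SUq2.dirac q) R) ∧
      ∀ z : ℂ, 1 / 2 < z.re → SUq2.absPowNeg (SUq2.dirac q) z ∈ SUq2.traceIdeal q) ∧
    -- it is holomorphic there
    DifferentiableOn ℂ (SUq2.zetaQ q) {z : ℂ | 1 / 2 < z.re} ∧
    -- and has a meromorphic extension, with double poles exactly in the given set, which is given
    -- by the explicit series
    ∃ Z : ℂ → ℂ, Meromorphic Z ∧
      Set.EqOn Z (SUq2.zetaQ q) {z : ℂ | 1 / 2 < z.re} ∧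
      (∀ z ∈ SUq2.poleSet q, meromorphicOrderAt Z z = ((-2 : ℤ) : WithTop ℤ)) ∧
      (∀ z ∉ SUq2.poleSet q, AnalyticAt ℂ Z z) ∧
      (∀ z ∉ SUq2.poleSet q, ∃ s : ℂ, HasSum (SUq2.seriesTerm q z) s ∧
        Z z = ((((q : ℝ)⁻¹ - (q : ℝ) : ℝ)) : ℂ) ^ z * s) := by
  open SUq2 in
  refine ⟨⟨isSelfAdjoint_dirac, exists_boundedInverse_dirac q, fun z hz => ?_⟩,
    differentiableOn_zetaQ, zetaExt q, meromorphic_zetaExt, fun z hz => zetaExt_eq_zetaQ hz,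
    fun z hz => meromorphicOrderAt_zetaExt hz, fun z hz => analyticAt_zetaExt hz, fun z _ =>
      ⟨_, (summable_seriesTerm q z).hasSum, rfl⟩⟩
  obtain ⟨s, -, h⟩ := exists_hasSum_zetaTerm (q := q) hz
  exact absPowNeg_mem_traceIdeal (by linarith) h.summable
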